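/- Let $N,G,m,L\ge 1$ be integers and $\sigma>0$. For $f\in\mathbb{R}$ let $a(f)\in\mathbb{C}^N$ be the steering vector with entries $a(f)_k=e^{j2\pi(k-\frac{N-1}{2})f}$, $k=0,\dots,N-1$. Let $f=(f_1,\dots,f_m)\in\mathbb{R}^m$, $\alpha\in\mathbb{C}^m$ with $\alpha_i\neq 0$ for all $i$, and $\gamma\in\mathbb{C}^L$, and let $$h=\sum_{i=1}^m\alpha_i\,a(f_i)+\sum_{r=0}^{L-1}\gamma_{r+1}\,a(-r/L).$$ One observes $G$ independent snapshots $y^{(g)}=S_g h+n^{(g)}$, $g=1,\dots,G$, where the known pilot matrices $S_g\in\mathbb{C}^{N\times N}$ are diagonal with $S_g^{\mathsf H}S_g=I_N$ and the $n^{(g)}\sim\mathcal{CN}(0,\sigma^2I_N)$ are independent and circular. Let $J^\theta$ be the Fisher information matrix of $(y^{(1)},\dots,y^{(G)})$ for the complexified parameter $\theta=[f^\top,\alpha^\top,\gamma^\top,\alpha^{\mathsf H},\gamma^{\mathsf H}]^\top$, that is $$(J^\theta)_{a,b}=\mathbb{E}\big[\overline{\partial_{\theta_a}\log p(y;\theta)}\;\partial_{\theta_b}\log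 p(y;\theta)\big],$$ with real derivatives in the $f_i$ and Wirtinger derivatives in the $\alpha_i,\gamma_r$ and their conjugates. Let $\mathrm{CRB}(f_i),\mathrm{CRB}(\alpha_i),\mathrm{CRB}(\gamma_r)$ be the corresponding diagonal entries of $(J^\theta)^{-1}$. Let $$\delta_{\mathrm s}=\min_{i\ne j}\min_{k\in\mathbb{Z}}|f_i-f_j+k|,\qquad \delta_{\mathrm{s\text{-}d}}=\min_i\min_{r\in\mathbb{Z}}|f_i-r/L|,\qquad \delta=\min(\delta_{\mathrm s},\delta_{\mathrm{s\text{-}d}})$$ (with $\delta_{\mathrm s}=+\infty$ if $m=1$), and $$K_{\min}=\frac{1}{G(1+2(N\delta)^{-1})},\qquad K_{\max}=\frac{1}{G(1-2(N\delta)^{-1})}.$$ If $3m+3L\le 2N$ and $N\delta>2$, then the score is square integrable, $J^\theta$ is positive definite (so that the bounds are well defined), and for all $1\le i\le m$ and $1\le r\le L$, $$K_{\min}|\alpha_i|^{-2}\sigma^2\le \frac{2\pi^2N(N-1)(N+1)}{3}\,\mathrm{CRB}(f_i)\le K_{\max}|\alpha_i|^{-2}\sigma^2,$$ $$K_{\min}\frac{\sigma^2}{N}\le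 \mathrm{CRB}(\alpha_i)\le K_{\max}\frac{\sigma^2}{N},\qquad K_{\min}\frac{\sigma^2}{N}\le \mathrm{CRB}(\gamma_r)\le K_{\max}\frac{\sigma^2}{N}.$$ -/

import Mathlib

open scoped ENNReal ComplexOrder ComplexConjugate

noncomputable section

namespace HybridChannel

/-! ### The hybrid sparse/diffuse channel -/

/-- The steering vector
`a(f) = [exp(-j2π (N-1)/2 f), exp(-j2π (N-3)/2 f), …, exp(j2π (N-1)/2 f)]`. -/
def steering (N : ℕ) (f : ℝ) : Fin N → ℂ := fun k =>
  Complex.exp (2 * (Real.pi : ℂ) * Complex.I * (((k : ℕ) : ℂ) - ((N : ℂ) - 1) / 2) * (f : ℂ))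

/-- `A_f = [a(f_1), …, a(f_m)]`. -/
def sparseDict (N : ℕ) {m : ℕ} (f : Fin m → ℝ) : Matrix (Fin N) (Fin m) ℂ :=
  Matrix.of fun k i => steering N (f i) k

/-- `D = [a(0), a(-1/L), …, a(-(L-1)/L)]`. -/
def diffuseDict (N L : ℕ) : Matrix (Fin N) (Fin L) ℂ :=
  Matrix.of fun k r => steering N (-(((r : ℕ) : ℝ) / (L : ℝ))) k

/-- The channel response `h = A_f α + D γ`. -/
def channel (N : ℕ) {m L : ℕ} (f : Fin m → ℝ) (α : Fin m → ℂ) (γ : Fin L → ℂ) : Fin N → ℂ :=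
  (sparseDict N f).mulVec α + (diffuseDict N L).mulVec γ

/-- The pilot matrix `S = diag(s_0, …, s_{N-1})`. -/
def pilot {N : ℕ} (s : Fin N → ℂ) : Matrix (Fin N) (Fin N) ℂ := Matrix.diagonal s

/-! ### Minimum separations -/

/-- `δ_s = min_{i ≠ j} min_{k ∈ ℤ} |f_i - f_j + k|` (`∞` if there is a single frequency). -/
def sepSparse {m : ℕ} (f : Fin m → ℝ) : ℝ≥0∞ :=
  ⨅ (i : Fin m) (j : Fin m) (_ : i ≠ j) (k : ℤ), ENNReal.ofReal |f i - f j + (k : ℝ)|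

/-- `δ_{s-d} = min_i min_{r ∈ ℤ} |f_i - r/L|`. -/
def sepSparseDiffuse (L : ℕ) {m : ℕ} (f : Fin m → ℝ) : ℝ≥0∞ :=
  ⨅ (i : Fin m) (r : ℤ), ENNReal.ofReal |f i - (r : ℝ) / (L : ℝ)|

/-- `δ = min(δ_s, δ_{s-d})`, a real number as soon as there is at least one frequency. -/
def minSep (L : ℕ) {m : ℕ} (f : Fin m → ℝ) : ℝ :=
  (min (sepSparse f) (sepSparseDiffuse L f)).toReal

/-! ### The statistical model -/

/-- The density, with respect to Lebesgue measure on `ℂ^N`, of the circular complex Gaussian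
distribution `CN(0, σ² I_N)`. -/
def circGaussianDensity (N : ℕ) (σ : ℝ) (z : Fin N → ℂ) : ℝ :=
  (Real.pi * σ ^ 2)⁻¹ ^ N * Real.exp (-(∑ k, ‖z k‖ ^ 2) / σ ^ 2)

/-- The likelihood of the `G` snapshots `y^(1), …, y^(G)`, where `y^(g) = S_g h + n^(g)` and the
noises `n^(g)` are independent with distribution `CN(0, σ² I_N)`. -/
def likelihood {N G m L : ℕ} (σ : ℝ) (s : Fin G → Fin N → ℂ)
    (f : Fin m → ℝ) (α : Fin m → ℂ) (γ : Fin L → ℂ) (y : Fin G → Fin N → ℂ) : ℝ :=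
  ∏ g, circGaussianDensity N σ (y g - (pilot (s g)).mulVec (channel N f α γ))

/-- The log-likelihood. -/
def logLikelihood {N G m L : ℕ} (σ : ℝ) (s : Fin G → Fin N → ℂ)
    (f : Fin m → ℝ) (α : Fin m → ℂ) (γ : Fin L → ℂ) (y : Fin G → Fin N → ℂ) : ℝ :=
  Real.log (likelihood σ s f α γ y)

/-- The joint law of the `G` snapshots. -/
def obsLaw {N G m L : ℕ} (σ : ℝ) (s : Fin G → Fin N → ℂ)
    (f : Fin m → ℝ) (α : Fin m → ℂ) (γ : Fin L → ℂ) :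
    MeasureTheory.Measure (Fin G → Fin N → ℂ) :=
  MeasureTheory.volume.withDensity fun y => ENNReal.ofReal (likelihood σ s f α γ y)

/-! ### Fisher information and Cramér-Rao bounds in complexified coordinates -/

/-- The Wirtinger derivative `∂F/∂z = (∂F/∂x - j ∂F/∂y) / 2`. -/
def wirtinger (F : ℂ → ℝ) (z : ℂ) : ℂ :=
  (((deriv (fun t : ℝ => F (z + (t : ℂ))) 0 : ℝ) : ℂ)
    - Complex.I * ((deriv (fun t : ℝ => F (z + (t : ℂ) * Complex.I)) 0 : ℝ) : ℂ)) / 2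

/-- The conjugate Wirtinger derivative `∂F/∂z̄ = (∂F/∂x + j ∂F/∂y) / 2`. -/
def wirtingerConj (F : ℂ → ℝ) (z : ℂ) : ℂ :=
  (((deriv (fun t : ℝ => F (z + (t : ℂ))) 0 : ℝ) : ℂ)
    + Complex.I * ((deriv (fun t : ℝ => F (z + (t : ℂ) * Complex.I)) 0 : ℝ) : ℂ)) / 2

/-- Indices of the `3m + 2L` coordinates of `θ = [fᵀ, αᵀ, γᵀ, αᴴ, γᴴ]ᵀ`, in this order. -/
abbrev ParamIdx (m L : ℕ) : Type :=
  Fin m ⊕ ((Fin m ⊕ Fin L) ⊕ (Fin m ⊕ Fin L))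

/-- The index of `f_i` in `θ`. -/
def idxFreq {m : ℕ} (L : ℕ) (i : Fin m) : ParamIdx m L := Sum.inl i

/-- The index of `α_i` in `θ`. -/
def idxSparse {m : ℕ} (L : ℕ) (i : Fin m) : ParamIdx m L := Sum.inr (Sum.inl (Sum.inl i))

/-- The index of `γ_r` in `θ`. -/
def idxDiffuse (m : ℕ) {L : ℕ} (r : Fin L) : ParamIdx m L := Sum.inr (Sum.inl (Sum.inr r))

/-- The score: the derivatives of the log-likelihood with respect to the coordinates of `θ`. -/
def score {N G m L : ℕ} (σ : ℝ) (s : Fin G → Fin N → ℂ)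
    (f : Fin m → ℝ) (α : Fin m → ℂ) (γ : Fin L → ℂ) :
    ParamIdx m L → (Fin G → Fin N → ℂ) → ℂ
  | Sum.inl i, y =>
      ((deriv (fun t : ℝ => logLikelihood σ s (Function.update f i t) α γ y) (f i) : ℝ) : ℂ)
  | Sum.inr (Sum.inl (Sum.inl i)), y =>
      wirtinger (fun z => logLikelihood σ s f (Function.update α i z) γ y) (α i)
  | Sum.inr (Sum.inl (Sum.inr r)), y =>
      wirtinger (fun z => logLikelihood σ s f α (Function.update γ r z) y) (γ r)
  | Sum.inr (Sum.inr (Sum.inl i)), y =>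
      wirtingerConj (fun z => logLikelihood σ s f (Function.update α i z) γ y) (α i)
  | Sum.inr (Sum.inr (Sum.inr r)), y =>
      wirtingerConj (fun z => logLikelihood σ s f α (Function.update γ r z) y) (γ r)

/-- The Fisher information matrix `J^θ`, with entries
`J_{a b} = E[conj(∂_a log p(y; θ)) ∂_b log p(y; θ)]`. -/
def fisherInfo {N G m L : ℕ} (σ : ℝ) (s : Fin G → Fin N → ℂ)
    (f : Fin m → ℝ) (α : Fin m → ℂ) (γ : Fin L → ℂ) :
    Matrix (ParamIdx m L) (ParamIdx m L) ℂ :=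
  Matrix.of fun a b =>
    ∫ y, conj (score σ s f α γ a y) * score σ s f α γ b y ∂(obsLaw σ s f α γ)

/-- The Cramér-Rao bound on a coordinate of `θ`: the corresponding diagonal entry of `(J^θ)⁻¹`. -/
def crb {N G m L : ℕ} (σ : ℝ) (s : Fin G → Fin N → ℂ)
    (f : Fin m → ℝ) (α : Fin m → ℂ) (γ : Fin L → ℂ) (a : ParamIdx m L) : ℝ :=
  ((fisherInfo σ s f α γ)⁻¹ a a).re

/-- `K_min = 1 / (G (1 + 2 (N δ)⁻¹))`. -/
def Kmin (G N : ℕ) (δ : ℝ) : ℝ := 1 / ((G : ℝ) * (1 + 2 * ((N : ℝ) * δ)⁻¹))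

/-- `K_max = 1 / (G (1 - 2 (N δ)⁻¹))`. -/
def Kmax (G N : ℕ) (δ : ℝ) : ℝ := 1 / ((G : ℝ) * (1 - 2 * ((N : ℝ) * δ)⁻¹))

end HybridChannel

end

noncomputable section

namespace HybridChannel

open MeasureTheory Matrix

/-! The score is a real-linear functional of the noise `y - S h`. The noise satisfies `E[n n'] = 0`
and `E[conj n n'] = σ²` or `0`, and the pilots have unit modulus, so the Fisher information is `(G /
σ²)` times a deterministic Gram matrix `gram` (`fisherInfo_eq`). Its diagonal is `N` at an amplitude
and `8π²|α_i|² N(N²-1)/12` at a frequency. Put `x = N δ` and `κ = 1 - 2/x`. Everything reduces to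
comparing `(J⁻¹)_aa` with `1 / J_aa` for `J = gram`.

The lower bound is Cauchy-Schwarz, `(J⁻¹)_aa ≥ 1 / J_aa`, and already gives `1/G ≥ K_min`. The upper
bound `(J⁻¹)_aa ≤ 1 / (κ J_aa)` combines two ingredients.

(1) A diagonal minorant `D ≤ J` (`confluent_lower_bound`, `gramLower_le`), of large-sieve type.
Modulated bumps placed on disjoint arcs of length `δ` around the nodes are orthogonal, so Parseval
evaluates exactly the sum over all integers of a confluent exponential sum weighted by `(H² - (ω -
r)²)|g(ω - r)|²`, where `g` is the Fourier transform of a raised cosine. This weight is negative off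
a bounded interval and `|g| ≤ 1`, so a suitable multiple of the lobe at `r` plus the lobe at `-r`
lies below the indicator of the observation window. The surviving diagonal weights are fractions `A`
and `B` of the diagonal of `J`, up to replacing `N³` by `N(N²-1)`.

(2) A bound on the off-diagonal mass of each column, `∑ |J_ja|² / d_j` (`freq_column_le`,
`amp_column_le`). The entries are moments of the Dirichlet kernel; closed forms bound them by powers
of `1 / sin²`, and `∑ 1 / sin²(π(t_j - t_i)) ≤ 1 / (3δ²)` follows from the partial fractions of `π²
/ sin²` and `ζ(2)`.

These are merged by `inv_diag_le_of_moment`: `D ≤ J` gives `J⁻¹ ≤ D⁻¹`, and testing this on `J e_a -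
r e_a` bounds `(J⁻¹)_aa` by a quadratic expression in `1/r`, which is optimised. The minorant alone
is good enough for `x` near `2`, and the mass estimate takes over for larger `x`. What remains is a
choice of `H`, `r` and `w` for each `x > 2` (`exists_admissible`), verified through explicit
polynomial inequalities. -/

/-! ### Characters of the circle and Parseval's identity on disjoint arcs -/

/-- The character `x ↦ exp(2πi x)`. -/
def phase (x : ℝ) : ℂ := Complex.exp (((2 * Real.pi * x : ℝ) : ℂ) * Complex.I)

lemma phase_add (x y : ℝ) : phase (x + y) = phase x * phase y := by
  simp only [phase, ← Complex.exp_add]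
  congr 1
  push_cast
  ring

@[simp] lemma norm_phase (x : ℝ) : ‖phase x‖ = 1 := Complex.norm_exp_ofReal_mul_I _

@[simp] lemma phase_zero : phase 0 = 1 := by simp [phase]

lemma phase_int (n : ℤ) : phase n = 1 := by
  rw [phase, Complex.exp_eq_one_iff]
  exact ⟨n, by push_cast; ring⟩

lemma conj_phase (x : ℝ) : conj (phase x) = phase (-x) := by
  rw [phase, phase, ← Complex.exp_conj, map_mul, Complex.conj_ofReal, Complex.conj_I]
  congr 1
  push_cast
  ring

lemma phase_eq_cos_add_sin (x : ℝ) :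
    phase x = (Real.cos (2 * Real.pi * x) : ℂ) + (Real.sin (2 * Real.pi * x) : ℂ) * Complex.I := by
  rw [phase, Complex.exp_mul_I, Complex.ofReal_cos, Complex.ofReal_sin]

@[fun_prop] lemma continuous_phase : Continuous phase := by
  unfold phase
  fun_prop

lemma hasDerivAt_phase_mul (c v : ℝ) :
    HasDerivAt (fun v : ℝ => phase (c * v))
      (2 * Real.pi * c * Complex.I * phase (c * v)) v := by
  have h1 : HasDerivAt (fun v : ℝ => ((2 * Real.pi * (c * v) : ℝ) : ℂ) * Complex.I)
      (((2 * Real.pi * (c * 1) : ℝ) : ℂ) * Complex.I) v :=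
    ((((hasDerivAt_id v).const_mul c).const_mul (2 * Real.pi)).ofReal_comp).mul_const _
  have h2 := h1.cexp
  refine h2.congr_deriv ?_
  rw [phase]
  push_cast
  ring

/-- The restriction of `κ` to the arc `|s| < δ / 2`, extended by zero. -/
def arcBump (δ : ℝ) (κ : ℝ → ℂ) (s : ℝ) : ℂ := if |s| < δ / 2 then κ s else 0

/-- The `1`-periodic function that is `κ` on the arc of length `δ` centred at `τ`. -/
def arcPeriodic (δ τ : ℝ) (κ : ℝ → ℂ) (t : ℝ) : ℂ :=
  arcBump δ κ (t - τ - (round (t - τ) : ℤ))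

lemma arcPeriodic_periodic (δ τ : ℝ) (κ : ℝ → ℂ) : Function.Periodic (arcPeriodic δ τ κ) 1 := by
  intro t
  have : t + 1 - τ = (t - τ) + 1 := by ring
  unfold arcPeriodic
  rw [this, round_add_one]
  congr 1
  push_cast
  ring

lemma phase_neg_int_periodic (n : ℤ) : Function.Periodic (fun t : ℝ => phase (-(n * t))) 1 := by
  intro t
  have : -((n : ℝ) * (t + 1)) = -(n * t) + ((-n : ℤ) : ℝ) := by push_cast; ring
  simp only [this, phase_add, phase_int, mul_one]

lemma measurable_arcBump (δ : ℝ) {κ : ℝ → ℂ} (hκ : Continuous κ) : Measurable (arcBump δ κ) :=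
  Measurable.ite (measurableSet_lt measurable_norm measurable_const) hκ.measurable
    measurable_const

lemma measurable_arcPeriodic (δ τ : ℝ) {κ : ℝ → ℂ} (hκ : Continuous κ) :
    Measurable (arcPeriodic δ τ κ) := by
  refine (measurable_arcBump δ hκ).comp ?_
  have : Measurable fun t : ℝ => ((round (t - τ) : ℤ) : ℝ) :=
    (measurable_of_countable _).comp (by
      simp only [round_eq]
      exact Int.measurable_floor.comp (by fun_prop))
  fun_prop

lemma exists_norm_arcPeriodic_le (δ τ : ℝ) {κ : ℝ → ℂ} (hκ : Continuous κ) :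
    ∃ C, ∀ t, ‖arcPeriodic δ τ κ t‖ ≤ C := by
  obtain ⟨C, hC⟩ := (isCompact_Icc (a := -(δ / 2)) (b := δ / 2)).exists_bound_of_continuousOn
    hκ.continuousOn
  refine ⟨max C 0, fun t => ?_⟩
  unfold arcPeriodic arcBump
  split_ifs with h
  · exact (hC _ (abs_le.mp h.le)).trans (le_max_left _ _)
  · simp

/-- Moving the period to the unit interval centred at `τ` makes the rounding in `arcPeriodic`
disappear. The integrand `F` is left general because Parseval needs both `F t z = phase (-(n t)) z`
(coefficients) and `F t z = ‖z‖²` (energy). -/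
lemma integral_periodic_arc {δ : ℝ} (hδ0 : 0 ≤ δ) (hδ : δ ≤ 1) (τ : ℝ) (κ : ℝ → ℂ)
    {E : Type*} [NormedAddCommGroup E] [NormedSpace ℝ E]
    (F : ℝ → ℂ → E) (hF : ∀ z, Function.Periodic (fun t => F t z) 1) (h0 : ∀ t, F t 0 = 0) (a : ℝ) :
    ∫ t in a..a + 1, F t (arcPeriodic δ τ κ t)
      = ∫ s in (-(δ / 2))..(δ / 2), F (s + τ) (κ s) := by
  have hp : Function.Periodic (fun t => F t (arcPeriodic δ τ κ t)) 1 := by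
    intro t
    simp only [arcPeriodic_periodic δ τ κ t]
    exact hF _ t
  rw [hp.intervalIntegral_add_eq a (-(1 / 2) + τ)]
  have e1 : (-(1 / 2) + τ + 1 : ℝ) = 1 / 2 + τ := by ring
  rw [e1, ← intervalIntegral.integral_comp_add_right (fun t => F t (arcPeriodic δ τ κ t)) τ]
  have e2 : ∫ s in (-(1 / 2) : ℝ)..(1 / 2), F (s + τ) (arcPeriodic δ τ κ (s + τ))
      = ∫ s in (-(1 / 2) : ℝ)..(1 / 2), (Set.Ioo (-(δ / 2)) (δ / 2)).indicator
          (fun s => F (s + τ) (κ s)) s := by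
    -- Open intervals are needed because `1/2` rounds to `1`, not to `0`.
    rw [intervalIntegral.integral_of_le (by norm_num), intervalIntegral.integral_of_le (by norm_num),
      ← integral_Ioc_eq_integral_Ioo.symm, ← integral_Ioc_eq_integral_Ioo.symm]
    refine setIntegral_congr_fun measurableSet_Ioo fun s hs => ?_
    have hr : round s = 0 := round_eq_zero_iff.mpr ⟨hs.1.le, hs.2⟩
    simp only [arcPeriodic, arcBump, add_sub_cancel_right, hr, Int.cast_zero, sub_zero,
      Set.indicator, Set.mem_Ioo, ← abs_lt]
    split_ifs <;> simp [h0]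
  rw [e2, intervalIntegral.integral_of_le (by norm_num), intervalIntegral.integral_of_le (by linarith),
    setIntegral_indicator measurableSet_Ioo, integral_Ioc_eq_integral_Ioo,
    Set.inter_eq_self_of_subset_right]
  exact fun s hs => ⟨by linarith [hs.1], by linarith [hs.2]⟩

/-- A point within `δ/2` of both `τ` and `τ'` modulo `1` would put `τ - τ'` within less than `δ` of
an integer. -/
lemma arcPeriodic_eq_zero_or {δ τ τ' : ℝ} (hsep : ∀ k : ℤ, δ ≤ |τ - τ' + k|) (κ κ' : ℝ → ℂ)
    (t : ℝ) : arcPeriodic δ τ κ t = 0 ∨ arcPeriodic δ τ' κ' t = 0 := by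
  unfold arcPeriodic arcBump
  by_cases h1 : |t - τ - (round (t - τ) : ℤ)| < δ / 2
  · right
    rw [if_neg]
    intro h2
    have h3 := hsep (round (t - τ) - round (t - τ'))
    have h4 : τ - τ' + ((round (t - τ) - round (t - τ') : ℤ) : ℝ)
        = (t - τ' - (round (t - τ') : ℤ)) - (t - τ - (round (t - τ) : ℤ)) := by
      push_cast
      ring
    rw [h4] at h3
    linarith [abs_sub (t - τ' - (round (t - τ') : ℤ)) (t - τ - (round (t - τ) : ℤ))]
  · left
    rw [if_neg h1]

lemma norm_sq_sum_of_disjoint {ι : Type*} (s : Finset ι) (z : ι → ℂ)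
    (h : ∀ i j, i ≠ j → z i = 0 ∨ z j = 0) : ‖∑ i ∈ s, z i‖ ^ 2 = ∑ i ∈ s, ‖z i‖ ^ 2 := by
  by_cases hz : ∃ i ∈ s, z i ≠ 0
  · obtain ⟨i, hi, hzi⟩ := hz
    have h0 : ∀ j ∈ s, j ≠ i → z j = 0 := fun j _ hj => (h i j hj.symm).resolve_left hzi
    rw [Finset.sum_eq_single_of_mem i hi h0,
      Finset.sum_eq_single_of_mem i hi fun j hj hne => by simp [h0 j hj hne]]
  · push Not at hz
    rw [Finset.sum_eq_zero hz, Finset.sum_eq_zero fun j hj => by simp [hz j hj]]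
    simp

/-- Parseval's identity for a sum of functions supported on disjoint arcs of the circle. -/
theorem hasSum_norm_sq_arcs {ι : Type*} [Fintype ι] {δ : ℝ} (hδ0 : 0 ≤ δ) (hδ : δ ≤ 1) (τ : ι → ℝ)
    (hsep : ∀ i j, i ≠ j → ∀ k : ℤ, δ ≤ |τ i - τ j + k|) (κ : ι → ℝ → ℂ)
    (hκ : ∀ i, Continuous (κ i)) :
    HasSum (fun n : ℤ => ‖∑ i, phase (-(n * τ i)) *
        ∫ s in (-(δ / 2))..(δ / 2), phase (-(n * s)) * κ i s‖ ^ 2)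
      (∑ i, ∫ s in (-(δ / 2))..(δ / 2), ‖κ i s‖ ^ 2) := by
  set P : ℝ → ℂ := fun t => ∑ i, arcPeriodic δ (τ i) (κ i) t with hP
  have hmeas : ∀ i, Measurable (arcPeriodic δ (τ i) (κ i)) :=
    fun i => measurable_arcPeriodic _ _ (hκ i)
  choose C hC using fun i => exists_norm_arcPeriodic_le δ (τ i) (hκ i)
  have hL : MemLp P 2 (volume.restrict (Set.Ioc (0 : ℝ) (0 + 1))) := by
    refine MemLp.of_bound (Measurable.aestronglyMeasurable (by fun_prop)) (∑ i, C i)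
      (ae_of_all _ fun t => ?_)
    exact (norm_sum_le _ _).trans (Finset.sum_le_sum fun i _ => hC i t)
  have hint : ∀ (i) (g : ℝ → ℂ), Continuous g → IntervalIntegrable
      (fun t => g t * arcPeriodic δ (τ i) (κ i) t) volume 0 (0 + 1) := by
    intro i g hg
    rw [intervalIntegrable_iff_integrableOn_Ioc_of_le (by norm_num)]
    obtain ⟨D, hD⟩ := (isCompact_Icc (a := (0 : ℝ)) (b := 0 + 1)).exists_bound_of_continuousOn
      hg.continuousOn
    refine Integrable.mono' (g := fun _ => D * C i) (integrable_const _)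
      ((hg.measurable.mul (hmeas i)).aestronglyMeasurable) ?_
    refine (ae_restrict_iff' measurableSet_Ioc).mpr (ae_of_all _ fun t ht => ?_)
    rw [norm_mul]
    exact mul_le_mul (hD t ⟨ht.1.le, ht.2⟩) (hC i t) (norm_nonneg _)
      ((norm_nonneg _).trans (hD t ⟨ht.1.le, ht.2⟩))
  have hmain := hasSum_sq_fourierCoeffOn (a := 0) (b := 0 + 1) (by norm_num) hL
  convert hmain using 1
  · funext n
    congr 2
    rw [fourierCoeffOn_eq_integral]
    have hf : ∀ x : ℝ, (fourier (-n) (x : AddCircle ((0 : ℝ) + 1 - 0)) : ℂ) = phase (-(n * x)) := by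
      intro x
      rw [fourier_coe_apply, phase]
      congr 1
      push_cast
      ring
    simp only [hf, smul_eq_mul, hP, Finset.mul_sum]
    rw [intervalIntegral.integral_finsetSum fun i _ => hint i _ (by fun_prop)]
    simp only [zero_add, sub_zero, div_one, one_smul]
    refine Finset.sum_congr rfl fun i _ => ?_
    have := integral_periodic_arc hδ0 hδ (τ i) (κ i) (fun t z => phase (-(n * t)) * z)
      (fun z t => by simp only [phase_neg_int_periodic n t]) (fun t => by simp) 0
    rw [zero_add] at this
    rw [this, ← intervalIntegral.integral_const_mul]
    refine intervalIntegral.integral_congr fun s _ => ?_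
    rw [← mul_assoc, ← phase_add]
    congr 2
    ring
  · have hpt : ∀ t, ‖P t‖ ^ 2 = ∑ i, ‖arcPeriodic δ (τ i) (κ i) t‖ ^ 2 := fun t =>
      norm_sq_sum_of_disjoint _ _ fun i j hij => arcPeriodic_eq_zero_or (hsep i j hij) _ _ t
    simp only [hpt]
    rw [intervalIntegral.integral_finsetSum]
    · simp only [zero_add, sub_zero, inv_one, one_smul]
      refine Finset.sum_congr rfl fun i _ => ?_
      have := integral_periodic_arc hδ0 hδ (τ i) (κ i) (fun _ z => ‖z‖ ^ 2)
        (fun z t => rfl) (fun t => by simp) 0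
      rw [zero_add] at this
      exact this.symm
    · intro i _
      rw [intervalIntegrable_iff_integrableOn_Ioc_of_le (by norm_num)]
      refine Integrable.mono' (g := fun _ => C i ^ 2) (integrable_const _)
        (((hmeas i).norm.pow_const 2).aestronglyMeasurable) (ae_of_all _ fun t => ?_)
      rw [norm_pow, norm_norm]
      exact pow_le_pow_left₀ (norm_nonneg _) (hC i t) 2

/-! ### A band-limited minorant of the observation window -/

/-- The Fourier transform of the raised cosine `1 + cos (2πv)` on `[-1/2, 1/2]`. -/
def raisedCosFT (ω : ℝ) : ℂ :=
  ∫ v in (-(1 / 2) : ℝ)..(1 / 2), phase (-(ω * v)) * ((1 + Real.cos (2 * Real.pi * v) : ℝ) : ℂ)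

lemma cos_two_pi_mul_half : Real.cos (2 * Real.pi * (1 / 2)) = -1 := by
  rw [show 2 * Real.pi * (1 / 2) = Real.pi by ring, Real.cos_pi]

lemma sin_two_pi_mul_half : Real.sin (2 * Real.pi * (1 / 2)) = 0 := by
  rw [show 2 * Real.pi * (1 / 2) = Real.pi by ring, Real.sin_pi]

lemma integral_one_add_cos :
    ∫ v in (-(1 / 2) : ℝ)..(1 / 2), (1 + Real.cos (2 * Real.pi * v)) = 1 := by
  have h : ∀ v : ℝ, HasDerivAt (fun v => v + Real.sin (2 * Real.pi * v) / (2 * Real.pi))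
      (1 + Real.cos (2 * Real.pi * v)) v := by
    intro v
    have h1 : HasDerivAt (fun v : ℝ => 2 * Real.pi * v) (2 * Real.pi * 1) v :=
      (hasDerivAt_id v).const_mul _
    refine ((hasDerivAt_id v).add (h1.sin.div_const _)).congr_deriv ?_
    field_simp
  rw [intervalIntegral.integral_eq_sub_of_hasDerivAt (fun v _ => h v)
    (Continuous.intervalIntegrable (by fun_prop) _ _), mul_neg, Real.sin_neg, sin_two_pi_mul_half]
  norm_num

lemma norm_raisedCosFT_le (ω : ℝ) : ‖raisedCosFT ω‖ ≤ 1 := by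
  have h0 : ∀ v : ℝ, 0 ≤ 1 + Real.cos (2 * Real.pi * v) := fun v => by
    linarith [Real.neg_one_le_cos (2 * Real.pi * v)]
  rw [← integral_one_add_cos]
  refine (intervalIntegral.norm_integral_le_integral_norm (by norm_num)).trans (le_of_eq ?_)
  refine intervalIntegral.integral_congr fun v _ => ?_
  simp only [norm_mul, norm_phase, one_mul, Complex.norm_real, Real.norm_of_nonneg (h0 v)]

lemma hasDerivAt_phase_neg_mul (ω v : ℝ) : HasDerivAt (fun v : ℝ => phase (-(ω * v)))
    (-(2 * Real.pi * ω * Complex.I * phase (-(ω * v)))) v := by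
  have := hasDerivAt_phase_mul (-ω) v
  simp only [neg_mul] at this
  refine this.congr_deriv ?_
  push_cast
  ring

/-- Integration by parts against a character, for a function vanishing at both ends. -/
lemma integral_phase_mul_deriv (ω : ℝ) {p p' : ℝ → ℝ} (hp : ∀ v, HasDerivAt p (p' v) v)
    (hp' : Continuous p') (h1 : p (1 / 2) = 0) (h2 : p (-(1 / 2)) = 0) :
    ∫ v in (-(1 / 2) : ℝ)..(1 / 2), phase (-(ω * v)) * (p' v : ℂ)
      = 2 * Real.pi * ω * Complex.I *
        ∫ v in (-(1 / 2) : ℝ)..(1 / 2), phase (-(ω * v)) * (p v : ℂ) := by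
  have hpc : Continuous p := continuous_iff_continuousAt.mpr fun v => (hp v).continuousAt
  have hd : ∀ v : ℝ, HasDerivAt (fun v => phase (-(ω * v)) * (p v : ℂ))
      (phase (-(ω * v)) * (p' v : ℂ)
        - 2 * Real.pi * ω * Complex.I * (phase (-(ω * v)) * (p v : ℂ))) v := by
    intro v
    refine ((hasDerivAt_phase_neg_mul ω v).mul (hp v).ofReal_comp).congr_deriv ?_
    ring
  have := intervalIntegral.integral_eq_sub_of_hasDerivAt (a := -(1 / 2)) (b := 1 / 2)
    (fun v _ => hd v) (Continuous.intervalIntegrable (by fun_prop) _ _)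
  rw [intervalIntegral.integral_sub (Continuous.intervalIntegrable (by fun_prop) _ _)
    (Continuous.intervalIntegrable (by fun_prop) _ _), h1, h2,
    intervalIntegral.integral_const_mul] at this
  simpa [sub_eq_zero] using this

lemma hasDerivAt_cos_two_pi (v : ℝ) : HasDerivAt (fun v => 1 + Real.cos (2 * Real.pi * v))
    (-(2 * Real.pi) * Real.sin (2 * Real.pi * v)) v := by
  have h1 : HasDerivAt (fun v : ℝ => 2 * Real.pi * v) (2 * Real.pi * 1) v :=
    (hasDerivAt_id v).const_mul _
  refine (h1.cos.const_add 1).congr_deriv ?_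
  ring

lemma hasDerivAt_sin_two_pi (v : ℝ) : HasDerivAt (fun v => -(2 * Real.pi) * Real.sin (2 * Real.pi * v))
    (-(2 * Real.pi) ^ 2 * Real.cos (2 * Real.pi * v)) v := by
  have h1 : HasDerivAt (fun v : ℝ => 2 * Real.pi * v) (2 * Real.pi * 1) v :=
    (hasDerivAt_id v).const_mul _
  refine (h1.sin.const_mul _).congr_deriv ?_
  ring

/-- The sine is, up to a factor, the derivative of the raised cosine, which vanishes at both ends;
integrating by parts therefore only multiplies the transform by the frequency. This is how the
factor `ω` of a confluent atom is produced inside an arc. -/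
lemma integral_phase_mul_sin (ω : ℝ) :
    ∫ v in (-(1 / 2) : ℝ)..(1 / 2), phase (-(ω * v)) *
      (Complex.I * (Real.sin (2 * Real.pi * v) : ℂ)) = ω * raisedCosFT ω := by
  have h := integral_phase_mul_deriv ω hasDerivAt_cos_two_pi (by fun_prop)
    (by rw [cos_two_pi_mul_half]; norm_num)
    (by rw [mul_neg, Real.cos_neg, cos_two_pi_mul_half]; norm_num)
  rw [← raisedCosFT] at h
  have hpi : (2 * Real.pi * Complex.I : ℂ) ≠ 0 := by simp [Real.pi_ne_zero]
  refine mul_left_cancel₀ hpi ?_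
  rw [← intervalIntegral.integral_const_mul]
  refine Eq.trans (intervalIntegral.integral_congr fun v _ => ?_) (h.trans (by ring))
  push_cast
  linear_combination (2 * Real.pi * phase (-(ω * v)) * Complex.sin (2 * Real.pi * v)) * Complex.I_sq

/-- A second integration by parts without boundary terms, since the derivative of the raised cosine
also vanishes at both ends. -/
lemma integral_phase_mul_cos (ω : ℝ) :
    ∫ v in (-(1 / 2) : ℝ)..(1 / 2), phase (-(ω * v)) * (Real.cos (2 * Real.pi * v) : ℂ)
      = ω ^ 2 * raisedCosFT ω := by
  have h := integral_phase_mul_deriv ω hasDerivAt_sin_two_pi (by fun_prop)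
    (by rw [sin_two_pi_mul_half]; norm_num)
    (by rw [mul_neg, Real.sin_neg, sin_two_pi_mul_half]; norm_num)
  have h' := integral_phase_mul_sin ω
  have hpi : (2 * Real.pi * Complex.I : ℂ) ≠ 0 := by simp [Real.pi_ne_zero]
  refine mul_left_cancel₀ (pow_ne_zero 2 hpi) ?_
  have e1 : (2 * Real.pi * Complex.I : ℂ) ^ 2 *
      ∫ v in (-(1 / 2) : ℝ)..(1 / 2), phase (-(ω * v)) * (Real.cos (2 * Real.pi * v) : ℂ)
      = ∫ v in (-(1 / 2) : ℝ)..(1 / 2), phase (-(ω * v)) *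
        ((-(2 * Real.pi) ^ 2 * Real.cos (2 * Real.pi * v) : ℝ) : ℂ) := by
    rw [← intervalIntegral.integral_const_mul]
    refine intervalIntegral.integral_congr fun v _ => ?_
    push_cast
    linear_combination ((2 * Real.pi) ^ 2 * phase (-(ω * v)) * Complex.cos (2 * Real.pi * v)) *
      Complex.I_sq
  have e2 : ∫ v in (-(1 / 2) : ℝ)..(1 / 2), phase (-(ω * v)) *
        ((-(2 * Real.pi) * Real.sin (2 * Real.pi * v) : ℝ) : ℂ)
      = 2 * Real.pi * Complex.I * (ω * raisedCosFT ω) := by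
    rw [← h', ← intervalIntegral.integral_const_mul]
    refine intervalIntegral.integral_congr fun v _ => ?_
    push_cast
    linear_combination (-(2 * Real.pi) * phase (-(ω * v)) * Complex.sin (2 * Real.pi * v)) *
      Complex.I_sq
  rw [e1, h, e2]
  ring

/-! Squared norms of the two profiles. -/

/-- The cross term integrates the odd function `p q` over a symmetric interval. -/
lemma integral_norm_sq_profile {p q : ℝ → ℝ} (hp : Continuous p) (hq : Continuous q)
    (hpe : ∀ v, p (-v) = p v) (hqo : ∀ v, q (-v) = -q v) (a b : ℂ) :
    ∫ v in (-(1 / 2) : ℝ)..(1 / 2), ‖a * (p v : ℂ) + b * (q v : ℂ)‖ ^ 2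
      = ‖a‖ ^ 2 * (∫ v in (-(1 / 2) : ℝ)..(1 / 2), p v ^ 2)
        + ‖b‖ ^ 2 * ∫ v in (-(1 / 2) : ℝ)..(1 / 2), q v ^ 2 := by
  have hz : ∫ v in (-(1 / 2) : ℝ)..(1 / 2), p v * q v = 0 := by
    have h1 := intervalIntegral.integral_comp_neg (a := -(1 / 2)) (b := 1 / 2)
      (fun v => p v * q v)
    simp only [hpe, hqo, mul_neg, neg_neg, intervalIntegral.integral_neg] at h1
    linarith
  have hpt : ∀ v, ‖a * (p v : ℂ) + b * (q v : ℂ)‖ ^ 2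
      = ‖a‖ ^ 2 * p v ^ 2 + ‖b‖ ^ 2 * q v ^ 2 + 2 * (a * conj b).re * (p v * q v) := by
    intro v
    simp only [Complex.sq_norm, Complex.normSq_apply]
    simp
    ring
  simp only [hpt]
  rw [intervalIntegral.integral_add, intervalIntegral.integral_add,
    intervalIntegral.integral_const_mul, intervalIntegral.integral_const_mul,
    intervalIntegral.integral_const_mul, hz]
  · ring
  all_goals exact Continuous.intervalIntegrable (by fun_prop) _ _

lemma integral_cos_sq_two_pi :
    ∫ v in (-(1 / 2) : ℝ)..(1 / 2), Real.cos (2 * Real.pi * v) ^ 2 = 1 / 2 := by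
  have h : ∀ v : ℝ, HasDerivAt (fun v => v / 2 + Real.sin (2 * Real.pi * v) *
      Real.cos (2 * Real.pi * v) / (4 * Real.pi)) (Real.cos (2 * Real.pi * v) ^ 2) v := by
    intro v
    have h1 : HasDerivAt (fun v : ℝ => 2 * Real.pi * v) (2 * Real.pi * 1) v :=
      (hasDerivAt_id v).const_mul _
    refine (((hasDerivAt_id v).div_const 2).add
      ((h1.sin.mul h1.cos).div_const _)).congr_deriv ?_
    have hpi := Real.pi_ne_zero
    field_simp
    linear_combination -4 * Real.sin_sq_add_cos_sq (2 * Real.pi * v)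
  rw [intervalIntegral.integral_eq_sub_of_hasDerivAt (fun v _ => h v)
    (Continuous.intervalIntegrable (by fun_prop) _ _), mul_neg, Real.sin_neg, sin_two_pi_mul_half]
  norm_num

lemma integral_sin_sq_two_pi :
    ∫ v in (-(1 / 2) : ℝ)..(1 / 2), Real.sin (2 * Real.pi * v) ^ 2 = 1 / 2 := by
  have h : ∀ v : ℝ, Real.sin (2 * Real.pi * v) ^ 2 = 1 - Real.cos (2 * Real.pi * v) ^ 2 :=
    fun v => by linarith [Real.sin_sq_add_cos_sq (2 * Real.pi * v)]
  simp only [h]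
  rw [intervalIntegral.integral_sub (Continuous.intervalIntegrable (by fun_prop) _ _)
    (Continuous.intervalIntegrable (by fun_prop) _ _), integral_cos_sq_two_pi]
  norm_num

lemma integral_one_add_cos_sq :
    ∫ v in (-(1 / 2) : ℝ)..(1 / 2), (1 + Real.cos (2 * Real.pi * v)) ^ 2 = 3 / 2 := by
  have h : ∀ v : ℝ, (1 + Real.cos (2 * Real.pi * v)) ^ 2
      = 2 * (1 + Real.cos (2 * Real.pi * v)) + (Real.cos (2 * Real.pi * v) ^ 2 - 1) :=
    fun v => by ring
  simp only [h]
  rw [intervalIntegral.integral_add (Continuous.intervalIntegrable (by fun_prop) _ _)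
    (Continuous.intervalIntegrable (by fun_prop) _ _), intervalIntegral.integral_const_mul,
    integral_one_add_cos, intervalIntegral.integral_sub
    (Continuous.intervalIntegrable (by fun_prop) _ _)
    (Continuous.intervalIntegrable (by fun_prop) _ _), integral_cos_sq_two_pi]
  norm_num

/-- Rescaling the arc `|s| < δ / 2` to the unit arc. -/
lemma integral_arc_rescale {δ : ℝ} (hδ : 0 < δ) {E : Type*} [NormedAddCommGroup E]
    [NormedSpace ℝ E] (F : ℝ → E) :
    ∫ s in (-(δ / 2))..(δ / 2), F (s / δ) = δ • ∫ v in (-(1 / 2) : ℝ)..(1 / 2), F v := by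
  rw [intervalIntegral.integral_comp_div (fun v => F v) hδ.ne']
  congr 2 <;> field_simp

/-- Parseval's identity for modulated profiles `a p + b q` on disjoint arcs, with `p` even
and `q` odd. -/
lemma hasSum_profile {ι : Type*} [Fintype ι] {δ : ℝ} (hδ0 : 0 < δ) (hδ : δ ≤ 1) (t : ι → ℝ)
    (hsep : ∀ i j, i ≠ j → ∀ k : ℤ, δ ≤ |t i - t j + k|) (c : ℝ) {p q : ℝ → ℝ}
    (hp : Continuous p) (hq : Continuous q) (hpe : ∀ v, p (-v) = p v) (hqo : ∀ v, q (-v) = -q v)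
    (a b : ι → ℂ) :
    HasSum (fun n : ℤ => ‖∑ i, phase (n * t i) *
        ∫ v in (-(1 / 2) : ℝ)..(1 / 2), phase (-((δ * n + c) * v)) *
          (a i * (p v : ℂ) + b i * (q v : ℂ))‖ ^ 2)
      (∑ i, (‖a i‖ ^ 2 * (∫ v in (-(1 / 2) : ℝ)..(1 / 2), p v ^ 2)
        + ‖b i‖ ^ 2 * ∫ v in (-(1 / 2) : ℝ)..(1 / 2), q v ^ 2) / δ) := by
  -- The arcs are centred at `-t i` because Fourier coefficients carry the character `phase (-(n
  -- τ))`.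
  have hsep' : ∀ i j, i ≠ j → ∀ k : ℤ, δ ≤ |-t i - -t j + k| := by
    intro i j hij k
    have := hsep i j hij (-k)
    rwa [← abs_neg, show -(t i - t j + ((-k : ℤ) : ℝ)) = -t i - -t j + k by push_cast; ring]
      at this
  have h := hasSum_norm_sq_arcs hδ0.le hδ (fun i => -t i) hsep'
    (fun i s => (δ : ℂ)⁻¹ * (phase (-(c * (s / δ))) *
      (a i * (p (s / δ) : ℂ) + b i * (q (s / δ) : ℂ)))) (fun i => by fun_prop)
  have hδc : (δ : ℂ) ≠ 0 := by exact_mod_cast hδ0.ne'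
  convert h using 1
  · funext n
    congr 2
    refine Finset.sum_congr rfl fun i _ => ?_
    rw [show -((n : ℝ) * -t i) = n * t i by ring]
    congr 1
    have := integral_arc_rescale hδ0 fun v => (δ : ℂ)⁻¹ * (phase (-((δ * n + c) * v)) *
      (a i * (p v : ℂ) + b i * (q v : ℂ)))
    simp only [intervalIntegral.integral_const_mul, Complex.real_smul] at this
    rw [mul_inv_cancel_left₀ hδc, ← intervalIntegral.integral_const_mul] at this
    rw [← this]
    refine intervalIntegral.integral_congr fun s _ => ?_
    have e : -((δ * n + c) * (s / δ)) = -(n * s) + -(c * (s / δ)) := by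
      field_simp
      ring
    simp only [e, phase_add]
    ring
  · refine Finset.sum_congr rfl fun i _ => ?_
    have := integral_arc_rescale hδ0 fun v => (δ⁻¹) ^ 2 *
      ‖a i * (p v : ℂ) + b i * (q v : ℂ)‖ ^ 2
    simp only [intervalIntegral.integral_const_mul, integral_norm_sq_profile hp hq hpe hqo,
      smul_eq_mul] at this
    have e : ∀ s : ℝ, ‖(δ : ℂ)⁻¹ * (phase (-(c * (s / δ))) *
        (a i * (p (s / δ) : ℂ) + b i * (q (s / δ) : ℂ)))‖ ^ 2
        = (δ⁻¹) ^ 2 * ‖a i * (p (s / δ) : ℂ) + b i * (q (s / δ) : ℂ)‖ ^ 2 := by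
      intro s
      rw [norm_mul, norm_mul, norm_phase, norm_inv, Complex.norm_real, Real.norm_of_nonneg hδ0.le,
        one_mul, mul_pow]
    simp only [e, intervalIntegral.integral_const_mul]
    rw [this]
    field_simp

/-! ### Weighted exponential sums over the observation window -/

section Window

variable {ι : Type*} [Fintype ι] {δ : ℝ} {t : ι → ℝ}

lemma phase_mul_neg_shift (n h t : ℝ) : phase (n * t) * phase (-(h * t)) = phase ((n - h) * t) := by
  rw [← phase_add]
  congr 1
  ring

/-- The profile `1 + cos` carries `y` and `i sin` carries `x`: their transforms are `g` and `ω g`,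
which reassemble as `(y + x ω) g`. The modulations by `phase (-(h t_i))` centre the window at `h`.
The numbers `3/2` and `1/2` are the energies of the two profiles. -/
lemma hasSum_window_zero (hδ0 : 0 < δ) (hδ : δ ≤ 1)
    (hsep : ∀ i j, i ≠ j → ∀ k : ℤ, δ ≤ |t i - t j + k|) (h r : ℝ) (x y : ι → ℂ) :
    HasSum (fun n : ℤ => ‖∑ i, (y i + x i * ((δ * (n - h) - r : ℝ) : ℂ)) * phase ((n - h) * t i)‖ ^ 2
        * ‖raisedCosFT (δ * (n - h) - r)‖ ^ 2)
      (∑ i, (3 / 2 * ‖y i‖ ^ 2 + 1 / 2 * ‖x i‖ ^ 2) / δ) := by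
  have H := hasSum_profile hδ0 hδ t hsep (-(δ * h) - r)
    (p := fun v => 1 + Real.cos (2 * Real.pi * v)) (q := fun v => Real.sin (2 * Real.pi * v))
    (by fun_prop) (by fun_prop) (fun v => by simp) (fun v => by simp)
    (fun i => y i * phase (-(h * t i))) (fun i => x i * phase (-(h * t i)) * Complex.I)
  simp only [integral_one_add_cos_sq, integral_sin_sq_two_pi, norm_mul, norm_phase, mul_one,
    Complex.norm_I] at H
  convert H using 1
  · funext n
    have e : δ * (n : ℝ) + (-(δ * h) - r) = δ * (n - h) - r := by ring
    rw [e, ← mul_pow, ← norm_mul, Finset.sum_mul]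
    congr 2
    refine Finset.sum_congr rfl fun i _ => ?_
    set ω := δ * ((n : ℝ) - h) - r with hω
    have e1 : ∀ v : ℝ, phase (-(ω * v)) * (y i * phase (-(h * t i)) *
          ((1 + Real.cos (2 * Real.pi * v) : ℝ) : ℂ)
          + x i * phase (-(h * t i)) * Complex.I * (Real.sin (2 * Real.pi * v) : ℂ))
        = (y i * phase (-(h * t i))) * (phase (-(ω * v)) *
            ((1 + Real.cos (2 * Real.pi * v) : ℝ) : ℂ))
          + (x i * phase (-(h * t i))) * (phase (-(ω * v)) *
            (Complex.I * (Real.sin (2 * Real.pi * v) : ℂ))) := fun v => by ring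
    simp only [e1]
    rw [intervalIntegral.integral_add (Continuous.intervalIntegrable (by fun_prop) _ _)
      (Continuous.intervalIntegrable (by fun_prop) _ _), intervalIntegral.integral_const_mul,
      intervalIntegral.integral_const_mul, integral_phase_mul_sin, ← raisedCosFT,
      ← phase_mul_neg_shift]
    ring
  · refine Finset.sum_congr rfl fun i _ => ?_
    ring

/-- The extra factor `ω` is absorbed by one more differentiation of the profile: `i sin` now carries
`y` and `cos` carries `x`, with transforms `ω g` and `ω² g`, both of energy `1/2`. -/
lemma hasSum_window_two (hδ0 : 0 < δ) (hδ : δ ≤ 1)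
    (hsep : ∀ i j, i ≠ j → ∀ k : ℤ, δ ≤ |t i - t j + k|) (h r : ℝ) (x y : ι → ℂ) :
    HasSum (fun n : ℤ => (δ * (n - h) - r) ^ 2 *
        (‖∑ i, (y i + x i * ((δ * (n - h) - r : ℝ) : ℂ)) * phase ((n - h) * t i)‖ ^ 2
        * ‖raisedCosFT (δ * (n - h) - r)‖ ^ 2))
      (∑ i, (1 / 2 * ‖y i‖ ^ 2 + 1 / 2 * ‖x i‖ ^ 2) / δ) := by
  have H := hasSum_profile hδ0 hδ t hsep (-(δ * h) - r)
    (p := fun v => Real.cos (2 * Real.pi * v)) (q := fun v => Real.sin (2 * Real.pi * v))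
    (by fun_prop) (by fun_prop) (fun v => by simp) (fun v => by simp)
    (fun i => x i * phase (-(h * t i))) (fun i => y i * phase (-(h * t i)) * Complex.I)
  simp only [integral_cos_sq_two_pi, integral_sin_sq_two_pi, norm_mul, norm_phase, mul_one,
    Complex.norm_I] at H
  convert H using 1
  · funext n
    have e : δ * (n : ℝ) + (-(δ * h) - r) = δ * (n - h) - r := by ring
    rw [e]
    set ω := δ * ((n : ℝ) - h) - r with hω
    have e0 : ω ^ 2 = ‖(ω : ℂ)‖ ^ 2 := by rw [Complex.norm_real, Real.norm_eq_abs, sq_abs]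
    rw [e0, ← mul_pow, ← mul_pow, ← norm_mul, ← norm_mul, Finset.sum_mul, Finset.mul_sum]
    congr 2
    refine Finset.sum_congr rfl fun i _ => ?_
    have e1 : ∀ v : ℝ, phase (-(ω * v)) * (x i * phase (-(h * t i)) *
          (Real.cos (2 * Real.pi * v) : ℂ)
          + y i * phase (-(h * t i)) * Complex.I * (Real.sin (2 * Real.pi * v) : ℂ))
        = (x i * phase (-(h * t i))) * (phase (-(ω * v)) * (Real.cos (2 * Real.pi * v) : ℂ))
          + (y i * phase (-(h * t i))) * (phase (-(ω * v)) *
            (Complex.I * (Real.sin (2 * Real.pi * v) : ℂ))) := fun v => by ring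
    simp only [e1]
    rw [intervalIntegral.integral_add (Continuous.intervalIntegrable (by fun_prop) _ _)
      (Continuous.intervalIntegrable (by fun_prop) _ _), intervalIntegral.integral_const_mul,
      intervalIntegral.integral_const_mul, integral_phase_mul_sin, integral_phase_mul_cos,
      ← phase_mul_neg_shift]
    ring
  · refine Finset.sum_congr rfl fun i _ => ?_
    ring

/-- The value of a shifted minorant `(H² - (ω - r)²) |g(ω - r)|²` on a confluent exponential sum. -/
lemma hasSum_minorant (hδ0 : 0 < δ) (hδ : δ ≤ 1)
    (hsep : ∀ i j, i ≠ j → ∀ k : ℤ, δ ≤ |t i - t j + k|) (h H r : ℝ) (x y : ι → ℂ) :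
    HasSum (fun n : ℤ => (H ^ 2 - (δ * (n - h) - r) ^ 2) * ‖raisedCosFT (δ * (n - h) - r)‖ ^ 2 *
        ‖∑ i, (y i + x i * ((n - h : ℝ) : ℂ)) * phase ((n - h) * t i)‖ ^ 2)
      (∑ i, ((3 / 2 * H ^ 2 - 1 / 2) * ‖y i + x i * (r / δ : ℝ)‖ ^ 2
        + 1 / 2 * (H ^ 2 - 1) * (‖x i‖ ^ 2 / δ ^ 2)) / δ) := by
  have hδc : (δ : ℂ) ≠ 0 := by exact_mod_cast hδ0.ne'
  have h0 := (hasSum_window_zero hδ0 hδ hsep h r (fun i => x i / δ)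
    (fun i => y i + x i * (r / δ : ℝ))).mul_left (H ^ 2)
  have h2 := hasSum_window_two hδ0 hδ hsep h r (fun i => x i / δ)
    (fun i => y i + x i * (r / δ : ℝ))
  -- The coefficients `y + x r/δ` and `x/δ` re-expand `y + x (n - h)` around the centre of the lobe,
  -- in the variable `δ (n - h) - r`.
  have e : ∀ n : ℤ, ∀ i, y i + x i * ((r / δ : ℝ) : ℂ) + x i / δ * ((δ * (n - h) - r : ℝ) : ℂ)
      = y i + x i * ((n - h : ℝ) : ℂ) := by
    intro n i
    push_cast
    field_simp
    ring
  simp only [e] at h0 h2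
  convert h0.sub h2 using 1
  · rfl
  · funext n
    ring
  · rw [Finset.mul_sum, ← Finset.sum_sub_distrib]
    refine Finset.sum_congr rfl fun i _ => ?_
    rw [norm_div, Complex.norm_real, Real.norm_of_nonneg hδ0.le]
    field_simp
    ring

lemma norm_sq_add_mul_add_norm_sq_sub_mul (a b : ℂ) (s : ℝ) :
    ‖a + b * (s : ℂ)‖ ^ 2 + ‖a + b * ((-s : ℝ) : ℂ)‖ ^ 2 = 2 * ‖a‖ ^ 2 + 2 * s ^ 2 * ‖b‖ ^ 2 := by
  simp only [Complex.sq_norm, Complex.normSq_apply]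
  simp
  ring

/-- The two-lobe minorant is at most the indicator of `|ω| < H + r`. -/
lemma two_lobe_le {H r w ω a b : ℝ} (hw : 0 ≤ w) (h1 : w * H ^ 2 ≤ 1)
    (h2 : w * (2 * (H ^ 2 - r ^ 2)) ≤ 1) (ha : 0 ≤ a) (ha1 : a ≤ 1) (hb : 0 ≤ b) (hb1 : b ≤ 1) :
    w * ((H ^ 2 - (ω - r) ^ 2) * a + (H ^ 2 - (ω + r) ^ 2) * b) ≤ 1 := by
  have key : ∀ u c : ℝ, 0 ≤ c → c ≤ 1 → (H ^ 2 - u ^ 2) * c ≤ max 0 (H ^ 2 - u ^ 2) := by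
    intro u c hc hc1
    rcases le_total 0 (H ^ 2 - u ^ 2) with h | h
    · exact (mul_le_of_le_one_right h hc1).trans (le_max_right _ _)
    · exact (mul_nonpos_of_nonpos_of_nonneg h hc).trans (le_max_left _ _)
  have ka := key (ω - r) a ha ha1
  have kb := key (ω + r) b hb hb1
  have hA : w * (H ^ 2 - (ω - r) ^ 2) ≤ 1 := by nlinarith [mul_nonneg hw (sq_nonneg (ω - r))]
  have hB : w * (H ^ 2 - (ω + r) ^ 2) ≤ 1 := by nlinarith [mul_nonneg hw (sq_nonneg (ω + r))]
  -- Where both lobes are active the parabolas add up to `2(H² - r²) - 2ω²`.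
  have hAB : w * (H ^ 2 - (ω - r) ^ 2) + w * (H ^ 2 - (ω + r) ^ 2) ≤ 1 := by
    nlinarith [mul_nonneg hw (sq_nonneg ω)]
  have hs := mul_le_mul_of_nonneg_left (add_le_add ka kb) hw
  refine hs.trans ?_
  rcases max_cases 0 (H ^ 2 - (ω - r) ^ 2) with ⟨e1, -⟩ | ⟨e1, -⟩ <;>
    rcases max_cases 0 (H ^ 2 - (ω + r) ^ 2) with ⟨e2, -⟩ | ⟨e2, -⟩ <;> rw [e1, e2] <;> linarith

/-- At such `ω` the distances to both centres `r` and `-r` are at least `H`, so both parabolas are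
nonpositive. -/
lemma two_lobe_nonpos {H r w ω a b : ℝ} (hH : 0 ≤ H) (hr : 0 ≤ r) (hw : 0 ≤ w)
    (hω : H + r ≤ |ω|) (ha : 0 ≤ a) (hb : 0 ≤ b) :
    w * ((H ^ 2 - (ω - r) ^ 2) * a + (H ^ 2 - (ω + r) ^ 2) * b) ≤ 0 := by
  have h1 : H ^ 2 ≤ (ω - r) ^ 2 := by
    rw [← sq_abs (ω - r)]
    refine pow_le_pow_left₀ hH ?_ 2
    have := abs_sub_abs_le_abs_sub ω r
    rw [abs_of_nonneg hr] at this
    linarith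
  have h2 : H ^ 2 ≤ (ω + r) ^ 2 := by
    rw [← sq_abs (ω + r)]
    refine pow_le_pow_left₀ hH ?_ 2
    have := abs_sub_abs_le_abs_sub ω (-r)
    rw [abs_neg, abs_of_nonneg hr, sub_neg_eq_add] at this
    linarith
  refine mul_nonpos_of_nonneg_of_nonpos hw (add_nonpos ?_ ?_)
  · exact mul_nonpos_of_nonpos_of_nonneg (by linarith) ha
  · exact mul_nonpos_of_nonpos_of_nonneg (by linarith) hb

/-- Large-sieve type lower bound for confluent exponential sums with well-separated frequencies. -/
theorem confluent_lower_bound (hδ0 : 0 < δ) (hδ : δ ≤ 1)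
    (hsep : ∀ i j, i ≠ j → ∀ k : ℤ, δ ≤ |t i - t j + k|) {N : ℕ} {H r w : ℝ} (hH : 0 ≤ H)
    (hr : 0 ≤ r) (hw : 0 ≤ w) (hx : 2 * (H + r) = N * δ) (h1 : w * H ^ 2 ≤ 1)
    (h2 : w * (2 * (H ^ 2 - r ^ 2)) ≤ 1) (x y : ι → ℂ) :
    ∑ i, (2 * w * (3 / 2 * H ^ 2 - 1 / 2) / δ * ‖y i‖ ^ 2
        + 2 * w * (r ^ 2 * (3 / 2 * H ^ 2 - 1 / 2) + 1 / 2 * (H ^ 2 - 1)) / δ ^ 3 * ‖x i‖ ^ 2)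
      ≤ ∑ k : Fin N, ‖∑ i, (y i + x i * (((k : ℕ) - ((N : ℝ) - 1) / 2 : ℝ) : ℂ)) *
          phase (((k : ℕ) - ((N : ℝ) - 1) / 2) * t i)‖ ^ 2 := by
  set h : ℝ := ((N : ℝ) - 1) / 2 with hh
  set u : ℤ → ℝ := fun n => ‖∑ i, (y i + x i * ((n - h : ℝ) : ℂ)) * phase ((n - h) * t i)‖ ^ 2
    with hu
  have hp := hasSum_minorant hδ0 hδ hsep h H r x y
  have hm := hasSum_minorant hδ0 hδ hsep h H (-r) x y
  have hs := (hp.add hm).mul_left w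
  have hfin : HasSum (fun n : ℤ => if 0 ≤ n ∧ n < N then u n else 0)
      (∑ k : Fin N, u ((k : ℕ) : ℤ)) := by
    have e : ∑ k : Fin N, u ((k : ℕ) : ℤ)
        = ∑ n ∈ Finset.Ico (0 : ℤ) N, if 0 ≤ n ∧ n < N then u n else 0 := by
      rw [Fin.sum_univ_eq_sum_range (fun k : ℕ => u (k : ℤ)) N]
      refine Finset.sum_bij (fun k _ => (k : ℤ)) ?_ ?_ ?_ ?_
      · intro k hk
        simp only [Finset.mem_range] at hk
        simp only [Finset.mem_Ico]
        omega
      · intro a _ b _ hab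
        exact_mod_cast hab
      · intro n hn
        simp only [Finset.mem_Ico] at hn
        exact ⟨n.toNat, by simp only [Finset.mem_range]; omega, by omega⟩
      · intro k hk
        simp only [Finset.mem_range] at hk
        rw [if_pos (by omega)]
    rw [e]
    refine hasSum_sum_of_ne_finset_zero fun n hn => if_neg ?_
    simpa only [Finset.mem_Ico] using hn
  have hle := hasSum_le (fun n => ?_) hs hfin
  · refine le_trans (le_of_eq ?_) hle
    rw [← Finset.sum_add_distrib, Finset.mul_sum]
    refine Finset.sum_congr rfl fun i _ => ?_
    -- Adding the lobes at `r` and `-r` cancels the cross terms between `x i` and `y i`, which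
    -- leaves a diagonal form.
    have := norm_sq_add_mul_add_norm_sq_sub_mul (y i) (x i) (r / δ)
    rw [neg_div]
    have e : ‖y i + x i * ((-(r / δ) : ℝ) : ℂ)‖ ^ 2
        = 2 * ‖y i‖ ^ 2 + 2 * (r / δ) ^ 2 * ‖x i‖ ^ 2 - ‖y i + x i * ((r / δ : ℝ) : ℂ)‖ ^ 2 := by
      linarith
    rw [e]
    field_simp
    ring
  · have hun : 0 ≤ u n := sq_nonneg _
    set ω : ℝ := δ * (n - h) with hω
    have e : w * ((H ^ 2 - (ω - r) ^ 2) * ‖raisedCosFT (ω - r)‖ ^ 2 * u n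
        + (H ^ 2 - (ω - -r) ^ 2) * ‖raisedCosFT (ω - -r)‖ ^ 2 * u n)
        = w * ((H ^ 2 - (ω - r) ^ 2) * ‖raisedCosFT (ω - r)‖ ^ 2
        + (H ^ 2 - (ω + r) ^ 2) * ‖raisedCosFT (ω + r)‖ ^ 2) * u n := by
      rw [sub_neg_eq_add]
      ring
    have hg : ∀ ω, ‖raisedCosFT ω‖ ^ 2 ≤ 1 := fun ω =>
      pow_le_one₀ (norm_nonneg _) (norm_raisedCosFT_le ω)
    refine (le_of_eq e).trans ?_
    split_ifs with hn
    · exact mul_le_of_le_one_left hun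
        (two_lobe_le hw h1 h2 (sq_nonneg _) (hg _) (sq_nonneg _) (hg _))
    · refine mul_nonpos_of_nonpos_of_nonneg
        (two_lobe_nonpos hH hr hw ?_ (sq_nonneg _) (sq_nonneg _)) hun
      -- Outside `0, …, N - 1` the centred index has modulus at least `(N + 1)/2`; since `H + r = N
      -- δ / 2`, such points lie where the minorant is nonpositive.
      have habs : (N : ℝ) / 2 ≤ |(n : ℝ) - h| := by
        rcases lt_or_ge n 0 with h0 | h0
        · have : (n : ℝ) ≤ -1 := by exact_mod_cast Int.le_sub_one_of_lt h0
          rw [le_abs]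
          right
          rw [hh]
          linarith
        · have hn' : (N : ℤ) ≤ n := by
            by_contra hc
            exact hn ⟨h0, by omega⟩
          have : (N : ℝ) ≤ n := by exact_mod_cast hn'
          rw [le_abs]
          left
          rw [hh]
          linarith
      rw [hω, abs_mul, abs_of_pos hδ0]
      nlinarith

end Window

/-! ### Moments of the Dirichlet kernel -/

/-- `∑_k ω_k^p exp(2πi ω_k Δ)` over the centred window `ω_k = k - (N-1)/2`. -/
def trigMoment (N p : ℕ) (Δ : ℝ) : ℂ :=
  ∑ k : Fin N, (((k : ℕ) - ((N : ℝ) - 1) / 2 : ℝ) : ℂ) ^ p *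
    phase (((k : ℕ) - ((N : ℝ) - 1) / 2) * Δ)

lemma phase_half_sub (Δ : ℝ) :
    phase (1 / 2 * Δ) - phase (-(1 / 2 * Δ)) = 2 * Complex.I * Real.sin (Real.pi * Δ) := by
  rw [phase_eq_cos_add_sin, phase_eq_cos_add_sin,
    show 2 * Real.pi * -(1 / 2 * Δ) = -(Real.pi * Δ) by ring,
    show 2 * Real.pi * (1 / 2 * Δ) = Real.pi * Δ by ring, Real.cos_neg, Real.sin_neg]
  push_cast
  ring

lemma phase_half_add (Δ : ℝ) :
    phase (1 / 2 * Δ) + phase (-(1 / 2 * Δ)) = 2 * Real.cos (Real.pi * Δ) := by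
  rw [phase_eq_cos_add_sin, phase_eq_cos_add_sin,
    show 2 * Real.pi * -(1 / 2 * Δ) = -(Real.pi * Δ) by ring,
    show 2 * Real.pi * (1 / 2 * Δ) = Real.pi * Δ by ring, Real.cos_neg, Real.sin_neg]
  push_cast
  ring

/-- Half-integer shifts keep the window symmetric. Taking `F s = s^p phase (s Δ)` for `p = 0, 1, 2`
yields recurrences for the moments. -/
lemma sum_window_telescope (N : ℕ) (F : ℝ → ℂ) :
    ∑ k : Fin N, (F (((k : ℕ) - ((N : ℝ) - 1) / 2) + 1 / 2) - F (((k : ℕ) - ((N : ℝ) - 1) / 2) - 1 / 2))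
      = F (N / 2) - F (-(N / 2)) := by
  rw [Fin.sum_univ_eq_sum_range (fun k : ℕ => F (((k : ℝ) - ((N : ℝ) - 1) / 2) + 1 / 2)
    - F (((k : ℝ) - ((N : ℝ) - 1) / 2) - 1 / 2)) N]
  have h := Finset.sum_range_sub (fun k : ℕ => F ((k : ℝ) - N / 2)) N
  simp only [Nat.cast_zero, zero_sub] at h
  rw [show (N : ℝ) - N / 2 = N / 2 by ring] at h
  rw [← h]
  refine Finset.sum_congr rfl fun k _ => ?_
  congr 2 <;> push_cast <;> ring

lemma trigMoment_zero_mul (N : ℕ) (Δ : ℝ) :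
    trigMoment N 0 Δ * Real.sin (Real.pi * Δ) = Real.sin (Real.pi * (N * Δ)) := by
  have h := sum_window_telescope N (fun s => phase (s * Δ))
  rw [neg_mul, show (N : ℝ) / 2 * Δ = 1 / 2 * (N * Δ) by ring, phase_half_sub] at h
  have e : ∀ k : ℝ, phase ((k + 1 / 2) * Δ) - phase ((k - 1 / 2) * Δ)
      = 2 * Complex.I * Real.sin (Real.pi * Δ) * phase (k * Δ) := by
    intro k
    rw [← phase_half_sub, add_mul, sub_mul, sub_eq_add_neg (k * Δ), phase_add, phase_add]
    ring
  simp only [e, ← Finset.mul_sum] at h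
  refine mul_left_cancel₀ (mul_ne_zero two_ne_zero Complex.I_ne_zero) ?_
  rw [← h, trigMoment]
  simp only [pow_zero, one_mul]
  ring

lemma trigMoment_one_mul (N : ℕ) (Δ : ℝ) :
    2 * Complex.I * Real.sin (Real.pi * Δ) * trigMoment N 1 Δ
      + Real.cos (Real.pi * Δ) * trigMoment N 0 Δ = N * Real.cos (Real.pi * (N * Δ)) := by
  have h := sum_window_telescope N (fun s => (s : ℂ) * phase (s * Δ))
  have e : ∀ k : ℝ, ((k + 1 / 2 : ℝ) : ℂ) * phase ((k + 1 / 2) * Δ)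
        - ((k - 1 / 2 : ℝ) : ℂ) * phase ((k - 1 / 2) * Δ)
      = 2 * Complex.I * Real.sin (Real.pi * Δ) * ((k : ℂ) ^ 1 * phase (k * Δ))
        + Real.cos (Real.pi * Δ) * ((k : ℂ) ^ 0 * phase (k * Δ)) := by
    intro k
    rw [← phase_half_sub, add_mul, sub_mul, sub_eq_add_neg (k * Δ), phase_add, phase_add]
    have := phase_half_add Δ
    push_cast at this ⊢
    linear_combination (1 / 2 * phase (k * Δ)) * this
  simp only [e] at h
  rw [Finset.sum_add_distrib, ← Finset.mul_sum, ← Finset.mul_sum] at h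
  rw [trigMoment, trigMoment, h, neg_mul, show (N : ℝ) / 2 * Δ = 1 / 2 * (N * Δ) by ring]
  have := phase_half_add (N * Δ)
  push_cast at this ⊢
  linear_combination ((N : ℂ) / 2) * this

lemma trigMoment_two_mul (N : ℕ) (Δ : ℝ) :
    2 * Complex.I * Real.sin (Real.pi * Δ) * (trigMoment N 2 Δ + 1 / 4 * trigMoment N 0 Δ)
      + 2 * Real.cos (Real.pi * Δ) * trigMoment N 1 Δ
      = N ^ 2 / 4 * (2 * Complex.I * Real.sin (Real.pi * (N * Δ))) := by
  have h := sum_window_telescope N (fun s => (s : ℂ) ^ 2 * phase (s * Δ))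
  have e : ∀ k : ℝ, ((k + 1 / 2 : ℝ) : ℂ) ^ 2 * phase ((k + 1 / 2) * Δ)
        - ((k - 1 / 2 : ℝ) : ℂ) ^ 2 * phase ((k - 1 / 2) * Δ)
      = 2 * Complex.I * Real.sin (Real.pi * Δ) * ((k : ℂ) ^ 2 * phase (k * Δ)
        + 1 / 4 * ((k : ℂ) ^ 0 * phase (k * Δ)))
        + 2 * Real.cos (Real.pi * Δ) * ((k : ℂ) ^ 1 * phase (k * Δ)) := by
    intro k
    rw [← phase_half_sub, add_mul, sub_mul, sub_eq_add_neg (k * Δ), phase_add, phase_add]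
    have := phase_half_add Δ
    push_cast at this ⊢
    linear_combination (k * phase (k * Δ)) * this
  simp only [e] at h
  rw [Finset.sum_add_distrib, ← Finset.mul_sum, ← Finset.mul_sum, Finset.sum_add_distrib,
    ← Finset.mul_sum] at h
  rw [trigMoment, trigMoment, trigMoment, h, neg_mul,
    show (N : ℝ) / 2 * Δ = 1 / 2 * (N * Δ) by ring, ← phase_half_sub]
  push_cast
  ring

lemma sq_le_of_cos_sin (a b θ : ℝ) : (a * Real.cos θ + b * Real.sin θ) ^ 2 ≤ a ^ 2 + b ^ 2 := by
  nlinarith [sq_nonneg (a * Real.sin θ - b * Real.cos θ), Real.sin_sq_add_cos_sq θ]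

lemma norm_sq_trigMoment_zero_le (N : ℕ) {Δ : ℝ} (hS : Real.sin (Real.pi * Δ) ≠ 0) :
    ‖trigMoment N 0 Δ‖ ^ 2 ≤ 1 / Real.sin (Real.pi * Δ) ^ 2 := by
  rw [le_div_iff₀ (by positivity)]
  have h := congrArg (fun z : ℂ => ‖z‖ ^ 2) (trigMoment_zero_mul N Δ)
  simp only [norm_mul, Complex.norm_real, mul_pow, Real.norm_eq_abs, sq_abs] at h
  rw [h]
  exact Real.sin_sq_le_one _

/-- Eliminating the zeroth moment leaves `2i S² T₁ = N S cos θ - C sin θ` with `θ = π N Δ`, and the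
right side is bounded by the Euclidean norm of its two coefficients. -/
lemma norm_sq_trigMoment_one_le (N : ℕ) {Δ : ℝ} (hS : Real.sin (Real.pi * Δ) ≠ 0) :
    ‖trigMoment N 1 Δ‖ ^ 2 ≤ 1 / 4 * ((N : ℝ) ^ 2 / Real.sin (Real.pi * Δ) ^ 2
      + Real.cos (Real.pi * Δ) ^ 2 / Real.sin (Real.pi * Δ) ^ 4) := by
  set S := Real.sin (Real.pi * Δ) with hSdef
  set C := Real.cos (Real.pi * Δ) with hCdef
  have h : 2 * Complex.I * (S : ℂ) ^ 2 * trigMoment N 1 Δ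
      = ((N * S * Real.cos (Real.pi * (N * Δ)) + (-C) * Real.sin (Real.pi * (N * Δ)) : ℝ) : ℂ) := by
    have h0 := trigMoment_zero_mul N Δ
    have h1 := trigMoment_one_mul N Δ
    simp only [← hSdef, ← hCdef] at h0 h1
    push_cast at h0 h1 ⊢
    linear_combination (S : ℂ) * h1 - (C : ℂ) * h0
  have h' := congrArg (fun z : ℂ => ‖z‖ ^ 2) h
  simp only [norm_mul, Complex.norm_real, mul_pow, norm_pow, Real.norm_eq_abs,
    Complex.norm_I, Complex.norm_ofNat, mul_one, ← abs_pow, abs_sq] at h'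
  have hb := sq_le_of_cos_sin (N * S) (-C) (Real.pi * (N * Δ))
  rw [← h'] at hb
  have e : 1 / 4 * ((N : ℝ) ^ 2 / S ^ 2 + C ^ 2 / S ^ 4)
      = ((N * S) ^ 2 + (-C) ^ 2) / (4 * S ^ 4) := by
    field_simp
  rw [e, le_div_iff₀ (by positivity)]
  nlinarith

/-- Eliminating the lower moments gives `2 S³ T₂` as a combination of `cos θ` and `sin θ`, with `θ =
π N Δ`. In the sum of the squared coefficients the terms of order `N² C² S²` cancel, and `S² + C² =
1` reduces the remainder to `C²`. -/
lemma norm_sq_trigMoment_two_le (N : ℕ) {Δ : ℝ} (hS : Real.sin (Real.pi * Δ) ≠ 0) :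
    ‖trigMoment N 2 Δ‖ ^ 2 ≤ ((N : ℝ) ^ 2 - 1) ^ 2 / (16 * Real.sin (Real.pi * Δ) ^ 2)
      + Real.cos (Real.pi * Δ) ^ 2 / (4 * Real.sin (Real.pi * Δ) ^ 6) := by
  have hsc := Real.sin_sq_add_cos_sq (Real.pi * Δ)
  set S := Real.sin (Real.pi * Δ) with hSdef
  set C := Real.cos (Real.pi * Δ) with hCdef
  have h : 2 * (S : ℂ) ^ 3 * trigMoment N 2 Δ
      = ((C * N * S * Real.cos (Real.pi * (N * Δ)) +
        (((N : ℝ) ^ 2 - 1) / 2 * S ^ 2 - C ^ 2) * Real.sin (Real.pi * (N * Δ)) : ℝ) : ℂ) := by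
    have h0 := trigMoment_zero_mul N Δ
    have h1 := trigMoment_one_mul N Δ
    have h2 := trigMoment_two_mul N Δ
    simp only [← hSdef, ← hCdef] at h0 h1 h2
    refine mul_left_cancel₀ Complex.I_ne_zero ?_
    push_cast at h0 h1 h2 ⊢
    linear_combination (S : ℂ) ^ 2 * h2 - (Complex.I / 2 * (S : ℂ) ^ 2) * h0
      + (Complex.I * C * S) * h1 - Complex.I * C ^ 2 * h0
      - (2 * C * (S : ℂ) ^ 2 * trigMoment N 1 Δ) * Complex.I_sq
  have h' := congrArg (fun z : ℂ => ‖z‖ ^ 2) h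
  simp only [norm_mul, Complex.norm_real, mul_pow, norm_pow, Real.norm_eq_abs,
    Complex.norm_ofNat, ← abs_pow, abs_sq] at h'
  have hb := sq_le_of_cos_sin (C * N * S) (((N : ℝ) ^ 2 - 1) / 2 * S ^ 2 - C ^ 2)
    (Real.pi * (N * Δ))
  rw [← h'] at hb
  have e : ((N : ℝ) ^ 2 - 1) ^ 2 / (16 * S ^ 2) + C ^ 2 / (4 * S ^ 6)
      = ((C * N * S) ^ 2 + (((N : ℝ) ^ 2 - 1) / 2 * S ^ 2 - C ^ 2) ^ 2) / (4 * S ^ 6) := by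
    field_simp
    linear_combination (-64 * C ^ 2) * hsc
  rw [e, le_div_iff₀ (by positivity)]
  nlinarith

/-! ### Sums of `1 / sin²` over separated points -/

/-- Parseval for the character of real frequency `x` on a single arc of length `1`: its energy is
`1`, and its `n`-th coefficient has squared modulus `sin²(πx) / (π²(x - n)²)`. -/
lemma hasSum_inv_sq_shift (x : ℝ) (hx : Real.sin (Real.pi * x) ≠ 0) :
    HasSum (fun n : ℤ => 1 / (x - n) ^ 2) (Real.pi ^ 2 / Real.sin (Real.pi * x) ^ 2) := by
  have hne : ∀ n : ℤ, x - n ≠ 0 := by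
    intro n h
    apply hx
    rw [sub_eq_zero.mp h, mul_comm]
    exact Real.sin_int_mul_pi n
  have h := hasSum_norm_sq_arcs (ι := Unit) zero_le_one le_rfl (fun _ => 0)
    (fun i j hij => absurd (Subsingleton.elim i j) hij) (fun _ s => phase (x * s))
    (fun _ => by fun_prop)
  simp only [Finset.univ_unique, Finset.sum_singleton, mul_zero, neg_zero, phase_zero, one_mul,
    norm_phase, one_pow, intervalIntegral.integral_const, smul_eq_mul, mul_one] at h
  have hcoef : ∀ n : ℤ, ‖∫ s in (-(1 / 2) : ℝ)..(1 / 2), phase (-(n * s)) * phase (x * s)‖ ^ 2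
      = Real.sin (Real.pi * x) ^ 2 / Real.pi ^ 2 * (1 / (x - n) ^ 2) := by
    intro n
    have e : ∀ s : ℝ, phase (-(n * s)) * phase (x * s) = phase ((x - n) * s) := by
      intro s
      rw [← phase_add]
      congr 1
      ring
    have hc : (2 * Real.pi * ((x - n : ℝ) : ℂ) * Complex.I) ≠ 0 := by
      have := hne n
      have h1 : ((x - n : ℝ) : ℂ) ≠ 0 := by exact_mod_cast this
      simp [Real.pi_ne_zero, h1, -Complex.ofReal_sub]
    have hI : ∫ s in (-(1 / 2) : ℝ)..(1 / 2), phase ((x - n) * s)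
        = (2 * Real.pi * ((x - n : ℝ) : ℂ) * Complex.I)⁻¹ *
          (2 * Complex.I * Real.sin (Real.pi * (x - n))) := by
      rw [eq_inv_mul_iff_mul_eq₀ hc, ← intervalIntegral.integral_const_mul,
        intervalIntegral.integral_eq_sub_of_hasDerivAt
          (fun s _ => hasDerivAt_phase_mul (x - n) s)
          (Continuous.intervalIntegrable (by fun_prop) _ _), ← phase_half_sub]
      congr 2 <;> ring
    have hsin : Real.sin (Real.pi * (x - n)) ^ 2 = Real.sin (Real.pi * x) ^ 2 := by
      rw [mul_sub, mul_comm Real.pi (n : ℝ), Real.sin_sub_int_mul_pi, mul_pow]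
      rcases Int.even_or_odd n with hn | hn <;> simp [hn.neg_one_zpow]
    simp only [e, hI, norm_mul, norm_inv, Complex.norm_real, Complex.norm_I, Complex.norm_ofNat,
      mul_one, mul_pow, inv_pow, Real.norm_eq_abs, sq_abs, hsin]
    have := hne n
    have := Real.pi_ne_zero
    field_simp
  simp only [hcoef] at h
  have h3 := h.mul_left (Real.pi ^ 2 / Real.sin (Real.pi * x) ^ 2)
  have := Real.pi_ne_zero
  convert h3 using 1
  · rfl
  · funext n
    generalize Real.sin (Real.pi * x) = S at hx
    field_simp
  · norm_num

/-- Points of a `δ`-separated set outside `(-δ, δ)`: the sum of inverse squares. -/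
lemma sum_inv_sq_le_of_separated {α : Type*} (s : Finset α) {δ : ℝ} (hδ : 0 < δ) (p : α → ℝ)
    (hp : ∀ a ∈ s, δ ≤ |p a|) (hsep : ∀ a ∈ s, ∀ b ∈ s, a ≠ b → δ ≤ |p a - p b|) :
    ∑ a ∈ s, 1 / p a ^ 2 ≤ Real.pi ^ 2 / (3 * δ ^ 2) := by
  classical
  set G : ℕ → ℝ := fun k => 1 / δ ^ 2 * (1 / (k : ℝ) ^ 2) with hG
  have hGs : HasSum G (1 / δ ^ 2 * (Real.pi ^ 2 / 6)) := hasSum_zeta_two.mul_left _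
  have half : ∀ q : Finset α, q ⊆ s → (∀ a ∈ q, ∀ b ∈ q, 0 ≤ p a * p b) →
      ∑ a ∈ q, 1 / p a ^ 2 ≤ 1 / δ ^ 2 * (Real.pi ^ 2 / 6) := by
    intro q hq hsign
    -- Two points on the same side of `0` whose moduli fall into the same cell of length `δ` would
    -- be closer than `δ`. Each cell therefore holds at most one point, and comparison with `ζ(2)`
    -- bounds each side by `π² / (6δ²)`.
    have hinj : Set.InjOn (fun a => ⌊|p a| / δ⌋₊) q := by
      intro a ha b hb hab
      by_contra hne
      have h1 := hsep a (hq ha) b (hq hb) hne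
      have hfa : (⌊|p a| / δ⌋₊ : ℝ) ≤ |p a| / δ := Nat.floor_le (by positivity)
      have hfb : (⌊|p b| / δ⌋₊ : ℝ) ≤ |p b| / δ := Nat.floor_le (by positivity)
      have hla := Nat.lt_floor_add_one (|p a| / δ)
      have hlb := Nat.lt_floor_add_one (|p b| / δ)
      simp only at hab
      rw [hab] at hfa hla
      rw [le_div_iff₀ hδ] at hfa hfb
      rw [div_lt_iff₀ hδ] at hla hlb
      have h2 : |(|p a| - |p b|)| < δ := abs_lt.mpr ⟨by nlinarith, by nlinarith⟩
      have h3 : |p a - p b| = |(|p a| - |p b|)| := by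
        rw [← sq_eq_sq₀ (abs_nonneg _) (abs_nonneg _), sq_abs, sq_abs, sub_sq, sub_sq, sq_abs,
          sq_abs, mul_assoc 2 |p a|, ← abs_mul, abs_of_nonneg (hsign a ha b hb)]
        ring
      linarith
    calc ∑ a ∈ q, 1 / p a ^ 2 ≤ ∑ a ∈ q, G ⌊|p a| / δ⌋₊ := by
          refine Finset.sum_le_sum fun a ha => ?_
          have h1 : δ ≤ |p a| := hp a (hq ha)
          have h2 : (1 : ℕ) ≤ ⌊|p a| / δ⌋₊ := by
            rw [Nat.le_floor_iff (by positivity), Nat.cast_one, le_div_iff₀ hδ]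
            linarith
          have h2' : (0 : ℝ) < ⌊|p a| / δ⌋₊ := by exact_mod_cast h2
          have hfa : (⌊|p a| / δ⌋₊ : ℝ) ≤ |p a| / δ := Nat.floor_le (by positivity)
          rw [le_div_iff₀ hδ] at hfa
          rw [hG, ← sq_abs (p a)]
          simp only
          rw [one_div_mul_one_div, ← mul_pow]
          refine one_div_le_one_div_of_le (by positivity) (pow_le_pow_left₀ (by positivity) ?_ 2)
          linarith
      _ = ∑ k ∈ q.image (fun a => ⌊|p a| / δ⌋₊), G k := (Finset.sum_image hinj).symm
      _ ≤ _ := sum_le_hasSum _ (fun k _ => by positivity) hGs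
  rw [← Finset.sum_filter_add_sum_filter_not s (fun a => 0 ≤ p a)]
  have h1 := half (s.filter fun a => 0 ≤ p a) (Finset.filter_subset _ _) (fun a ha b hb =>
    mul_nonneg (Finset.mem_filter.mp ha).2 (Finset.mem_filter.mp hb).2)
  have h2 := half (s.filter fun a => ¬ 0 ≤ p a) (Finset.filter_subset _ _) (fun a ha b hb =>
    mul_nonneg_of_nonpos_of_nonpos (not_le.mp (Finset.mem_filter.mp ha).2).le
      (not_le.mp (Finset.mem_filter.mp hb).2).le)
  refine (add_le_add h1 h2).trans (le_of_eq ?_)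
  field_simp
  ring

lemma sin_pi_mul_ne_zero {δ x : ℝ} (hδ : 0 < δ) (hx : ∀ k : ℤ, δ ≤ |x + k|) :
    Real.sin (Real.pi * x) ≠ 0 := by
  intro h
  obtain ⟨n, hn⟩ := Real.sin_eq_zero_iff.mp h
  have hxn : x = n := by
    have := Real.pi_ne_zero
    field_simp at hn
    linarith
  have := hx (-n)
  rw [hxn] at this
  simp at this
  linarith

/-- Expanding each term into partial fractions turns the sum into one over the points `t j - t i -
n`. These are `δ`-separated on the line (for equal `j` because `δ ≤ 1`) and avoid `(-δ, δ)`. -/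
lemma sum_inv_sin_sq_le {ι : Type*} [Fintype ι] [DecidableEq ι] {δ : ℝ} (hδ : 0 < δ) {t : ι → ℝ}
    (hsep : ∀ i j, i ≠ j → ∀ k : ℤ, δ ≤ |t i - t j + k|) (hδ1 : δ ≤ 1) (i : ι) :
    ∑ j ∈ Finset.univ.erase i, 1 / Real.sin (Real.pi * (t j - t i)) ^ 2 ≤ 1 / (3 * δ ^ 2) := by
  have hs : ∀ j ∈ Finset.univ.erase i, HasSum (fun n : ℤ => 1 / (t j - t i - n) ^ 2)
      (Real.pi ^ 2 / Real.sin (Real.pi * (t j - t i)) ^ 2) := fun j hj =>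
    hasSum_inv_sq_shift _ (sin_pi_mul_ne_zero hδ (hsep j i (Finset.ne_of_mem_erase hj)))
  have hle := hasSum_le_of_sum_le (hasSum_sum hs) (c := Real.pi ^ 2 / (3 * δ ^ 2)) fun F => by
    rw [Finset.sum_comm, ← Finset.sum_product']
    refine sum_inv_sq_le_of_separated _ hδ (fun a : ι × ℤ => t a.1 - t i - a.2) ?_ ?_
    · rintro ⟨j, n⟩ hj
      have := hsep j i (Finset.ne_of_mem_erase (Finset.mem_product.mp hj).1) (-n)
      simpa [sub_eq_add_neg] using this
    · rintro ⟨j, n⟩ - ⟨j', n'⟩ - hne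
      by_cases hjj : j = j'
      · subst hjj
        have hnn : n' - n ≠ 0 := fun h => hne (by rw [sub_eq_zero.mp h])
        have : (1 : ℝ) ≤ |((n' - n : ℤ) : ℝ)| := by exact_mod_cast Int.one_le_abs hnn
        simp only
        rw [show t j - t i - n - (t j - t i - n') = ((n' - n : ℤ) : ℝ) by push_cast; ring]
        linarith
      · have := hsep j j' hjj (n' - n)
        simp only
        rwa [show t j - t i - n - (t j' - t i - n') = t j - t j' + ((n' - n : ℤ) : ℝ) by
          push_cast; ring]
  have hpi : 0 < Real.pi ^ 2 := by positivity
  have e : ∑ j ∈ Finset.univ.erase i, Real.pi ^ 2 / Real.sin (Real.pi * (t j - t i)) ^ 2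
      = Real.pi ^ 2 * ∑ j ∈ Finset.univ.erase i, 1 / Real.sin (Real.pi * (t j - t i)) ^ 2 := by
    rw [Finset.mul_sum]
    exact Finset.sum_congr rfl fun j _ => by ring
  rw [e] at hle
  refine le_of_mul_le_mul_left (hle.trans (le_of_eq ?_)) hpi
  ring

/-! ### Diagonal entries of the inverse of a positive definite matrix -/

section InverseDiagonal

variable {n : Type*} [Fintype n] {J : Matrix n n ℂ} {d : n → ℝ}

lemma posDef_of_diagonal_le (hJ : J.IsHermitian) (hd : ∀ j, 0 < d j)
    (h : ∀ c : n → ℂ, ∑ j, d j * ‖c j‖ ^ 2 ≤ (star c ⬝ᵥ J *ᵥ c).re) : J.PosDef := by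
  rw [posDef_iff_dotProduct_mulVec]
  refine ⟨hJ, fun c hc => ?_⟩
  obtain ⟨i, hi⟩ := Function.ne_iff.mp hc
  have him : (star c ⬝ᵥ J *ᵥ c).im = 0 := hJ.im_star_dotProduct_mulVec_self c
  rw [Complex.lt_def]
  refine ⟨lt_of_lt_of_le ?_ (h c), by simp [him]⟩
  refine Finset.sum_pos' (fun j _ => mul_nonneg (hd j).le (sq_nonneg _)) ⟨i, Finset.mem_univ i, ?_⟩
  exact mul_pos (hd i) (pow_pos (norm_pos_iff.mpr hi) 2)

lemma star_dotProduct_mulVec_comm (hJ : J.IsHermitian) (v w : n → ℂ) :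
    star v ⬝ᵥ J *ᵥ w = conj (star w ⬝ᵥ J *ᵥ v) := by
  rw [dotProduct_mulVec, ← hJ.eq, ← star_mulVec, hJ.eq]
  change _ = star (star w ⬝ᵥ J *ᵥ v)
  rw [star_dotProduct]

variable [DecidableEq n]

lemma mulVec_inv_col (hJ : J.PosDef) (a : n) : J *ᵥ (fun j => J⁻¹ j a) = Pi.single a 1 := by
  have h : J * J⁻¹ = 1 := mul_nonsing_inv J ((isUnit_iff_isUnit_det J).mp hJ.isUnit)
  funext i
  have := congrFun (congrFun h i) a
  rw [mul_apply] at this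
  rw [mulVec, dotProduct, this, one_apply, Pi.single_apply]

/-- The quadratic form of `J` at `s e_a - r J⁻¹ e_a`. -/
lemma quadForm_single_sub_inv_col (hJ : J.PosDef) (a : n) (s r : ℝ) :
    (star (fun j => (s : ℂ) * Pi.single (M := fun _ => ℂ) a 1 j - r * J⁻¹ j a) ⬝ᵥ
      J *ᵥ (fun j => (s : ℂ) * Pi.single (M := fun _ => ℂ) a 1 j - r * J⁻¹ j a)).re
      = s ^ 2 * (J a a).re - 2 * s * r + r ^ 2 * (J⁻¹ a a).re := by
  have hH := hJ.isHermitian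
  have hw := mulVec_inv_col hJ a
  have e0 : (fun j => (s : ℂ) * Pi.single (M := fun _ => ℂ) a 1 j - r * J⁻¹ j a)
      = (s : ℂ) • Pi.single (M := fun _ => ℂ) a 1 - (r : ℂ) • fun j => J⁻¹ j a := by
    funext j
    simp
  have e1 : star (fun j => J⁻¹ j a) ⬝ᵥ J *ᵥ Pi.single (M := fun _ => ℂ) a 1 = 1 := by
    rw [star_dotProduct_mulVec_comm hH, hw]
    simp
  have e2 : star (Pi.single (M := fun _ => ℂ) a 1) ⬝ᵥ J *ᵥ Pi.single (M := fun _ => ℂ) a 1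
      = J a a := by
    simp
  have e3 : star (fun j => J⁻¹ j a) ⬝ᵥ Pi.single (M := fun _ => ℂ) a 1 = conj (J⁻¹ a a) := by
    simp
  have e4 : star (Pi.single (M := fun _ => ℂ) a 1) ⬝ᵥ Pi.single (M := fun _ => ℂ) a 1 = 1 := by
    simp
  rw [e0, star_sub, star_smul, star_smul, mulVec_sub, mulVec_smul, mulVec_smul, hw,
    sub_dotProduct, dotProduct_sub, dotProduct_sub, smul_dotProduct, smul_dotProduct,
    smul_dotProduct, smul_dotProduct, dotProduct_smul, dotProduct_smul, dotProduct_smul,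
    dotProduct_smul, e1, e2, e3, e4]
  simp
  ring

/-- Cauchy-Schwarz, in the form of nonnegativity of the quadratic form at `e_a - J_aa J⁻¹ e_a`. -/
lemma one_div_diag_le_inv_diag (hJ : J.PosDef) (a : n) : 1 / (J a a).re ≤ (J⁻¹ a a).re := by
  have hpos : 0 < (J a a).re := (Complex.lt_def.mp hJ.diag_pos).1
  have h := hJ.posSemidef.re_dotProduct_nonneg
    (fun j => ((1 : ℝ) : ℂ) * Pi.single (M := fun _ => ℂ) a 1 j - ((J a a).re : ℂ) * J⁻¹ j a)
  rw [RCLike.re_eq_complex_re, quadForm_single_sub_inv_col hJ] at h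
  rw [div_le_iff₀ hpos]
  nlinarith

/-- Testing the minorant on `J⁻¹ e_a` and keeping only the coordinate `a` gives `d_a R² ≤ R` for `R
= (J⁻¹)_aa`. -/
lemma inv_diag_le_one_div (hJ : J.PosDef) (hd : ∀ j, 0 < d j)
    (h : ∀ c : n → ℂ, ∑ j, d j * ‖c j‖ ^ 2 ≤ (star c ⬝ᵥ J *ᵥ c).re) (a : n) :
    (J⁻¹ a a).re ≤ 1 / d a := by
  have h1 := h (fun j => ((0 : ℝ) : ℂ) * Pi.single (M := fun _ => ℂ) a 1 j - ((1 : ℝ) : ℂ) * J⁻¹ j a)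
  rw [quadForm_single_sub_inv_col hJ] at h1
  have h2 := Finset.single_le_sum (f := fun j => d j *
    ‖((0 : ℝ) : ℂ) * Pi.single (M := fun _ => ℂ) a 1 j - ((1 : ℝ) : ℂ) * J⁻¹ j a‖ ^ 2)
    (fun j _ => mul_nonneg (hd j).le (sq_nonneg _)) (Finset.mem_univ a)
  have h3 := h2.trans h1
  simp only [Complex.ofReal_zero, zero_mul, Complex.ofReal_one, one_mul, zero_sub, norm_neg] at h3
  have hpos : 0 < (J⁻¹ a a).re := (Complex.lt_def.mp hJ.inv.diag_pos).1
  have h4 : (J⁻¹ a a).re ^ 2 ≤ ‖J⁻¹ a a‖ ^ 2 := by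
    rw [← sq_abs]
    exact pow_le_pow_left₀ (abs_nonneg _) (Complex.abs_re_le_norm _) 2
  have h5 := mul_le_mul_of_nonneg_left h4 (hd a).le
  rw [le_div_iff₀ (hd a)]
  nlinarith

/-- A second-moment estimate of Kantorovich type for a diagonal entry of `J⁻¹`, given a diagonal
lower bound for `J`. -/
lemma inv_diag_moment_bound (hJ : J.PosDef) (hd : ∀ j, 0 < d j)
    (h : ∀ c : n → ℂ, ∑ j, d j * ‖c j‖ ^ 2 ≤ (star c ⬝ᵥ J *ᵥ c).re) (a : n) (r : ℝ) :
    (J a a).re - 2 * r + r ^ 2 * (J⁻¹ a a).re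
      ≤ ((J a a).re - r) ^ 2 / d a + ∑ j ∈ Finset.univ.erase a, ‖J j a‖ ^ 2 / d j := by
  set v : n → ℂ := fun j => ((1 : ℝ) : ℂ) * Pi.single (M := fun _ => ℂ) a 1 j - r * J⁻¹ j a with hv
  set q : n → ℂ := J *ᵥ v with hq
  have hquad := quadForm_single_sub_inv_col hJ a 1 r
  rw [← hv, ← hq] at hquad
  have hqj : ∀ j, q j = J j a - r * Pi.single (M := fun _ => ℂ) a 1 j := by
    intro j
    have e0 : v = Pi.single (M := fun _ => ℂ) a 1 - (r : ℂ) • fun j => J⁻¹ j a := by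
      funext j
      simp [hv]
    rw [hq, e0, mulVec_sub, mulVec_smul, mulVec_inv_col hJ a]
    simp
  have hJaa : J a a = ((J a a).re : ℂ) := by
    exact (hJ.isHermitian.coe_re_apply_self a).symm
  have hsum : ∑ j, ‖q j‖ ^ 2 / d j
      = ((J a a).re - r) ^ 2 / d a + ∑ j ∈ Finset.univ.erase a, ‖J j a‖ ^ 2 / d j := by
    rw [← Finset.add_sum_erase _ _ (Finset.mem_univ a)]
    congr 1
    · rw [hqj, Pi.single_eq_same, mul_one, hJaa, ← Complex.ofReal_sub, Complex.norm_real,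
        Real.norm_eq_abs, sq_abs, Complex.ofReal_re]
    · refine Finset.sum_congr rfl fun j hj => ?_
      rw [hqj, Pi.single_eq_of_ne (Finset.ne_of_mem_erase hj), mul_zero, sub_zero]
  have hre : (star v ⬝ᵥ q).re = ∑ j, (conj (v j) * q j).re := by
    simp [dotProduct, Complex.re_sum]
  -- With `q = J v`, Young's inequality `2 Re (v* q) ≤ v* D v + q* D⁻¹ q` together with `v* D v ≤ v*
  -- q` gives `v* q ≤ q* D⁻¹ q`, which is `J⁻¹ ≤ D⁻¹` evaluated at `q`.
  have hpt : ∀ j, 2 * (conj (v j) * q j).re ≤ d j * ‖v j‖ ^ 2 + ‖q j‖ ^ 2 / d j := by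
    intro j
    have h1 : (conj (v j) * q j).re ≤ ‖v j‖ * ‖q j‖ := by
      refine (Complex.re_le_norm _).trans (le_of_eq ?_)
      rw [norm_mul, RCLike.norm_conj]
    have hdj := hd j
    have h2 : 0 ≤ d j * (‖v j‖ - ‖q j‖ / d j) ^ 2 := by positivity
    have h3 : d j * (‖v j‖ - ‖q j‖ / d j) ^ 2
        = d j * ‖v j‖ ^ 2 + ‖q j‖ ^ 2 / d j - 2 * (‖v j‖ * ‖q j‖) := by
      field_simp
      ring
    linarith
  have hsumpt := Finset.sum_le_sum fun j (_ : j ∈ Finset.univ) => hpt j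
  rw [← Finset.mul_sum, Finset.sum_add_distrib, ← hre, hsum, hquad] at hsumpt
  have hv2 := h v
  rw [← hq, hquad] at hv2
  linarith

/-- Quantitative consequence: if `d a = B J_aa` and the off-diagonal mass of column `a` is small,
then `(J⁻¹)_aa ≤ 1 / (κ J_aa)`. -/
theorem inv_diag_le_of_moment (hJ : J.PosDef) (hd : ∀ j, 0 < d j)
    (h : ∀ c : n → ℂ, ∑ j, d j * ‖c j‖ ^ 2 ≤ (star c ⬝ᵥ J *ᵥ c).re) (a : n) {B κ β : ℝ}
    (hB : 0 < B) (hκ : 0 < κ) (hκ1 : κ < 1) (hda : d a = B * (J a a).re)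
    (hsum : ∑ j ∈ Finset.univ.erase a, ‖J j a‖ ^ 2 / d j ≤ β * (J a a).re / B)
    (hβ : B < κ → β * (κ - B) ≤ (1 - κ) * B * (1 - B)) :
    (J⁻¹ a a).re ≤ 1 / (κ * (J a a).re) := by
  have hpos : 0 < (J a a).re := (Complex.lt_def.mp hJ.diag_pos).1
  -- If `κ ≤ B`, the minorant alone suffices and no information on the column is needed.
  rcases le_or_gt κ B with hle | hlt
  · refine (inv_diag_le_one_div hJ hd h a).trans ?_
    rw [hda]
    exact one_div_le_one_div_of_le (mul_pos hκ hpos) (mul_le_mul_of_nonneg_right hle hpos.le)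
  · have hκB : 0 < κ - B := sub_pos.mpr hlt
    have h1B : 0 < 1 - B := by linarith
    set m := (J a a).re with hm
    set R := (J⁻¹ a a).re with hR
    -- This `r` is the optimal one when `β` attains its largest allowed value `(1 - κ) B (1 - B) /
    -- (κ - B)`. The resulting minimum is then exactly `1 / (κ m)`, which explains the form of the
    -- hypothesis on `β`.
    have hmom := inv_diag_moment_bound hJ hd h a (κ * (1 - B) / (κ - B) * m)
    rw [← hm, ← hR, hda] at hmom
    have hβ' : β ≤ (1 - κ) * B * (1 - B) / (κ - B) := (le_div_iff₀ hκB).mpr (hβ hlt)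
    have hsum' : ∑ j ∈ Finset.univ.erase a, ‖J j a‖ ^ 2 / d j
        ≤ (1 - κ) * (1 - B) / (κ - B) * m := by
      refine hsum.trans ?_
      rw [div_le_iff₀ hB]
      have := mul_le_mul_of_nonneg_right hβ' hpos.le
      refine this.trans (le_of_eq ?_)
      field_simp
    rw [le_div_iff₀ (mul_pos hκ hpos)]
    set u := κ - B with hu
    have hmain := hmom.trans (add_le_add le_rfl hsum')
    have hz : 0 < (1 - B) ^ 2 * κ * m / u ^ 2 := by positivity
    refine le_of_mul_le_mul_left ?_ hz
    have e : (1 - B) ^ 2 * κ * m / u ^ 2 * (R * (κ * m))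
        = (κ * (1 - B) / u * m) ^ 2 * R := by
      field_simp
    rw [e]
    have e2 : (m - κ * (1 - B) / u * m) ^ 2 / (B * m) + (1 - κ) * (1 - B) / u * m
        - (m - 2 * (κ * (1 - B) / u * m)) = (1 - B) ^ 2 * κ * m / u ^ 2 * 1 := by
      have hκ' : κ = u + B := by rw [hu]; ring
      rw [hκ']
      field_simp
      ring
    linarith

end InverseDiagonal

/-! ### Choice of the minorant -/

/-- Bound for the weighted off-diagonal mass of a frequency column, for weight ratio `ρ`. -/
def freqMass (x ρ : ℝ) : ℝ :=
  (3 + 21 / 25 / x ^ 4 + ρ * (25 / 24 * (1 + 1 / (4 * x ^ 2)))) / x ^ 2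

/-- Bound for the weighted off-diagonal mass of an amplitude column, for weight ratio `ρ`. -/
def ampMass (x ρ : ℝ) : ℝ :=
  (1 / 3 + 1 / 2 * ρ * (25 / 24 * (1 + 1 / (4 * x ^ 2)))) / x ^ 2

/-- The normalised weights `A`, `B` are good enough for the bound `1 / (1 - 2 / x)`. -/
def AdmissibleWeights (x A B : ℝ) : Prop :=
  0 < A ∧ 0 < B ∧
  (B < 1 - 2 / x → freqMass x (B / A) * (1 - 2 / x - B) ≤ (1 - (1 - 2 / x)) * B * (1 - B)) ∧
  (A < 1 - 2 / x → ampMass x (A / B) * (1 - 2 / x - A) ≤ (1 - (1 - 2 / x)) * A * (1 - A))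

/-- The difference of the two sides has positive coefficients in the Bernstein basis of degree `8`
on `[2, 73/25]`. -/
lemma admissible_small_aux {x : ℝ} (h2 : 2 ≤ x) (h3 : x ≤ 73 / 25) :
    169 / 50 * x ^ 4 * (x ^ 4 - 6 * x - 12) ≤ 12 * (x + 2) * (x ^ 5 - 6 * x ^ 2 + 24) := by
  have hp : 0 ≤ x - 2 := sub_nonneg.mpr h2
  have hq : 0 ≤ 73 / 25 - x := sub_nonneg.mpr h3
  have e : 12 * (x + 2) * (x ^ 5 - 6 * x ^ 2 + 24) - 169 / 50 * x ^ 4 * (x ^ 4 - 6 * x - 12)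
    = 300390625000000 / 78310985281 * ((73 / 25 - x) ^ 8)
      + 2758457031250000 / 78310985281 * ((x - 2) * (73 / 25 - x) ^ 7)
      + 10996787968750000 / 78310985281 * ((x - 2) ^ 2 * (73 / 25 - x) ^ 6)
      + 24623908693750000 / 78310985281 * ((x - 2) ^ 3 * (73 / 25 - x) ^ 5)
      + 33404104162562500 / 78310985281 * ((x - 2) ^ 4 * (73 / 25 - x) ^ 4)
      + 27455619035183125 / 78310985281 * ((x - 2) ^ 5 * (73 / 25 - x) ^ 3)
      + 12712244670504475 / 78310985281 * ((x - 2) ^ 6 * (73 / 25 - x) ^ 2)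
      + 2624555686705231 / 78310985281 * ((x - 2) ^ 7 * (73 / 25 - x))
      + 2437416447056561 / 3915549264050 * ((x - 2) ^ 8) := by
    ring
  rw [← sub_nonneg, e]
  positivity

/-- As in the small range, a Bernstein certificate of degree `8`, here on `[23/50, 71/100]`. -/
lemma admissible_middle_aux {r : ℝ} (h2 : 23 / 50 ≤ r) (h3 : r ≤ 71 / 100) :
    (3012 / 1000 * (1 + r) ^ 2 + 3219 / 1000 * r ^ 2) * ((1 - r) * (1 + r) ^ 3 - 3 / 2 * r)
      * ((1 - r) * (1 + r)) ≤ 6 * r * ((1 - r) * (1 + r) ^ 4 - 3 / 2 * r ^ 2) := by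
  have hp : 0 ≤ r - 23 / 50 := sub_nonneg.mpr h2
  have hq : 0 ≤ 71 / 100 - r := sub_nonneg.mpr h3
  have e : 6 * r * ((1 - r) * (1 + r) ^ 4 - 3 / 2 * r ^ 2)
      - (3012 / 1000 * (1 + r) ^ 2 + 3219 / 1000 * r ^ 2) * ((1 - r) * (1 + r) ^ 3 - 3 / 2 * r)
      * ((1 - r) * (1 + r))
    = 437482310973183648 / 19073486328125 * ((71 / 100 - r) ^ 8)
      + 9374931249858086784 / 19073486328125 * ((r - 23 / 50) * (71 / 100 - r) ^ 7)
      + 55247518495620205344 / 19073486328125 * ((r - 23 / 50) ^ 2 * (71 / 100 - r) ^ 6)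
      + 158445050886415443888 / 19073486328125 * ((r - 23 / 50) ^ 3 * (71 / 100 - r) ^ 5)
      + 52082298239082176772 / 3814697265625 * ((r - 23 / 50) ^ 4 * (71 / 100 - r) ^ 4)
      + 258327589443577200288 / 19073486328125 * ((r - 23 / 50) ^ 5 * (71 / 100 - r) ^ 3)
      + 152841646807087555494 / 19073486328125 * ((r - 23 / 50) ^ 6 * (71 / 100 - r) ^ 2)
      + 49478526549367341759 / 19073486328125 * ((r - 23 / 50) ^ 7 * (71 / 100 - r))
      + 53502723785863470609 / 152587890625000 * ((r - 23 / 50) ^ 8) := by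
    ring
  rw [← sub_nonneg, e]
  positivity

lemma admissible_large_aux {r : ℝ} (h2 : 7 / 10 ≤ r) :
    (3012 / 1000 * (1 + r) ^ 2 + 3219 / 1000 * r ^ 2) * (1 - r + r ^ 2)
      ≤ 12 * r * ((1 + r) ^ 3 - 3 * r ^ 2) := by
  obtain ⟨v, rfl⟩ : ∃ v, r = 7 / 10 + v := ⟨r - 7 / 10, by ring⟩
  have hv : 0 ≤ v := by linarith
  have h4 : 0 ≤ v ^ 4 := by positivity
  have h3 : 0 ≤ v ^ 3 := by positivity
  have h2 : 0 ≤ v ^ 2 := by positivity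
  nlinarith

/-- Small time-bandwidth product: one lobe. -/
lemma admissible_one_lobe {x : ℝ} (hx : 2 < x) (hx3 : x ≤ 73 / 25) :
    AdmissibleWeights x ((3 * x ^ 2 - 4) / (2 * x ^ 3)) (6 * (x ^ 2 - 4) / x ^ 5) := by
  have hx0 : 0 < x := by linarith
  have hx4 : 0 < x ^ 2 - 4 := by nlinarith
  have hx34 : 0 < 3 * x ^ 2 - 4 := by nlinarith
  refine ⟨by positivity, by positivity, fun hB => ?_, fun hA => ?_⟩
  · have hBκ : 6 * (x ^ 2 - 4) / x ^ 5 < 1 - 2 / x := hB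
    have hκB : 0 < 1 - 2 / x - 6 * (x ^ 2 - 4) / x ^ 5 := sub_pos.mpr hB
    have e1 : 1 - 2 / x - 6 * (x ^ 2 - 4) / x ^ 5
        = (x - 2) * (x ^ 4 - 6 * x - 12) / x ^ 5 := by
      field_simp
      ring
    have hpos : 0 < x ^ 4 - 6 * x - 12 := by
      rw [e1] at hκB
      by_contra hc
      have : (x - 2) * (x ^ 4 - 6 * x - 12) / x ^ 5 ≤ 0 :=
        div_nonpos_of_nonpos_of_nonneg
          (mul_nonpos_of_nonneg_of_nonpos (by linarith) (not_lt.mp hc)) (by positivity)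
      linarith
    -- Close to `x = 2` the weight `B` exceeds `κ`, so the condition to be checked is not vacuous
    -- only from `11/5` on; this lower bound on `x` controls the small terms of `freqMass`.
    have hx22 : 11 / 5 ≤ x := by
      by_contra hc
      have h1 : x < 11 / 5 := not_le.mp hc
      have h2 : x ^ 4 ≤ (11 / 5) ^ 2 * x ^ 2 := by
        have : x ^ 2 ≤ (11 / 5) ^ 2 := pow_le_pow_left₀ hx0.le h1.le 2
        nlinarith [sq_nonneg x]
      nlinarith
    have hsq : (11 / 5) ^ 2 ≤ x ^ 2 := pow_le_pow_left₀ (by norm_num) hx22 2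
    have hρ : 6 * (x ^ 2 - 4) / x ^ 5 / ((3 * x ^ 2 - 4) / (2 * x ^ 3)) ≤ 304 / 1000 := by
      have e : 6 * (x ^ 2 - 4) / x ^ 5 / ((3 * x ^ 2 - 4) / (2 * x ^ 3))
          = 12 * (x ^ 2 - 4) / (x ^ 2 * (3 * x ^ 2 - 4)) := by
        field_simp
        norm_num
      rw [e, div_le_iff₀ (by positivity)]
      -- In the variable `x²` the claim is a quadratic inequality, and `7.246` approximates the
      -- vertex.
      nlinarith [sq_nonneg (x ^ 2 - 7246 / 1000)]
    have h4 : 21 / 25 / x ^ 4 ≤ 36 / 1000 := by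
      rw [div_le_iff₀ (by positivity)]
      nlinarith
    have h5 : 1 / (4 * x ^ 2) ≤ 52 / 1000 := by
      rw [div_le_iff₀ (by positivity)]
      nlinarith
    have hm : freqMass x (6 * (x ^ 2 - 4) / x ^ 5 / ((3 * x ^ 2 - 4) / (2 * x ^ 3)))
        ≤ 169 / 50 / x ^ 2 := by
      unfold freqMass
      refine div_le_div_of_nonneg_right ?_ (by positivity)
      have h6 : 25 / 24 * (1 + 1 / (4 * x ^ 2)) ≤ 25 / 24 * (1 + 52 / 1000) := by linarith
      have h7 := mul_le_mul hρ h6 (by positivity) (by norm_num)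
      linarith
    refine (mul_le_mul_of_nonneg_right hm hκB.le).trans ?_
    rw [e1, ← sub_nonneg]
    have e2 : (1 - (1 - 2 / x)) * (6 * (x ^ 2 - 4) / x ^ 5) * (1 - 6 * (x ^ 2 - 4) / x ^ 5)
        - 169 / 50 / x ^ 2 * ((x - 2) * (x ^ 4 - 6 * x - 12) / x ^ 5)
        = (x - 2) * (12 * (x + 2) * (x ^ 5 - 6 * x ^ 2 + 24)
          - 169 / 50 * x ^ 4 * (x ^ 4 - 6 * x - 12)) / x ^ 11 := by
      field_simp
      ring
    rw [e2]
    exact div_nonneg (mul_nonneg (by linarith)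
      (sub_nonneg.mpr (admissible_small_aux hx.le hx3))) (by positivity)
  -- In this range `A ≥ κ`, so the amplitude condition is vacuous.
  · exfalso
    have e : (3 * x ^ 2 - 4) / (2 * x ^ 3) - (1 - 2 / x)
        = (7 * x ^ 2 - 2 * x ^ 3 - 4) / (2 * x ^ 3) := by
      field_simp
      ring
    have : 0 ≤ (7 * x ^ 2 - 2 * x ^ 3 - 4) / (2 * x ^ 3) := by
      refine div_nonneg ?_ (by positivity)
      nlinarith [mul_nonneg (sub_nonneg.mpr hx.le) (sub_nonneg.mpr hx3)]
    linarith

/-- The ratio `B / A = 3r² / (1 + r)²` does not involve `w`, so one estimate serves both two-lobe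
regimes. The constants `3.012 = 3 + 0.012` and `3.219 = 3 · 1.073` absorb the lower-order terms by
means of `1 + r ≥ 1.46`. -/
lemma freqMass_two_lobe_le {r : ℝ} (hr : 23 / 50 ≤ r) :
    freqMass (2 * (1 + r)) (3 * r ^ 2 / (1 + r) ^ 2)
      ≤ (3012 / 1000 * (1 + r) ^ 2 + 3219 / 1000 * r ^ 2) / (4 * (1 + r) ^ 4) := by
  have h2 : (146 / 100) ^ 2 ≤ (1 + r) ^ 2 := pow_le_pow_left₀ (by norm_num) (by linarith) 2
  have h4' : (146 / 100) ^ 4 ≤ (1 + r) ^ 4 := pow_le_pow_left₀ (by norm_num) (by linarith) 4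
  have hr1 : 0 < 1 + r := by linarith
  have h4 : 21 / 25 / (2 * (1 + r)) ^ 4 ≤ 12 / 1000 := by
    rw [div_le_iff₀ (by positivity)]
    nlinarith
  have h5 : 25 / 24 * (1 + 1 / (4 * (2 * (1 + r)) ^ 2)) ≤ 1073 / 1000 := by
    have : 1 / (4 * (2 * (1 + r)) ^ 2) ≤ 30 / 1000 := by
      rw [div_le_iff₀ (by positivity)]
      nlinarith
    linarith
  have h7 := mul_le_mul_of_nonneg_left h5 (show 0 ≤ 3 * r ^ 2 / (1 + r) ^ 2 by positivity)
  have e : (3012 / 1000 * (1 + r) ^ 2 + 3219 / 1000 * r ^ 2) / (4 * (1 + r) ^ 4)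
      = (3012 / 1000 + 3 * r ^ 2 / (1 + r) ^ 2 * (1073 / 1000)) / (2 * (1 + r)) ^ 2 := by
    field_simp
    ring
  rw [e]
  unfold freqMass
  refine div_le_div_of_nonneg_right ?_ (by positivity)
  linarith

/-- Moderate time-bandwidth product: two overlapping lobes. -/
lemma admissible_overlapping_lobes {r : ℝ} (hr : 23 / 50 ≤ r) (hr1 : r ≤ 71 / 100) :
    AdmissibleWeights (2 * (1 + r)) (1 / (2 * (1 - r ^ 2) * (1 + r)))
      (3 / 2 * r ^ 2 / ((1 - r ^ 2) * (1 + r) ^ 3)) := by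
  have hr0 : 0 < r := by linarith
  have h1r : 0 < 1 - r := by linarith
  have hr2 : 0 < 1 - r ^ 2 := by nlinarith
  have hrp : 0 < 1 + r := by linarith
  have eκ : 1 - 2 / (2 * (1 + r)) = r / (1 + r) := by
    field_simp
    ring
  have eρ : 3 / 2 * r ^ 2 / ((1 - r ^ 2) * (1 + r) ^ 3) / (1 / (2 * (1 - r ^ 2) * (1 + r)))
      = 3 * r ^ 2 / (1 + r) ^ 2 := by
    field_simp
  refine ⟨by positivity, by positivity, fun hB => ?_, fun hA => ?_⟩
  · rw [eρ]
    refine (mul_le_mul_of_nonneg_right (freqMass_two_lobe_le hr) (sub_pos.mpr hB).le).trans ?_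
    rw [eκ, ← sub_nonneg]
    have e : (1 - r / (1 + r)) * (3 / 2 * r ^ 2 / ((1 - r ^ 2) * (1 + r) ^ 3)) *
          (1 - 3 / 2 * r ^ 2 / ((1 - r ^ 2) * (1 + r) ^ 3))
        - (3012 / 1000 * (1 + r) ^ 2 + 3219 / 1000 * r ^ 2) / (4 * (1 + r) ^ 4) *
          (r / (1 + r) - 3 / 2 * r ^ 2 / ((1 - r ^ 2) * (1 + r) ^ 3))
        = r * (6 * r * ((1 - r) * (1 + r) ^ 4 - 3 / 2 * r ^ 2)
          - (3012 / 1000 * (1 + r) ^ 2 + 3219 / 1000 * r ^ 2) *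
            ((1 - r) * (1 + r) ^ 3 - 3 / 2 * r) * ((1 - r) * (1 + r)))
          / (4 * (1 - r) ^ 2 * (1 + r) ^ 9) := by
      have : 1 - r ^ 2 = (1 - r) * (1 + r) := by ring
      rw [this]
      field_simp
      ring
    rw [e]
    exact div_nonneg (mul_nonneg hr0.le (sub_nonneg.mpr (admissible_middle_aux hr hr1)))
      (by positivity)
  -- Here `A ≥ κ` amounts to `2r(1 - r²) ≤ 1`, which holds for every `r ≥ 0`, so the amplitude
  -- condition is vacuous.
  · exfalso
    rw [eκ, div_lt_div_iff₀ (by positivity) hrp] at hA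
    nlinarith [mul_nonneg hr0.le (sq_nonneg (r - 1 / 2)), mul_pos hr0 hr2]

/-- Large time-bandwidth product: two disjoint lobes. -/
lemma admissible_disjoint_lobes {r : ℝ} (hr : 7 / 10 ≤ r) :
    AdmissibleWeights (2 * (1 + r)) (1 / (1 + r)) (3 * r ^ 2 / (1 + r) ^ 3) := by
  have hr0 : 0 < r := by linarith
  have hrp : 0 < 1 + r := by linarith
  have eκ : 1 - 2 / (2 * (1 + r)) = r / (1 + r) := by
    field_simp
    ring
  have eρ : 3 * r ^ 2 / (1 + r) ^ 3 / (1 / (1 + r)) = 3 * r ^ 2 / (1 + r) ^ 2 := by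
    field_simp
  refine ⟨by positivity, by positivity, fun hB => ?_, fun hA => ?_⟩
  · rw [eρ]
    refine (mul_le_mul_of_nonneg_right (freqMass_two_lobe_le (by linarith))
      (sub_pos.mpr hB).le).trans ?_
    rw [eκ, ← sub_nonneg]
    have e : (1 - r / (1 + r)) * (3 * r ^ 2 / (1 + r) ^ 3) * (1 - 3 * r ^ 2 / (1 + r) ^ 3)
        - (3012 / 1000 * (1 + r) ^ 2 + 3219 / 1000 * r ^ 2) / (4 * (1 + r) ^ 4) *
          (r / (1 + r) - 3 * r ^ 2 / (1 + r) ^ 3)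
        = r * (12 * r * ((1 + r) ^ 3 - 3 * r ^ 2)
          - (3012 / 1000 * (1 + r) ^ 2 + 3219 / 1000 * r ^ 2) * (1 - r + r ^ 2))
          / (4 * (1 + r) ^ 7) := by
      field_simp
      ring
    rw [e]
    exact div_nonneg (mul_nonneg hr0.le (sub_nonneg.mpr (admissible_large_aux hr)))
      (by positivity)
  · rw [eκ] at hA ⊢
    -- The amplitude weight `1/(1 + r)` falls below `κ = r/(1 + r)` only when `r > 1`.
    have hr1 : 1 < r := by
      rw [div_lt_div_iff_of_pos_right hrp] at hA
      exact hA
    have eρ' : 1 / (1 + r) / (3 * r ^ 2 / (1 + r) ^ 3) = (1 + r) ^ 2 / (3 * r ^ 2) := by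
      field_simp
    have h1 : (1 + r) ^ 2 / (3 * r ^ 2) ≤ 4 / 3 := by
      rw [div_le_iff₀ (by positivity)]
      nlinarith
    have h2 : 25 / 24 * (1 + 1 / (4 * (2 * (1 + r)) ^ 2)) ≤ 107 / 100 := by
      have : 1 / (4 * (2 * (1 + r)) ^ 2) ≤ 1 / 64 := by
        refine one_div_le_one_div_of_le (by norm_num) ?_
        nlinarith
      linarith
    have hm : ampMass (2 * (1 + r)) ((1 + r) ^ 2 / (3 * r ^ 2)) ≤ 2 / (2 * (1 + r)) ^ 2 := by
      unfold ampMass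
      refine div_le_div_of_nonneg_right ?_ (by positivity)
      have := mul_le_mul h1 h2 (by positivity) (by norm_num)
      linarith
    rw [eρ']
    refine (mul_le_mul_of_nonneg_right hm (sub_pos.mpr hA).le).trans ?_
    rw [← sub_nonneg]
    have e : (1 - r / (1 + r)) * (1 / (1 + r)) * (1 - 1 / (1 + r))
        - 2 / (2 * (1 + r)) ^ 2 * (r / (1 + r) - 1 / (1 + r))
        = (r + 1) / (2 * (1 + r) ^ 3) := by
      field_simp
      ring
    rw [e]
    positivity

/-- For every `x > 2` there is a two-lobe minorant with admissible weights. -/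
theorem exists_admissible {x : ℝ} (hx : 2 < x) :
    ∃ H r w : ℝ, 0 ≤ H ∧ 0 ≤ r ∧ 0 ≤ w ∧ 2 * (H + r) = x ∧ w * H ^ 2 ≤ 1 ∧
      w * (2 * (H ^ 2 - r ^ 2)) ≤ 1 ∧
      AdmissibleWeights x (2 * w * (3 / 2 * H ^ 2 - 1 / 2) / x)
        (12 * (2 * w * (r ^ 2 * (3 / 2 * H ^ 2 - 1 / 2) + 1 / 2 * (H ^ 2 - 1))) / x ^ 3) := by
  have hx0 : 0 < x := by linarith
  rcases le_or_gt x (73 / 25) with h1 | h1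
  -- With `r = 0` the two lobes coincide. They fill the whole window, and `w = 1 / (2H²)` normalises
  -- their sum to height `1`.
  · refine ⟨x / 2, 0, 2 / x ^ 2, by positivity, le_rfl, by positivity, by ring, ?_, ?_, ?_⟩
    · field_simp
      norm_num
    · have : 2 / x ^ 2 * (2 * ((x / 2) ^ 2 - 0 ^ 2)) = 1 := by
        field_simp
        norm_num
      exact this.le
    · convert admissible_one_lobe hx h1 using 1
      · field_simp
        ring
      · field_simp
        ring
  -- From here on `H = 1`, which removes the `H² - 1` term from the derivative weight, and the lobes
  -- are pushed to the edges of the window, `r = x/2 - 1`.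
  · obtain ⟨r, rfl⟩ : ∃ r, x = 2 * (1 + r) := ⟨x / 2 - 1, by ring⟩
    have hr : 23 / 50 ≤ r := by linarith
    have hrp : 0 < 1 + r := by linarith
    rcases le_or_gt r (71 / 100) with h2 | h2
    · have hr2 : 0 < 1 - r ^ 2 := by nlinarith
      -- The sum of two overlapping lobes peaks at `2(1 - r²)`. Once `r² ≥ 1/2` this is at most `1`
      -- and `w = 1` is allowed even though the lobes may still overlap; otherwise `w` divides by
      -- the peak.
      rcases le_or_gt (1 / 2) (r ^ 2) with h3 | h3
      · refine ⟨1, r, 1, by norm_num, by linarith, by norm_num, rfl, by norm_num, by linarith, ?_⟩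
        convert admissible_disjoint_lobes (r := r) (by nlinarith) using 1
        · field_simp
          norm_num
        · field_simp
          ring
      · refine ⟨1, r, 1 / (2 * (1 - r ^ 2)), by norm_num, by linarith, by positivity, rfl, ?_, ?_, ?_⟩
        · rw [one_pow, mul_one, div_le_one (by positivity)]
          linarith
        · rw [one_pow]
          exact (one_div_mul_cancel (by positivity)).le
        · convert admissible_overlapping_lobes hr h2 using 1
          · field_simp
            norm_num
          · field_simp
            ring
    · refine ⟨1, r, 1, by norm_num, by linarith, by norm_num, rfl, by norm_num, by nlinarith, ?_⟩
      convert admissible_disjoint_lobes (r := r) (by linarith) using 1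
      · field_simp
        norm_num
      · field_simp
        ring

/-! ### Column sums of the Gram matrix -/

lemma sum_window (N : ℕ) : ∑ k : Fin N, ((k : ℕ) - ((N : ℝ) - 1) / 2) = 0 := by
  rw [Fin.sum_univ_eq_sum_range (fun k : ℕ => (k : ℝ) - ((N : ℝ) - 1) / 2) N]
  have h : ∀ c : ℝ, ∀ n : ℕ, ∑ k ∈ Finset.range n, ((k : ℝ) - c) = n * (n - 1) / 2 - c * n := by
    intro c n
    induction n with
    | zero => simp
    | succ n ih =>
      rw [Finset.sum_range_succ, ih]
      push_cast
      ring
  rw [h]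
  ring

lemma sum_window_sq (N : ℕ) :
    ∑ k : Fin N, ((k : ℕ) - ((N : ℝ) - 1) / 2) ^ 2 = N * ((N : ℝ) ^ 2 - 1) / 12 := by
  rw [Fin.sum_univ_eq_sum_range (fun k : ℕ => ((k : ℝ) - ((N : ℝ) - 1) / 2) ^ 2) N]
  have h : ∀ c : ℝ, ∀ n : ℕ, ∑ k ∈ Finset.range n, ((k : ℝ) - c) ^ 2
      = n * (n - 1) * (2 * n - 1) / 6 - c * (n * (n - 1)) + c ^ 2 * n := by
    intro c n
    induction n with
    | zero => simp
    | succ n ih =>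
      rw [Finset.sum_range_succ, ih]
      push_cast
      ring
  rw [h]
  ring

lemma trigMoment_zero_zero (N : ℕ) : trigMoment N 0 0 = N := by simp [trigMoment]

lemma trigMoment_one_zero (N : ℕ) : trigMoment N 1 0 = 0 := by
  have h := congrArg (fun x : ℝ => (x : ℂ)) (sum_window N)
  simp only [Complex.ofReal_sum, Complex.ofReal_zero] at h
  simpa [trigMoment] using h

lemma trigMoment_two_zero (N : ℕ) :
    trigMoment N 2 0 = ((N * ((N : ℝ) ^ 2 - 1) / 12 : ℝ) : ℂ) := by
  have h := congrArg (fun x : ℝ => (x : ℂ)) (sum_window_sq N)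
  simp only [Complex.ofReal_sum, Complex.ofReal_pow] at h
  rw [← h, trigMoment]
  simp

/-- Jordan's inequality `sin (π|u|) ≥ 2|u|` at the representative `u` of `Δ` in `[-1/2, 1/2]`. -/
lemma four_mul_sq_le_sin_sq {δ Δ : ℝ} (hδ : 0 ≤ δ) (h : ∀ k : ℤ, δ ≤ |Δ + k|) :
    4 * δ ^ 2 ≤ Real.sin (Real.pi * Δ) ^ 2 := by
  set u := Δ - round Δ with hu
  have hu1 : |u| ≤ 1 / 2 := abs_sub_round Δ
  have hu2 : δ ≤ |u| := by
    have := h (-round Δ)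
    rwa [Int.cast_neg, ← sub_eq_add_neg] at this
  have hsin : Real.sin (Real.pi * Δ) ^ 2 = Real.sin (Real.pi * |u|) ^ 2 := by
    have h1 : Real.sin (Real.pi * u) ^ 2 = Real.sin (Real.pi * Δ) ^ 2 := by
      rw [hu, mul_sub, mul_comm Real.pi ((round Δ : ℤ) : ℝ), Real.sin_sub_int_mul_pi, mul_pow]
      rcases Int.even_or_odd (round Δ) with hn | hn <;> simp [hn.neg_one_zpow]
    rcases abs_choice u with h2 | h2 <;> rw [h2, ← h1]
    rw [mul_neg, Real.sin_neg, neg_sq]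
  have hle : 2 * |u| ≤ Real.sin (Real.pi * |u|) := by
    have := Real.mul_le_sin (x := Real.pi * |u|) (by positivity)
      (by nlinarith [Real.pi_pos])
    refine le_trans (le_of_eq ?_) this
    have := Real.pi_ne_zero
    field_simp
  rw [hsin]
  have := pow_le_pow_left₀ (by positivity) ((mul_le_mul_of_nonneg_left hu2 zero_le_two).trans hle) 2
  linarith

section MomentSums

variable {ι : Type*} [Fintype ι] [DecidableEq ι] {δ : ℝ} {t : ι → ℝ} {N : ℕ}

lemma sum_inv_sin_sq_le' (hδ : 0 < δ) (hδ1 : δ ≤ 1)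
    (hsep : ∀ i j, i ≠ j → ∀ k : ℤ, δ ≤ |t i - t j + k|) (i : ι) :
    ∑ j ∈ Finset.univ.erase i, 1 / Real.sin (Real.pi * (t i - t j)) ^ 2 ≤ 1 / (3 * δ ^ 2) := by
  refine le_trans (le_of_eq (Finset.sum_congr rfl fun j _ => ?_)) (sum_inv_sin_sq_le hδ hsep hδ1 i)
  rw [← neg_sub (t j), mul_neg, Real.sin_neg, neg_sq]

lemma sum_trigMoment_zero_le (hδ : 0 < δ) (hδ1 : δ ≤ 1)
    (hsep : ∀ i j, i ≠ j → ∀ k : ℤ, δ ≤ |t i - t j + k|) (i : ι) (hx : 0 < (N : ℝ) * δ) :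
    ∑ j ∈ Finset.univ.erase i, ‖trigMoment N 0 (t i - t j)‖ ^ 2
      ≤ (N : ℝ) ^ 2 * (1 / 3 / (N * δ) ^ 2) := by
  have hN : (N : ℝ) ≠ 0 := fun h => by rw [h, zero_mul] at hx; exact lt_irrefl _ hx
  have h1 : ∀ j ∈ Finset.univ.erase i, ‖trigMoment N 0 (t i - t j)‖ ^ 2
      ≤ 1 / Real.sin (Real.pi * (t i - t j)) ^ 2 := fun j hj =>
    norm_sq_trigMoment_zero_le N (sin_pi_mul_ne_zero hδ (hsep i j (Finset.ne_of_mem_erase hj).symm))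
  refine (Finset.sum_le_sum h1).trans ((sum_inv_sin_sq_le' hδ hδ1 hsep i).trans (le_of_eq ?_))
  field_simp

/-- The diagonal term vanishes because the window is centred. The factor `25/24` is the value of `N²
/ (N² - 1)` at `N = 5`, its largest for `N ≥ 5`. -/
lemma sum_trigMoment_one_le (hδ : 0 < δ) (hδ1 : δ ≤ 1)
    (hsep : ∀ i j, i ≠ j → ∀ k : ℤ, δ ≤ |t i - t j + k|) (i : ι)
    (hN : 5 ≤ N) :
    ∑ j, ‖trigMoment N 1 (t i - t j)‖ ^ 2
      ≤ (N : ℝ) * (N * ((N : ℝ) ^ 2 - 1) / 12) *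
        (25 / 24 * (1 + 1 / (4 * (N * δ) ^ 2)) / (N * δ) ^ 2) := by
  have hN5 : (5 : ℝ) ≤ N := by exact_mod_cast hN
  have hN0 : (0 : ℝ) < N := by linarith
  rw [← Finset.add_sum_erase _ _ (Finset.mem_univ i), sub_self, trigMoment_one_zero, norm_zero,
    zero_pow two_ne_zero, zero_add]
  set c : ℝ := (N : ℝ) ^ 2 / 4 * (1 + 1 / (4 * (N * δ) ^ 2)) with hc
  have h1 : ∀ j ∈ Finset.univ.erase i, ‖trigMoment N 1 (t i - t j)‖ ^ 2
      ≤ c * (1 / Real.sin (Real.pi * (t i - t j)) ^ 2) := by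
    intro j hj
    have hs := hsep i j (Finset.ne_of_mem_erase hj).symm
    have h0 := sin_pi_mul_ne_zero hδ hs
    refine (norm_sq_trigMoment_one_le N h0).trans ?_
    have hS := four_mul_sq_le_sin_sq hδ.le hs
    have hC : Real.cos (Real.pi * (t i - t j)) ^ 2 ≤ 1 := Real.cos_sq_le_one _
    set S := Real.sin (Real.pi * (t i - t j))
    set C := Real.cos (Real.pi * (t i - t j))
    have hS0 : 0 < S ^ 2 := by positivity
    have hCS : C ^ 2 / S ^ 2 ≤ 1 / (4 * δ ^ 2) :=
      div_le_div₀ zero_le_one hC (by positivity) hS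
    have e : 1 / 4 * ((N : ℝ) ^ 2 / S ^ 2 + C ^ 2 / S ^ 4)
        = (1 / 4 * ((N : ℝ) ^ 2 + C ^ 2 / S ^ 2)) * (1 / S ^ 2) := by
      field_simp
    have ec : c = 1 / 4 * ((N : ℝ) ^ 2 + 1 / (4 * δ ^ 2)) := by
      rw [hc]
      field_simp
    rw [e, ec]
    refine mul_le_mul_of_nonneg_right ?_ (by positivity)
    linarith
  refine (Finset.sum_le_sum h1).trans ?_
  rw [← Finset.mul_sum]
  have hc0 : 0 ≤ c := by positivity
  refine (mul_le_mul_of_nonneg_left (sum_inv_sin_sq_le' hδ hδ1 hsep i) hc0).trans ?_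
  have e1 : c * (1 / (3 * δ ^ 2)) = (N : ℝ) ^ 4 / 12 * ((1 + 1 / (4 * (N * δ) ^ 2)) / (N * δ) ^ 2) := by
    rw [hc]
    field_simp
    norm_num
  have e2 : (N : ℝ) * (N * ((N : ℝ) ^ 2 - 1) / 12) *
        (25 / 24 * (1 + 1 / (4 * (N * δ) ^ 2)) / (N * δ) ^ 2)
      = (N : ℝ) ^ 2 * (25 / 24 * ((N : ℝ) ^ 2 - 1)) / 12 *
        ((1 + 1 / (4 * (N * δ) ^ 2)) / (N * δ) ^ 2) := by ring
  rw [e1, e2]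
  refine mul_le_mul_of_nonneg_right ?_ (by positivity)
  nlinarith [sq_nonneg (N : ℝ), mul_nonneg (sq_nonneg (N : ℝ)) (show 0 ≤ (N : ℝ) ^ 2 - 25 by nlinarith)]

/-- The correction `C² / S⁶` is made relative to the main term through `S² ≥ 4δ²`. The constant
`7/25` needs `N⁴ / (N² - 1)² ≤ 28/25`, which holds since the left side is at most `(25/24)²`; then
`21/25 = 3 · 7/25`. -/
lemma sum_trigMoment_two_le (hδ : 0 < δ) (hδ1 : δ ≤ 1)
    (hsep : ∀ i j, i ≠ j → ∀ k : ℤ, δ ≤ |t i - t j + k|) (i : ι)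
    (hN : 5 ≤ N) :
    ∑ j ∈ Finset.univ.erase i, ‖trigMoment N 2 (t i - t j)‖ ^ 2
      ≤ (N * ((N : ℝ) ^ 2 - 1) / 12) ^ 2 * ((3 + 21 / 25 / (N * δ) ^ 4) / (N * δ) ^ 2) := by
  have hN5 : (5 : ℝ) ≤ N := by exact_mod_cast hN
  have hN0 : (0 : ℝ) < N := by linarith
  have hN21 : 0 < (N : ℝ) ^ 2 - 1 := by nlinarith
  set c : ℝ := ((N : ℝ) ^ 2 - 1) ^ 2 / 16 * (1 + 7 / 25 / (N * δ) ^ 4) with hc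
  have h1 : ∀ j ∈ Finset.univ.erase i, ‖trigMoment N 2 (t i - t j)‖ ^ 2
      ≤ c * (1 / Real.sin (Real.pi * (t i - t j)) ^ 2) := by
    intro j hj
    have hs := hsep i j (Finset.ne_of_mem_erase hj).symm
    have h0 := sin_pi_mul_ne_zero hδ hs
    refine (norm_sq_trigMoment_two_le N h0).trans ?_
    have hS := four_mul_sq_le_sin_sq hδ.le hs
    have hC : Real.cos (Real.pi * (t i - t j)) ^ 2 ≤ 1 := Real.cos_sq_le_one _
    set S := Real.sin (Real.pi * (t i - t j))
    set C := Real.cos (Real.pi * (t i - t j))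
    have hS0 : 0 < S ^ 2 := by positivity
    have hS4 : 16 * δ ^ 4 ≤ S ^ 4 := by
      have := pow_le_pow_left₀ (by positivity) hS 2
      nlinarith
    have hCS : C ^ 2 / S ^ 4 ≤ 1 / (16 * δ ^ 4) :=
      div_le_div₀ zero_le_one hC (by positivity) hS4
    have e : ((N : ℝ) ^ 2 - 1) ^ 2 / (16 * S ^ 2) + C ^ 2 / (4 * S ^ 6)
        = (((N : ℝ) ^ 2 - 1) ^ 2 / 16 + 1 / 4 * (C ^ 2 / S ^ 4)) * (1 / S ^ 2) := by
      field_simp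
    rw [e]
    refine mul_le_mul_of_nonneg_right ?_ (by positivity)
    have hkey : 1 / 4 * (1 / (16 * δ ^ 4))
        ≤ ((N : ℝ) ^ 2 - 1) ^ 2 / 16 * (7 / 25 / (N * δ) ^ 4) := by
      have e3 : ((N : ℝ) ^ 2 - 1) ^ 2 / 16 * (7 / 25 / (N * δ) ^ 4)
          = ((N : ℝ) ^ 2 - 1) ^ 2 * (7 / 25) / (N : ℝ) ^ 4 * (1 / (16 * δ ^ 4)) := by
        field_simp
      rw [e3]
      refine mul_le_mul_of_nonneg_right ?_ (by positivity)
      rw [le_div_iff₀ (by positivity)]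
      have h24 : 24 / 25 * (N : ℝ) ^ 2 ≤ (N : ℝ) ^ 2 - 1 := by nlinarith
      have := pow_le_pow_left₀ (by positivity) h24 2
      nlinarith [pow_pos hN0 4]
    rw [hc]
    linarith
  refine (Finset.sum_le_sum h1).trans ?_
  rw [← Finset.mul_sum]
  have hc0 : 0 ≤ c := by positivity
  refine (mul_le_mul_of_nonneg_left (sum_inv_sin_sq_le' hδ hδ1 hsep i) hc0).trans (le_of_eq ?_)
  rw [hc]
  field_simp
  ring

end MomentSums

/-! ### The Gram matrix of the response vectors -/

section Gram

variable {N m L : ℕ}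

/-- The frequencies of all the columns of the sparse and diffuse dictionaries. -/
def nodes (L : ℕ) {m : ℕ} (f : Fin m → ℝ) : Fin m ⊕ Fin L → ℝ :=
  Sum.elim f fun r => -(((r : ℕ) : ℝ) / (L : ℝ))

lemma steering_eq_phase (N : ℕ) (f : ℝ) (k : Fin N) :
    steering N f k = phase (((k : ℕ) - ((N : ℝ) - 1) / 2) * f) := by
  rw [steering, phase]
  congr 1
  push_cast
  ring

/-- Derivatives of the channel with respect to the coordinates of `θ`. -/
def response (N : ℕ) (f : Fin m → ℝ) (α : Fin m → ℂ) : ParamIdx m L → Fin N → ℂ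
  | Sum.inl i, k => α i * (2 * Real.pi * Complex.I *
      (((k : ℕ) - ((N : ℝ) - 1) / 2 : ℝ) : ℂ) * steering N (f i) k)
  | Sum.inr (Sum.inl j), k => steering N (nodes L f j) k
  | Sum.inr (Sum.inr _), _ => 0

/-- Derivatives of the conjugate channel with respect to the coordinates of `θ`. -/
def responseConj (N : ℕ) (f : Fin m → ℝ) (α : Fin m → ℂ) : ParamIdx m L → Fin N → ℂ
  | Sum.inl i, k => conj (α i * (2 * Real.pi * Complex.I *
      (((k : ℕ) - ((N : ℝ) - 1) / 2 : ℝ) : ℂ) * steering N (f i) k))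
  | Sum.inr (Sum.inl _), _ => 0
  | Sum.inr (Sum.inr j), k => conj (steering N (nodes L f j) k)

/-- The Fisher information matrix for unit signal-to-noise ratio. -/
def gram (L N : ℕ) (f : Fin m → ℝ) (α : Fin m → ℂ) :
    Matrix (ParamIdx m L) (ParamIdx m L) ℂ :=
  Matrix.of fun a b => ∑ k, (conj (responseConj N f α a k) * responseConj N f α b k
    + conj (response N f α a k) * response N f α b k)

variable (f : Fin m → ℝ) (α : Fin m → ℂ)

lemma gram_eq : gram L N f α
    = (Matrix.of fun k a => responseConj N f α a k)ᴴ * (Matrix.of fun k a => responseConj N f α a k)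
      + (Matrix.of fun k a => response N f α a k)ᴴ * (Matrix.of fun k a => response N f α a k) := by
  ext a b
  simp [gram, mul_apply, Finset.sum_add_distrib]

lemma gram_isHermitian : (gram L N f α).IsHermitian := by
  rw [gram_eq]
  exact (isHermitian_conjTranspose_mul_self _).add (isHermitian_conjTranspose_mul_self _)

lemma re_quadForm_conjTranspose_mul_self {n : Type*} [Fintype n] (V : Matrix (Fin N) n ℂ)
    (c : n → ℂ) : (star c ⬝ᵥ (Vᴴ * V) *ᵥ c).re = ∑ k, ‖∑ a, c a * V k a‖ ^ 2 := by
  rw [← mulVec_mulVec, dotProduct_mulVec, ← star_mulVec, dotProduct, Complex.re_sum]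
  refine Finset.sum_congr rfl fun k _ => ?_
  rw [Pi.star_apply, RCLike.star_def, Complex.conj_mul', ← Complex.ofReal_pow, Complex.ofReal_re,
    mulVec, dotProduct]
  simp only [mul_comm]

lemma gram_quadForm (c : ParamIdx m L → ℂ) :
    (star c ⬝ᵥ gram L N f α *ᵥ c).re = ∑ k, (‖∑ a, c a * responseConj N f α a k‖ ^ 2
      + ‖∑ a, c a * response N f α a k‖ ^ 2) := by
  rw [gram_eq, add_mulVec, dotProduct_add, Complex.add_re, re_quadForm_conjTranspose_mul_self,
    re_quadForm_conjTranspose_mul_self, Finset.sum_add_distrib]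
  rfl

end Gram

/-! ### Entries of the Gram matrix -/

section GramEntries

variable {N m L : ℕ} (f : Fin m → ℝ) (α : Fin m → ℂ)

lemma conj_steering_mul_steering (u v : ℝ) (k : Fin N) :
    conj (steering N u k) * steering N v k = phase (((k : ℕ) - ((N : ℝ) - 1) / 2) * (v - u)) := by
  rw [steering_eq_phase, steering_eq_phase, conj_phase, ← phase_add]
  congr 1
  ring

lemma gram_inl_inl (i j : Fin m) : gram L N f α (Sum.inl j) (Sum.inl i)
    = 4 * Real.pi ^ 2 * conj (α j) * α i * trigMoment N 2 (f i - f j)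
      + conj (4 * Real.pi ^ 2 * conj (α j) * α i * trigMoment N 2 (f i - f j)) := by
  have h : ∑ k : Fin N, conj (response N f α (L := L) (Sum.inl j) k)
      * response N f α (L := L) (Sum.inl i) k
      = 4 * Real.pi ^ 2 * conj (α j) * α i * trigMoment N 2 (f i - f j) := by
    rw [trigMoment, Finset.mul_sum]
    refine Finset.sum_congr rfl fun k _ => ?_
    rw [← conj_steering_mul_steering]
    simp only [response, map_mul, Complex.conj_ofReal, Complex.conj_I, map_ofNat]
    linear_combination (-(4 * (Real.pi : ℂ) ^ 2 * conj (α j) * α i *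
      ((((k : ℕ) - ((N : ℝ) - 1) / 2 : ℝ) : ℂ)) ^ 2 * (conj (steering N (f j) k) *
        steering N (f i) k))) * Complex.I_sq
  rw [gram, of_apply, Finset.sum_add_distrib, h, add_comm, ← h, map_sum]
  congr 1
  refine Finset.sum_congr rfl fun k _ => ?_
  simp only [response, responseConj, map_mul, Complex.conj_conj]

lemma norm_gram_inl_inl_le (i j : Fin m) : ‖gram L N f α (Sum.inl j) (Sum.inl i)‖
    ≤ 8 * Real.pi ^ 2 * ‖α i‖ * ‖α j‖ * ‖trigMoment N 2 (f i - f j)‖ := by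
  rw [gram_inl_inl]
  refine (norm_add_le _ _).trans (le_of_eq ?_)
  rw [RCLike.norm_conj]
  simp only [norm_mul, RCLike.norm_conj, norm_pow, Complex.norm_real, Real.norm_eq_abs, sq_abs,
    Complex.norm_ofNat]
  ring

lemma gram_inl_self (i : Fin m) : gram L N f α (Sum.inl i) (Sum.inl i)
    = ((8 * Real.pi ^ 2 * ‖α i‖ ^ 2 * (N * ((N : ℝ) ^ 2 - 1) / 12) : ℝ) : ℂ) := by
  rw [gram_inl_inl, sub_self, trigMoment_two_zero, mul_assoc _ (conj (α i)), Complex.conj_mul']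
  simp only [map_mul, map_pow, Complex.conj_ofReal, map_ofNat]
  push_cast
  ring

lemma gram_amp_amp (j q : Fin m ⊕ Fin L) :
    gram L N f α (Sum.inr (Sum.inl q)) (Sum.inr (Sum.inl j))
      = trigMoment N 0 (nodes L f j - nodes L f q) := by
  rw [gram, of_apply, trigMoment]
  refine Finset.sum_congr rfl fun k _ => ?_
  simp only [response, responseConj, conj_steering_mul_steering, pow_zero, one_mul, mul_zero,
    zero_add]

lemma gram_conj_amp (j q : Fin m ⊕ Fin L) :
    gram L N f α (Sum.inr (Sum.inr q)) (Sum.inr (Sum.inl j)) = 0 := by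
  rw [gram, of_apply]
  refine Finset.sum_eq_zero fun k _ => ?_
  simp [response, responseConj]

lemma gram_amp_inl (i : Fin m) (q : Fin m ⊕ Fin L) :
    gram L N f α (Sum.inr (Sum.inl q)) (Sum.inl i)
      = 2 * Real.pi * Complex.I * α i * trigMoment N 1 (f i - nodes L f q) := by
  rw [gram, of_apply, trigMoment, Finset.mul_sum]
  refine Finset.sum_congr rfl fun k _ => ?_
  rw [← conj_steering_mul_steering]
  simp only [response, responseConj, map_zero, zero_mul, zero_add, pow_one]
  ring

lemma gram_conj_inl (i : Fin m) (q : Fin m ⊕ Fin L) :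
    gram L N f α (Sum.inr (Sum.inr q)) (Sum.inl i)
      = conj (2 * Real.pi * Complex.I * α i * trigMoment N 1 (f i - nodes L f q)) := by
  rw [← gram_amp_inl, gram, of_apply, of_apply, map_sum]
  refine Finset.sum_congr rfl fun k _ => ?_
  simp only [response, responseConj, map_zero, zero_mul, zero_add, add_zero, map_mul,
    Complex.conj_conj]

lemma gram_amp_self (j : Fin m ⊕ Fin L) :
    gram L N f α (Sum.inr (Sum.inl j)) (Sum.inr (Sum.inl j)) = ((N : ℝ) : ℂ) := by
  rw [gram_amp_amp, sub_self, trigMoment_zero_zero, Complex.ofReal_natCast]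

lemma norm_gram_amp_inl (i : Fin m) (q : Fin m ⊕ Fin L) :
    ‖gram L N f α (Sum.inr (Sum.inl q)) (Sum.inl i)‖
      = 2 * Real.pi * ‖α i‖ * ‖trigMoment N 1 (f i - nodes L f q)‖ := by
  rw [gram_amp_inl]
  simp [abs_of_pos Real.pi_pos]

lemma norm_gram_conj_inl (i : Fin m) (q : Fin m ⊕ Fin L) :
    ‖gram L N f α (Sum.inr (Sum.inr q)) (Sum.inl i)‖
      = 2 * Real.pi * ‖α i‖ * ‖trigMoment N 1 (f i - nodes L f q)‖ := by
  rw [gram_conj_inl, RCLike.norm_conj, ← norm_gram_amp_inl, gram_amp_inl]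

lemma norm_gram_inl_amp (i : Fin m) (j : Fin m ⊕ Fin L) :
    ‖gram L N f α (Sum.inl i) (Sum.inr (Sum.inl j))‖
      = 2 * Real.pi * ‖α i‖ * ‖trigMoment N 1 (nodes L f j - f i)‖ := by
  have h : gram L N f α (Sum.inl i) (Sum.inr (Sum.inl j))
      = conj (2 * Real.pi * Complex.I * α i) * trigMoment N 1 (nodes L f j - f i) := by
    rw [gram, of_apply, trigMoment, Finset.mul_sum]
    refine Finset.sum_congr rfl fun k _ => ?_
    rw [← conj_steering_mul_steering]
    simp only [response, responseConj, map_mul, mul_zero, zero_add, pow_one, Complex.conj_ofReal]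
    ring
  rw [h, norm_mul, RCLike.norm_conj]
  simp [abs_of_pos Real.pi_pos]

end GramEntries

/-! ### Diagonal bounds for the inverse of the Gram matrix -/

section GramInverse

variable {N m L : ℕ} {f : Fin m → ℝ} {α : Fin m → ℂ} {A B δ : ℝ}

/-- A diagonal lower bound for the Gram matrix. -/
def gramLower (L N : ℕ) (α : Fin m → ℂ) (A B : ℝ) : ParamIdx m L → ℝ
  | Sum.inl i => 8 * Real.pi ^ 2 * ‖α i‖ ^ 2 * (B * (N * ((N : ℝ) ^ 2 - 1) / 12))
  | Sum.inr _ => A * N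

/-- A lower bound for the energy of a combination of the atoms `a(t_i)` and their derivatives. -/
def IsConfluentLower {ι : Type*} [Fintype ι] (N : ℕ) (t : ι → ℝ) (A B : ℝ) : Prop :=
  ∀ x y : ι → ℂ, ∑ i, (A * N * ‖y i‖ ^ 2 + B * (N * ((N : ℝ) ^ 2 - 1) / 12) * ‖x i‖ ^ 2)
    ≤ ∑ k : Fin N, ‖∑ i, (y i + x i * (((k : ℕ) - ((N : ℝ) - 1) / 2 : ℝ) : ℂ)) *
      phase (((k : ℕ) - ((N : ℝ) - 1) / 2) * t i)‖ ^ 2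

/-- The quadratic form splits into a holomorphic and a conjugate energy, and each is a confluent
exponential sum to which the hypothesis applies. A frequency coefficient enters both, whence the
factor `8π² = 2 (2π)²` in `gramLower`. Diffuse nodes carry no derivative atom, hence the zero branch
of `Sum.elim`. -/
lemma gramLower_le (h : IsConfluentLower N (nodes L f) A B) (c : ParamIdx m L → ℂ) :
    ∑ a, gramLower L N α A B a * ‖c a‖ ^ 2 ≤ (star c ⬝ᵥ gram L N f α *ᵥ c).re := by
  have h1 := h (Sum.elim (fun i => c (Sum.inl i) * (α i * (2 * Real.pi * Complex.I))) 0)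
    (fun j => c (Sum.inr (Sum.inl j)))
  have h2 := h (Sum.elim (fun i => conj (c (Sum.inl i)) * (α i * (2 * Real.pi * Complex.I))) 0)
    (fun j => conj (c (Sum.inr (Sum.inr j))))
  rw [gram_quadForm, Finset.sum_add_distrib]
  have e1 : ∀ k : Fin N, ∑ j, (c (Sum.inr (Sum.inl j)) +
      (Sum.elim (fun i => c (Sum.inl i) * (α i * (2 * Real.pi * Complex.I))) 0 :
        Fin m ⊕ Fin L → ℂ) j * (((k : ℕ) - ((N : ℝ) - 1) / 2 : ℝ) : ℂ)) *
      phase (((k : ℕ) - ((N : ℝ) - 1) / 2) * nodes L f j) = ∑ a, c a * response N f α a k := by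
    intro k
    simp only [Fintype.sum_sum_type, response, Sum.elim_inl, Sum.elim_inr, Pi.zero_apply, zero_mul,
      add_zero, mul_zero, Finset.sum_const_zero, steering_eq_phase, add_mul,
      Finset.sum_add_distrib]
    have : nodes L f = Sum.elim f fun r : Fin L => -(((r : ℕ) : ℝ) / (L : ℝ)) := rfl
    simp only [this, Sum.elim_inl]
    have e : ∑ i, (c (Sum.inl i)) * (α i * (2 * Real.pi * Complex.I)) *
        (((k : ℕ) - ((N : ℝ) - 1) / 2 : ℝ) : ℂ) * phase (((k : ℕ) - ((N : ℝ) - 1) / 2) * f i)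
        = ∑ i, (c (Sum.inl i)) * (α i * (2 * Real.pi * Complex.I *
          (((k : ℕ) - ((N : ℝ) - 1) / 2 : ℝ) : ℂ) *
            phase (((k : ℕ) - ((N : ℝ) - 1) / 2) * f i))) :=
      Finset.sum_congr rfl fun i _ => by ring
    rw [e]
    ring
  have e2 : ∀ k : Fin N, ∑ j, (conj (c (Sum.inr (Sum.inr j))) +
      (Sum.elim (fun i => conj (c (Sum.inl i)) * (α i * (2 * Real.pi * Complex.I))) 0 :
        Fin m ⊕ Fin L → ℂ) j * (((k : ℕ) - ((N : ℝ) - 1) / 2 : ℝ) : ℂ)) *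
      phase (((k : ℕ) - ((N : ℝ) - 1) / 2) * nodes L f j)
        = conj (∑ a, c a * responseConj N f α a k) := by
    intro k
    simp only [Fintype.sum_sum_type, responseConj, Sum.elim_inl, Sum.elim_inr, Pi.zero_apply,
      zero_mul, zero_add, add_zero, mul_zero, Finset.sum_const_zero, steering_eq_phase, add_mul,
      Finset.sum_add_distrib, map_add, map_sum, map_mul, Complex.conj_conj]
    have : nodes L f = Sum.elim f fun r : Fin L => -(((r : ℕ) : ℝ) / (L : ℝ)) := rfl
    simp only [this, Sum.elim_inl]
    have e : ∑ i, conj (c (Sum.inl i)) * (α i * (2 * Real.pi * Complex.I)) *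
        (((k : ℕ) - ((N : ℝ) - 1) / 2 : ℝ) : ℂ) * phase (((k : ℕ) - ((N : ℝ) - 1) / 2) * f i)
        = ∑ i, conj (c (Sum.inl i)) * (α i * (2 * Real.pi * Complex.I *
          (((k : ℕ) - ((N : ℝ) - 1) / 2 : ℝ) : ℂ) *
            phase (((k : ℕ) - ((N : ℝ) - 1) / 2) * f i))) :=
      Finset.sum_congr rfl fun i _ => by ring
    rw [e]
    ring
  simp only [e1] at h1
  simp only [e2, RCLike.norm_conj] at h2
  refine le_trans (le_of_eq ?_) ((add_le_add h1 h2).trans (le_of_eq (add_comm _ _)))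
  simp only [Fintype.sum_sum_type, gramLower, Sum.elim_inl, Sum.elim_inr, Pi.zero_apply, norm_zero,
    Finset.sum_add_distrib, norm_mul, RCLike.norm_conj, Complex.norm_I, Complex.norm_real,
    Real.norm_eq_abs, abs_of_pos Real.pi_pos, Complex.norm_ofNat, mul_one, ne_eq,
    OfNat.ofNat_ne_zero, not_false_eq_true, zero_pow, mul_zero, Finset.sum_const_zero, add_zero]
  have e3 : ∑ i, 8 * Real.pi ^ 2 * ‖α i‖ ^ 2 * (B * (N * ((N : ℝ) ^ 2 - 1) / 12)) *
      ‖c (Sum.inl i)‖ ^ 2 = 2 * ∑ i, B * (N * ((N : ℝ) ^ 2 - 1) / 12) *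
        (‖c (Sum.inl i)‖ * (‖α i‖ * (2 * Real.pi))) ^ 2 := by
    rw [Finset.mul_sum]
    refine Finset.sum_congr rfl fun i _ => ?_
    ring
  rw [e3]
  ring

lemma sum_erase_inl (F : ParamIdx m L → ℝ) (i : Fin m) :
    ∑ b ∈ Finset.univ.erase (Sum.inl i), F b = ∑ j ∈ Finset.univ.erase i, F (Sum.inl j)
      + (∑ q, F (Sum.inr (Sum.inl q)) + ∑ q, F (Sum.inr (Sum.inr q))) := by
  rw [Finset.sum_erase_eq_sub (Finset.mem_univ _), Finset.sum_erase_eq_sub (Finset.mem_univ _),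
    Fintype.sum_sum_type, Fintype.sum_sum_type (fun b => F (Sum.inr b))]
  ring

lemma sum_erase_amp (F : ParamIdx m L → ℝ) (j : Fin m ⊕ Fin L) :
    ∑ b ∈ Finset.univ.erase (Sum.inr (Sum.inl j)), F b = ∑ i, F (Sum.inl i)
      + (∑ q ∈ Finset.univ.erase j, F (Sum.inr (Sum.inl q)) + ∑ q, F (Sum.inr (Sum.inr q))) := by
  rw [Finset.sum_erase_eq_sub (Finset.mem_univ _), Finset.sum_erase_eq_sub (Finset.mem_univ _),
    Fintype.sum_sum_type, Fintype.sum_sum_type (fun b => F (Sum.inr b))]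
  ring

lemma sum_inl_le {F : Fin m ⊕ Fin L → ℝ} (hF : ∀ q, 0 ≤ F q) :
    ∑ i, F (Sum.inl i) ≤ ∑ q, F q := by
  rw [Fintype.sum_sum_type]
  exact le_add_of_nonneg_right (Finset.sum_nonneg fun q _ => hF _)

lemma sum_erase_inl_le {F : Fin m ⊕ Fin L → ℝ} (hF : ∀ q, 0 ≤ F q) (i : Fin m) :
    ∑ j ∈ Finset.univ.erase i, F (Sum.inl j) ≤ ∑ q ∈ Finset.univ.erase (Sum.inl i), F q := by
  rw [Finset.sum_erase_eq_sub (Finset.mem_univ _), Finset.sum_erase_eq_sub (Finset.mem_univ _)]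
  exact sub_le_sub_right (sum_inl_le hF) _

/-- Frequency rows contribute second moments, while the `α, γ` rows and their conjugates contribute
first moments twice. The moduli `‖α j‖` cancel against the weights, so the bound is uniform in the
sparse amplitudes. -/
lemma freq_column_le (hα : ∀ i, α i ≠ 0) (hA : 0 < A) (hB : 0 < B) (hδ : 0 < δ) (hδ1 : δ ≤ 1)
    (hsep : ∀ i j, i ≠ j → ∀ k : ℤ, δ ≤ |nodes L f i - nodes L f j + k|) (hN : 5 ≤ N)
    (i : Fin m) :
    ∑ b ∈ Finset.univ.erase (Sum.inl i), ‖gram L N f α b (Sum.inl i)‖ ^ 2 / gramLower L N α A B b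
      ≤ freqMass (N * δ) (B / A) * (gram L N f α (Sum.inl i) (Sum.inl i)).re / B := by
  have hN5 : (5 : ℝ) ≤ N := by exact_mod_cast hN
  have hN0 : (0 : ℝ) < N := by linarith
  have hC : 0 < N * ((N : ℝ) ^ 2 - 1) / 12 := by
    have : 0 < (N : ℝ) ^ 2 - 1 := by nlinarith
    positivity
  have h1 := sum_trigMoment_one_le hδ hδ1 hsep (Sum.inl i) hN
  have h2 := (sum_erase_inl_le (L := L)
    (F := fun q => ‖trigMoment N 2 (nodes L f (Sum.inl i) - nodes L f q)‖ ^ 2)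
    (fun q => sq_nonneg _) i).trans (sum_trigMoment_two_le hδ hδ1 hsep (Sum.inl i) hN)
  have hπ := Real.pi_pos
  rw [sum_erase_inl, gram_inl_self, Complex.ofReal_re]
  simp only [norm_gram_amp_inl, norm_gram_conj_inl, gramLower]
  set C := N * ((N : ℝ) ^ 2 - 1) / 12
  have hi : 0 < ‖α i‖ := norm_pos_iff.mpr (hα i)
  have b1 : ∑ j ∈ Finset.univ.erase i, ‖gram L N f α (Sum.inl j) (Sum.inl i)‖ ^ 2 /
      (8 * Real.pi ^ 2 * ‖α j‖ ^ 2 * (B * C))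
      ≤ 8 * Real.pi ^ 2 * ‖α i‖ ^ 2 / (B * C) *
        ∑ j ∈ Finset.univ.erase i, ‖trigMoment N 2 (f i - f j)‖ ^ 2 := by
    rw [Finset.mul_sum]
    refine Finset.sum_le_sum fun j _ => ?_
    have hj : 0 < ‖α j‖ := norm_pos_iff.mpr (hα j)
    rw [div_le_iff₀ (by positivity)]
    refine (pow_le_pow_left₀ (norm_nonneg _) (norm_gram_inl_inl_le f α i j) 2).trans (le_of_eq ?_)
    field_simp
  have b2 : ∑ q, (2 * Real.pi * ‖α i‖ * ‖trigMoment N 1 (f i - nodes L f q)‖) ^ 2 / (A * N)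
      = 4 * Real.pi ^ 2 * ‖α i‖ ^ 2 / (A * N) * ∑ q, ‖trigMoment N 1 (f i - nodes L f q)‖ ^ 2 := by
    rw [Finset.mul_sum]
    refine Finset.sum_congr rfl fun q _ => ?_
    ring
  rw [b2]
  have b3 := b1.trans (mul_le_mul_of_nonneg_left h2
    (show 0 ≤ 8 * Real.pi ^ 2 * ‖α i‖ ^ 2 / (B * C) by positivity))
  have b4 := mul_le_mul_of_nonneg_left h1
    (show 0 ≤ 4 * Real.pi ^ 2 * ‖α i‖ ^ 2 / (A * N) by positivity)
  refine (add_le_add b3 (add_le_add b4 b4)).trans (le_of_eq ?_)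
  rw [freqMass]
  field_simp
  ring

/-- The conjugate amplitude rows are orthogonal to this column, so first moments occur only through
the frequency rows, which explains the factor `1/2` in `ampMass`. -/
lemma amp_column_le (hα : ∀ i, α i ≠ 0) (hA : 0 < A) (hB : 0 < B) (hδ : 0 < δ) (hδ1 : δ ≤ 1)
    (hsep : ∀ i j, i ≠ j → ∀ k : ℤ, δ ≤ |nodes L f i - nodes L f j + k|) (hN : 5 ≤ N)
    (j : Fin m ⊕ Fin L) :
    ∑ b ∈ Finset.univ.erase (Sum.inr (Sum.inl j)),
        ‖gram L N f α b (Sum.inr (Sum.inl j))‖ ^ 2 / gramLower L N α A B b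
      ≤ ampMass (N * δ) (A / B) *
        (gram L N f α (Sum.inr (Sum.inl j)) (Sum.inr (Sum.inl j))).re / A := by
  have hN5 : (5 : ℝ) ≤ N := by exact_mod_cast hN
  have hN0 : (0 : ℝ) < N := by linarith
  have hC : 0 < N * ((N : ℝ) ^ 2 - 1) / 12 := by
    have : 0 < (N : ℝ) ^ 2 - 1 := by nlinarith
    positivity
  have h0 := sum_trigMoment_zero_le hδ hδ1 hsep j (mul_pos hN0 hδ)
  have h1 := (sum_inl_le (L := L)
    (F := fun q => ‖trigMoment N 1 (nodes L f j - nodes L f q)‖ ^ 2)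
    (fun q => sq_nonneg _)).trans (sum_trigMoment_one_le hδ hδ1 hsep j hN)
  have hπ := Real.pi_pos
  rw [sum_erase_amp, gram_amp_self, Complex.ofReal_re]
  simp only [norm_gram_inl_amp, gram_conj_amp, gram_amp_amp, gramLower, norm_zero, ne_eq,
    OfNat.ofNat_ne_zero, not_false_eq_true, zero_pow, zero_div, Finset.sum_const_zero, add_zero]
  set C := N * ((N : ℝ) ^ 2 - 1) / 12
  have b1 : ∑ i, (2 * Real.pi * ‖α i‖ * ‖trigMoment N 1 (nodes L f j - f i)‖) ^ 2 /
      (8 * Real.pi ^ 2 * ‖α i‖ ^ 2 * (B * C))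
      = 1 / (2 * (B * C)) * ∑ i, ‖trigMoment N 1 (nodes L f j - f i)‖ ^ 2 := by
    rw [Finset.mul_sum]
    refine Finset.sum_congr rfl fun i _ => ?_
    have hi : 0 < ‖α i‖ := norm_pos_iff.mpr (hα i)
    field_simp
    ring
  rw [b1, ← Finset.sum_div]
  have b2 := mul_le_mul_of_nonneg_left h1 (show 0 ≤ 1 / (2 * (B * C)) by positivity)
  have b3 := div_le_div_of_nonneg_right h0 (show 0 ≤ A * N by positivity)
  refine (add_le_add b2 b3).trans (le_of_eq ?_)
  rw [ampMass]
  field_simp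
  ring

/-- Restates the large-sieve bound relative to the diagonal of the Gram matrix. Lowering `N³` to `N
(N² - 1)` is legitimate because `B ≥ 0`. -/
lemma isConfluentLower_of_separated {ι : Type*} [Fintype ι] {t : ι → ℝ} {H r w : ℝ} (hδ : 0 < δ)
    (hδ1 : δ ≤ 1) (hsep : ∀ i j, i ≠ j → ∀ k : ℤ, δ ≤ |t i - t j + k|) (hN : 0 < N) (hH : 0 ≤ H)
    (hr : 0 ≤ r) (hw : 0 ≤ w) (hx : 2 * (H + r) = N * δ) (h1 : w * H ^ 2 ≤ 1)
    (h2 : w * (2 * (H ^ 2 - r ^ 2)) ≤ 1)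
    (hB : 0 ≤ 12 * (2 * w * (r ^ 2 * (3 / 2 * H ^ 2 - 1 / 2) + 1 / 2 * (H ^ 2 - 1))) /
      (N * δ) ^ 3) :
    IsConfluentLower N t (2 * w * (3 / 2 * H ^ 2 - 1 / 2) / (N * δ))
      (12 * (2 * w * (r ^ 2 * (3 / 2 * H ^ 2 - 1 / 2) + 1 / 2 * (H ^ 2 - 1))) / (N * δ) ^ 3) := by
  intro x y
  refine le_trans (Finset.sum_le_sum fun i _ => ?_)
    (confluent_lower_bound hδ hδ1 hsep hH hr hw hx h1 h2 x y)
  have hN0 : (0 : ℝ) < N := by exact_mod_cast hN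
  set b := 2 * w * (r ^ 2 * (3 / 2 * H ^ 2 - 1 / 2) + 1 / 2 * (H ^ 2 - 1)) with hb
  have e1 : 2 * w * (3 / 2 * H ^ 2 - 1 / 2) / (N * δ) * N
      = 2 * w * (3 / 2 * H ^ 2 - 1 / 2) / δ := by
    field_simp
  have e2 : 12 * b / (N * δ) ^ 3 * (N * ((N : ℝ) ^ 2 - 1) / 12) ≤ b / δ ^ 3 := by
    have : b / δ ^ 3 = 12 * b / (N * δ) ^ 3 * ((N : ℝ) ^ 3 / 12) := by
      field_simp
    rw [this]
    refine mul_le_mul_of_nonneg_left ?_ hB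
    nlinarith
  rw [e1]
  exact add_le_add le_rfl (mul_le_mul_of_nonneg_right e2 (sq_nonneg _))

/-- If the nodes are `δ`-separated and `N δ > 2`, the Gram matrix is positive definite and the
diagonal of its inverse is comparable with the inverse of its diagonal. -/
theorem gram_inv_bounds (hα : ∀ i, α i ≠ 0) (hδ : 0 < δ) (hδ1 : δ ≤ 1)
    (hsep : ∀ i j, i ≠ j → ∀ k : ℤ, δ ≤ |nodes L f i - nodes L f j + k|) (hN : 5 ≤ N)
    (hx : 2 < (N : ℝ) * δ) :
    (gram L N f α).PosDef ∧
    (∀ i, ((gram L N f α)⁻¹ (Sum.inl i) (Sum.inl i)).re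
      ≤ 1 / ((1 - 2 / (N * δ)) * (gram L N f α (Sum.inl i) (Sum.inl i)).re)) ∧
    (∀ j, ((gram L N f α)⁻¹ (Sum.inr (Sum.inl j)) (Sum.inr (Sum.inl j))).re
      ≤ 1 / ((1 - 2 / (N * δ)) * (gram L N f α (Sum.inr (Sum.inl j)) (Sum.inr (Sum.inl j))).re)) := by
  obtain ⟨H, r, w, hH, hr, hw, hHr, h1, h2, hA, hB, hadmF, hadmA⟩ := exists_admissible hx
  have hlow := isConfluentLower_of_separated hδ hδ1 hsep (by omega) hH hr hw hHr h1 h2 hB.le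
  set A := 2 * w * (3 / 2 * H ^ 2 - 1 / 2) / (N * δ)
  set B := 12 * (2 * w * (r ^ 2 * (3 / 2 * H ^ 2 - 1 / 2) + 1 / 2 * (H ^ 2 - 1))) / (N * δ) ^ 3
  have hN5 : (5 : ℝ) ≤ N := by exact_mod_cast hN
  have hN0 : (0 : ℝ) < N := by linarith
  have hC : 0 < N * ((N : ℝ) ^ 2 - 1) / 12 := by
    have : 0 < (N : ℝ) ^ 2 - 1 := by nlinarith
    positivity
  have hπ := Real.pi_pos
  have hd : ∀ a, 0 < gramLower L N α A B a := by
    rintro (i | j)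
    · have hi : 0 < ‖α i‖ := norm_pos_iff.mpr (hα i)
      simp only [gramLower]
      positivity
    · simp only [gramLower]
      positivity
  have hquad := gramLower_le (α := α) hlow
  have hpd := posDef_of_diagonal_le (gram_isHermitian f α) hd hquad
  have hκ : 0 < 1 - 2 / (N * δ) := by
    rw [sub_pos, div_lt_one (by linarith)]
    exact hx
  have hκ1 : 1 - 2 / (N * δ) < 1 := by
    have : 0 < 2 / (N * δ) := by positivity
    linarith
  refine ⟨hpd, fun i => ?_, fun j => ?_⟩
  · refine inv_diag_le_of_moment hpd hd hquad _ hB hκ hκ1 ?_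
      (freq_column_le hα hA hB hδ hδ1 hsep hN i) hadmF
    rw [gram_inl_self, Complex.ofReal_re, gramLower]
    ring
  · refine inv_diag_le_of_moment hpd hd hquad _ hA hκ hκ1 ?_
      (amp_column_le hα hA hB hδ hδ1 hsep hN j) hadmA
    rw [gram_amp_self, Complex.ofReal_re, gramLower]

end GramInverse

/-! ### Separation of the nodes -/

section Separation

variable {m L : ℕ} {f : Fin m → ℝ}

/-- `toReal` sends `∞` to `0`, so positivity of `minSep` excludes an infinite minimum. -/
lemma ofReal_minSep (h : 0 < minSep L f) :
    ENNReal.ofReal (minSep L f) = min (sepSparse f) (sepSparseDiffuse L f) :=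
  ENNReal.ofReal_toReal (ENNReal.toReal_pos_iff.mp h).2.ne

lemma minSep_le_sparse (h : 0 < minSep L f) {i j : Fin m} (hij : i ≠ j) (k : ℤ) :
    minSep L f ≤ |f i - f j + k| := by
  rw [← ENNReal.ofReal_le_ofReal_iff (abs_nonneg _), ofReal_minSep h]
  refine (min_le_left _ _).trans ?_
  exact iInf_le_of_le i (iInf_le_of_le j (iInf_le_of_le hij (iInf_le _ k)))

lemma minSep_le_diffuse (h : 0 < minSep L f) (i : Fin m) (r : ℤ) :
    minSep L f ≤ |f i - r / L| := by
  rw [← ENNReal.ofReal_le_ofReal_iff (abs_nonneg _), ofReal_minSep h]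
  exact (min_le_right _ _).trans (iInf_le_of_le i (iInf_le _ r))

/-- Every frequency lies within `1/(2L)` of the grid of multiples of `1/L`. -/
lemma minSep_le_one_div (hm : 0 < m) (hL : 0 < L) (h : 0 < minSep L f) :
    minSep L f ≤ 1 / (2 * L) := by
  have hL' : (0 : ℝ) < L := by exact_mod_cast hL
  refine (minSep_le_diffuse h ⟨0, hm⟩ (round (f ⟨0, hm⟩ * L))).trans ?_
  have e : f ⟨0, hm⟩ - (round (f ⟨0, hm⟩ * L) : ℤ) / L
      = (f ⟨0, hm⟩ * L - (round (f ⟨0, hm⟩ * L) : ℤ)) / L := by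
    field_simp
  rw [e, abs_div, abs_of_pos hL', div_le_iff₀ hL']
  refine (abs_sub_round _).trans (le_of_eq ?_)
  field_simp

/-- The definition of `minSep` says nothing about pairs of diffuse nodes. Those are `1/L` apart
modulo `1`, which is enough because `minSep` is at most `1/(2L)`. -/
lemma minSep_le_nodes (hm : 0 < m) (hL : 0 < L) (h : 0 < minSep L f) (i j : Fin m ⊕ Fin L)
    (hij : i ≠ j) (k : ℤ) : minSep L f ≤ |nodes L f i - nodes L f j + k| := by
  have hL' : (0 : ℝ) < L := by exact_mod_cast hL
  rcases i with i | r <;> rcases j with j | q <;> simp only [nodes, Sum.elim_inl, Sum.elim_inr]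
  · exact minSep_le_sparse h (fun e => hij (by rw [e])) k
  · refine (minSep_le_diffuse h i (-(q : ℕ) - k * L)).trans (le_of_eq (congrArg _ ?_))
    push_cast
    field_simp
    ring
  · rw [← abs_neg]
    refine (minSep_le_diffuse h j (-(r : ℕ) + k * L)).trans (le_of_eq (congrArg _ ?_))
    push_cast
    field_simp
    ring
  · refine (minSep_le_one_div hm hL h).trans ?_
    have e : -(((r : ℕ) : ℝ) / L) - -(((q : ℕ) : ℝ) / L) + k
        = (((q : ℕ) - (r : ℕ) + k * L : ℤ) : ℝ) / L := by
      push_cast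
      field_simp
      ring
    have hne : ((q : ℕ) - (r : ℕ) + k * L : ℤ) ≠ 0 := by
      intro h0
      have hdvd : (L : ℤ) ∣ ((r : ℕ) : ℤ) - ((q : ℕ) : ℤ) := ⟨k, by linarith⟩
      have hr := r.isLt
      have hq := q.isLt
      have h1 := Int.eq_zero_of_abs_lt_dvd hdvd (by rw [abs_lt]; constructor <;> omega)
      exact hij (congrArg Sum.inr (Fin.ext (by omega)))
    rw [e, abs_div, abs_of_pos hL', ← Int.cast_abs]
    have h1 : (1 : ℝ) ≤ ((|((q : ℕ) - (r : ℕ) + k * L : ℤ)| : ℤ) : ℝ) := by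
      exact_mod_cast Int.one_le_abs hne
    refine le_trans ?_ (div_le_div_of_nonneg_right h1 hL'.le)
    exact one_div_le_one_div_of_le hL' (by linarith)

end Separation

/-! ### Product measures with densities -/

lemma measurePreserving_withDensity_comp {X Y : Type*} [MeasurableSpace X] [MeasurableSpace Y]
    {μ : Measure X} {ν : Measure Y} {T : X → Y} (hT : MeasurePreserving T μ ν) {W : Y → ℝ≥0∞}
    (hW : Measurable W) :
    MeasurePreserving T (μ.withDensity fun x => W (T x)) (ν.withDensity W) := by
  refine ⟨hT.measurable, Measure.ext fun s hs => ?_⟩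
  rw [Measure.map_apply hT.measurable hs, withDensity_apply _ (hT.measurable hs),
    withDensity_apply _ hs]
  exact hT.setLIntegral_comp_preimage hs hW

/-- On a box, the indicator times the product density is a product of functions of one coordinate,
so Fubini gives the product of the marginal masses. -/
lemma pi_withDensity_ofReal {ι E : Type*} [Fintype ι] [MeasurableSpace E] (μ : Measure E)
    [SigmaFinite μ] {ρ : E → ℝ} (hρ : Integrable ρ μ) (h0 : ∀ x, 0 ≤ ρ x) :
    Measure.pi (fun _ : ι => μ.withDensity fun x => ENNReal.ofReal (ρ x))
      = (Measure.pi fun _ : ι => μ).withDensity fun x => ENNReal.ofReal (∏ i, ρ (x i)) := by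
  have : IsFiniteMeasure (μ.withDensity fun x => ENNReal.ofReal (ρ x)) :=
    isFiniteMeasure_withDensity_ofReal hρ.2
  refine Measure.pi_eq fun s hs => ?_
  rw [withDensity_apply _ (MeasurableSet.univ_pi hs), ← lintegral_indicator (MeasurableSet.univ_pi hs)]
  have hint : ∀ i, Integrable ((s i).indicator ρ) μ := fun i => hρ.indicator (hs i)
  have e1 : ((Set.univ.pi s).indicator fun x : ι → E => ENNReal.ofReal (∏ i, ρ (x i)))
      = fun x => ENNReal.ofReal (∏ i, (s i).indicator ρ (x i)) := by
    funext x
    by_cases hx : x ∈ Set.univ.pi s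
    · rw [Set.indicator_of_mem hx]
      exact congrArg _ (Finset.prod_congr rfl fun i _ =>
        (Set.indicator_of_mem (hx i (Set.mem_univ i)) _).symm)
    · rw [Set.indicator_of_notMem hx]
      simp only [Set.mem_univ_pi, not_forall] at hx
      obtain ⟨i, hi⟩ := hx
      rw [Finset.prod_eq_zero (Finset.mem_univ i) (Set.indicator_of_notMem hi _),
        ENNReal.ofReal_zero]
  have hpos : ∀ i x, 0 ≤ (s i).indicator ρ x := fun i x =>
    Set.indicator_nonneg (fun y _ => h0 y) x
  rw [e1, ← ofReal_integral_eq_lintegral_ofReal (Integrable.fintype_prod_dep hint)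
    (Filter.Eventually.of_forall fun x => Finset.prod_nonneg fun i _ => hpos i _),
    integral_fintype_prod_eq_prod, ENNReal.ofReal_prod_of_nonneg
      (fun i _ => integral_nonneg (hpos i))]
  refine Finset.prod_congr rfl fun i _ => ?_
  rw [withDensity_apply _ (hs i), integral_indicator (hs i),
    ofReal_integral_eq_lintegral_ofReal hρ.integrableOn (Filter.Eventually.of_forall h0)]

/-! ### Circular complex Gaussian noise -/

/-- The density of `CN(0, σ²)` on `ℂ`. -/
def noiseDensity (σ : ℝ) (z : ℂ) : ℝ :=
  (Real.pi * σ ^ 2)⁻¹ * Real.exp (-‖z‖ ^ 2 / σ ^ 2)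

/-- The circular complex Gaussian law `CN(0, σ²)` on `ℂ`. -/
def scalarNoise (σ : ℝ) : Measure ℂ :=
  volume.withDensity fun z => ENNReal.ofReal (noiseDensity σ z)

/-- The law of `G` independent copies of `CN(0, σ² I_N)`. -/
def noiseLaw (G N : ℕ) (σ : ℝ) : Measure (Fin G → Fin N → ℂ) :=
  Measure.pi fun _ => Measure.pi fun _ => scalarNoise σ

section Noise

variable {σ : ℝ}

lemma noiseDensity_nonneg (σ : ℝ) (z : ℂ) : 0 ≤ noiseDensity σ z := by
  rw [noiseDensity]
  have := Real.pi_pos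
  positivity

lemma continuous_noiseDensity (σ : ℝ) : Continuous (noiseDensity σ) := by
  unfold noiseDensity
  fun_prop

lemma measurable_ofReal_noiseDensity (σ : ℝ) :
    Measurable fun z => ENNReal.ofReal (noiseDensity σ z) :=
  (continuous_noiseDensity σ).measurable.ennreal_ofReal

lemma integral_noiseDensity (hσ : 0 < σ) : ∫ z, noiseDensity σ z = 1 := by
  have h := Complex.integral_rpow_mul_exp_neg_mul_rpow (p := 2) (q := 0) (b := (σ ^ 2)⁻¹)
    one_le_two (by norm_num) (by positivity)
  have e : ∀ z : ℂ, noiseDensity σ z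
      = (Real.pi * σ ^ 2)⁻¹ * (‖z‖ ^ (0 : ℝ) * Real.exp (-(σ ^ 2)⁻¹ * ‖z‖ ^ (2 : ℝ))) := by
    intro z
    rw [noiseDensity, Real.rpow_zero, one_mul, Real.rpow_two]
    congr 2
    ring
  simp only [e]
  rw [integral_const_mul, h]
  have hπ := Real.pi_pos
  norm_num
  rw [Real.rpow_neg_one]
  field_simp

lemma integral_noiseDensity_mul_norm_sq (hσ : 0 < σ) :
    ∫ z, noiseDensity σ z * ‖z‖ ^ 2 = σ ^ 2 := by
  have h := Complex.integral_rpow_mul_exp_neg_mul_rpow (p := 2) (q := 2) (b := (σ ^ 2)⁻¹)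
    one_le_two (by norm_num) (by positivity)
  have e : ∀ z : ℂ, noiseDensity σ z * ‖z‖ ^ 2
      = (Real.pi * σ ^ 2)⁻¹ * (‖z‖ ^ (2 : ℝ) * Real.exp (-(σ ^ 2)⁻¹ * ‖z‖ ^ (2 : ℝ))) := by
    intro z
    rw [noiseDensity, Real.rpow_two, mul_assoc, mul_comm (Real.exp _)]
    congr 3
    ring
  simp only [e]
  rw [integral_const_mul, h]
  have hπ := Real.pi_pos
  norm_num
  field_simp

lemma integrable_noiseDensity (hσ : 0 < σ) : Integrable (noiseDensity σ) := by
  -- The Bochner integral of a non-integrable function is `0`, so a nonzero value proves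
  -- integrability.
  refine Integrable.of_integral_ne_zero ?_
  rw [integral_noiseDensity hσ]
  exact one_ne_zero

lemma isProbabilityMeasure_scalarNoise (hσ : 0 < σ) : IsProbabilityMeasure (scalarNoise σ) := by
  refine ⟨?_⟩
  rw [scalarNoise, withDensity_apply _ MeasurableSet.univ, Measure.restrict_univ,
    ← ofReal_integral_eq_lintegral_ofReal (integrable_noiseDensity hσ)
      (Filter.Eventually.of_forall (noiseDensity_nonneg σ)), integral_noiseDensity hσ,
    ENNReal.ofReal_one]

lemma integral_norm_sq_scalarNoise (hσ : 0 < σ) : ∫ z, ‖z‖ ^ 2 ∂scalarNoise σ = σ ^ 2 := by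
  rw [scalarNoise, integral_withDensity_eq_integral_toReal_smul
    (measurable_ofReal_noiseDensity σ)
    (Filter.Eventually.of_forall fun _ => ENNReal.ofReal_lt_top)]
  simp only [ENNReal.toReal_ofReal (noiseDensity_nonneg σ _), smul_eq_mul]
  exact integral_noiseDensity_mul_norm_sq hσ

lemma memLp_scalarNoise (hσ : 0 < σ) : MemLp (fun z : ℂ => z) 2 (scalarNoise σ) := by
  refine (memLp_two_iff_integrable_sq_norm aestronglyMeasurable_id).mpr ?_
  refine Integrable.of_integral_ne_zero ?_
  simp only [id]
  rw [integral_norm_sq_scalarNoise hσ]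
  positivity

lemma measurePreserving_mul_scalarNoise {c : ℂ} (hc : ‖c‖ = 1) :
    MeasurePreserving (fun z => c * z) (scalarNoise σ) (scalarNoise σ) := by
  have hT : MeasurePreserving (fun z : ℂ => c * z) volume volume :=
    (rotation (⟨c, mem_sphere_zero_iff_norm.mpr hc⟩ : Circle)).measurePreserving
  have h := measurePreserving_withDensity_comp hT (measurable_ofReal_noiseDensity σ)
  have e : ∀ z, noiseDensity σ (c * z) = noiseDensity σ z := by
    intro z
    rw [noiseDensity, noiseDensity, norm_mul, hc, one_mul]
  simp only [e] at h
  exact h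

lemma noiseLaw_eq_withDensity (G N : ℕ) (hσ : 0 < σ) :
    noiseLaw G N σ = volume.withDensity
      fun n : Fin G → Fin N → ℂ => ENNReal.ofReal (∏ g, ∏ k, noiseDensity σ (n g k)) := by
  have hint := integrable_noiseDensity hσ
  rw [noiseLaw]
  simp only [scalarNoise]
  rw [pi_withDensity_ofReal _ hint (noiseDensity_nonneg σ)]
  exact pi_withDensity_ofReal _ (Integrable.fintype_prod_dep fun _ => hint)
    fun n => Finset.prod_nonneg fun k _ => noiseDensity_nonneg σ _

lemma measurePreserving_noise_eval {G N : ℕ} (hσ : 0 < σ) (g : Fin G) (k : Fin N) :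
    MeasurePreserving (fun n : Fin G → Fin N → ℂ => n g k) (noiseLaw G N σ) (scalarNoise σ) := by
  have := isProbabilityMeasure_scalarNoise hσ
  exact (measurePreserving_eval (fun _ : Fin N => scalarNoise σ) k).comp
    (measurePreserving_eval (fun _ : Fin G => Measure.pi fun _ : Fin N => scalarNoise σ) g)

lemma memLp_noise {G N : ℕ} (hσ : 0 < σ) (g : Fin G) (k : Fin N) :
    MemLp (fun n : Fin G → Fin N → ℂ => n g k) 2 (noiseLaw G N σ) :=
  (memLp_scalarNoise hσ).comp_measurePreserving (measurePreserving_noise_eval hσ g k)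

lemma memLp_conj_noise {G N : ℕ} (hσ : 0 < σ) (g : Fin G) (k : Fin N) :
    MemLp (fun n : Fin G → Fin N → ℂ => conj (n g k)) 2 (noiseLaw G N σ) :=
  (memLp_noise hσ g k).star

lemma measurePreserving_mul_noise {G N : ℕ} (hσ : 0 < σ) {c : Fin G → Fin N → ℂ}
    (hc : ∀ g k, ‖c g k‖ = 1) :
    MeasurePreserving (fun (n : Fin G → Fin N → ℂ) g k => c g k * n g k) (noiseLaw G N σ)
      (noiseLaw G N σ) := by
  have := isProbabilityMeasure_scalarNoise hσ
  exact measurePreserving_pi _ _ fun g => measurePreserving_pi _ _ fun k =>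
    measurePreserving_mul_scalarNoise (hc g k)

lemma integral_noise_mul_noise {G N : ℕ} (hσ : 0 < σ) (p q : Fin G × Fin N) :
    ∫ n, n p.1 p.2 * n q.1 q.2 ∂noiseLaw G N σ = 0 := by
  -- Circularity: multiplying all the noise by `i` preserves its law and changes the sign of this
  -- product.
  have hT := measurePreserving_mul_noise (G := G) (N := N) hσ (c := fun _ _ => Complex.I) (by simp)
  have h := integral_map (μ := noiseLaw G N σ) hT.measurable.aemeasurable
    (f := fun n : Fin G → Fin N → ℂ => n p.1 p.2 * n q.1 q.2)
    (by fun_prop)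
  rw [hT.map_eq] at h
  have e : ∀ n : Fin G → Fin N → ℂ, Complex.I * n p.1 p.2 * (Complex.I * n q.1 q.2)
      = -(n p.1 p.2 * n q.1 q.2) := fun n => by
    linear_combination (n p.1 p.2 * n q.1 q.2) * Complex.I_mul_I
  simp only [e] at h
  rw [integral_neg] at h
  exact self_eq_neg.mp h

lemma integral_conj_noise_mul_noise {G N : ℕ} (hσ : 0 < σ) (p q : Fin G × Fin N) :
    ∫ n, conj (n p.1 p.2) * n q.1 q.2 ∂noiseLaw G N σ = if p = q then (σ : ℂ) ^ 2 else 0 := by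
  split_ifs with hpq
  · subst hpq
    have hT := measurePreserving_noise_eval (σ := σ) hσ p.1 p.2
    have h := integral_map (μ := noiseLaw G N σ) hT.measurable.aemeasurable
      (f := fun z : ℂ => conj z * z) (by fun_prop)
    rw [hT.map_eq] at h
    rw [← h]
    simp only [Complex.conj_mul', ← Complex.ofReal_pow]
    rw [integral_complex_ofReal, integral_norm_sq_scalarNoise hσ]
  -- Flipping the sign of the single coordinate `p` preserves the law and negates the correlation.
  · have hT := measurePreserving_mul_noise (G := G) (N := N) hσ
      (c := fun g k => if (g, k) = p then -1 else 1) (by intro g k; split_ifs <;> simp)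
    have h := integral_map (μ := noiseLaw G N σ) hT.measurable.aemeasurable
      (f := fun n : Fin G → Fin N → ℂ => conj (n p.1 p.2) * n q.1 q.2)
      (by fun_prop)
    rw [hT.map_eq] at h
    have hqp : ¬ q = p := fun e => hpq e.symm
    simp only [if_pos, hqp, if_false, neg_mul, one_mul, map_neg] at h
    rw [integral_neg] at h
    exact self_eq_neg.mp h

lemma integral_fun_add_add_add {X : Type*} [MeasurableSpace X] {μ : Measure X}
    {f₁ f₂ f₃ f₄ : X → ℂ} (h₁ : Integrable f₁ μ) (h₂ : Integrable f₂ μ) (h₃ : Integrable f₃ μ)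
    (h₄ : Integrable f₄ μ) : ∫ x, (f₁ x + f₂ x + f₃ x + f₄ x) ∂μ
      = ∫ x, f₁ x ∂μ + ∫ x, f₂ x ∂μ + ∫ x, f₃ x ∂μ + ∫ x, f₄ x ∂μ := by
  rw [← integral_add h₁ h₂]
  exact (integral_add ((h₁.add h₂).add h₃) h₄).trans
    (congrArg (· + ∫ x, f₄ x ∂μ) (integral_add (h₁.add h₂) h₃))

/-- A real-linear functional of the noise. -/
def noiseFunctional {G N : ℕ} (u v : Fin G × Fin N → ℂ) (n : Fin G → Fin N → ℂ) : ℂ :=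
  ∑ p, (u p * n p.1 p.2 + v p * conj (n p.1 p.2))

lemma memLp_noiseFunctional {G N : ℕ} (hσ : 0 < σ) (u v : Fin G × Fin N → ℂ) :
    MemLp (noiseFunctional u v) 2 (noiseLaw G N σ) :=
  memLp_finsetSum _ fun p _ =>
    ((memLp_noise hσ p.1 p.2).const_mul (u p)).add ((memLp_conj_noise hσ p.1 p.2).const_mul (v p))

lemma integral_conj_noiseFunctional_mul {G N : ℕ} (hσ : 0 < σ) (u v u' v' : Fin G × Fin N → ℂ) :
    ∫ n, conj (noiseFunctional u v n) * noiseFunctional u' v' n ∂noiseLaw G N σ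
      = (σ : ℂ) ^ 2 * ∑ p, (conj (u p) * u' p + conj (v p) * v' p) := by
  have i1 : ∀ p q : Fin G × Fin N, Integrable (fun n => n p.1 p.2 * n q.1 q.2)
      (noiseLaw G N σ) := fun p q => (memLp_noise hσ p.1 p.2).integrable_mul (memLp_noise hσ q.1 q.2)
  have i2 : ∀ p q : Fin G × Fin N, Integrable (fun n => conj (n p.1 p.2) * n q.1 q.2)
      (noiseLaw G N σ) := fun p q =>
    (memLp_conj_noise hσ p.1 p.2).integrable_mul (memLp_noise hσ q.1 q.2)
  have i3 : ∀ p q : Fin G × Fin N, Integrable (fun n => conj (n p.1 p.2 * n q.1 q.2))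
      (noiseLaw G N σ) := fun p q => by
    simp only [map_mul]
    exact (memLp_conj_noise hσ p.1 p.2).integrable_mul (memLp_conj_noise hσ q.1 q.2)
  have e : ∀ n : Fin G → Fin N → ℂ, conj (noiseFunctional u v n) * noiseFunctional u' v' n
      = ∑ p, ∑ q, (conj (u p) * u' q * (conj (n p.1 p.2) * n q.1 q.2)
        + conj (v p) * v' q * (conj (n q.1 q.2) * n p.1 p.2)
        + conj (v p) * u' q * (n p.1 p.2 * n q.1 q.2)
        + conj (u p) * v' q * conj (n p.1 p.2 * n q.1 q.2)) := by
    intro n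
    rw [noiseFunctional, noiseFunctional, map_sum, Finset.sum_mul_sum]
    refine Finset.sum_congr rfl fun p _ => Finset.sum_congr rfl fun q _ => ?_
    simp only [map_add, map_mul, Complex.conj_conj]
    ring
  simp only [e]
  have i4 : ∀ p q : Fin G × Fin N, Integrable (fun n =>
      (conj (u p) * u' q * (conj (n p.1 p.2) * n q.1 q.2)
        + conj (v p) * v' q * (conj (n q.1 q.2) * n p.1 p.2)
        + conj (v p) * u' q * (n p.1 p.2 * n q.1 q.2)
        + conj (u p) * v' q * conj (n p.1 p.2 * n q.1 q.2))) (noiseLaw G N σ) := fun p q =>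
    ((((i2 p q).const_mul _).add ((i2 q p).const_mul _)).add ((i1 p q).const_mul _)).add
      ((i3 p q).const_mul _)
  rw [integral_finsetSum _ fun p _ => integrable_finsetSum _ fun q _ => i4 p q, Finset.mul_sum]
  refine Finset.sum_congr rfl fun p _ => ?_
  rw [integral_finsetSum _ fun q _ => i4 p q]
  have h : ∀ q, ∫ n, (conj (u p) * u' q * (conj (n p.1 p.2) * n q.1 q.2)
        + conj (v p) * v' q * (conj (n q.1 q.2) * n p.1 p.2)
        + conj (v p) * u' q * (n p.1 p.2 * n q.1 q.2)
        + conj (u p) * v' q * conj (n p.1 p.2 * n q.1 q.2)) ∂noiseLaw G N σ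
      = if p = q then (σ : ℂ) ^ 2 * (conj (u p) * u' q + conj (v p) * v' q) else 0 := by
    intro q
    rw [integral_fun_add_add_add ((i2 p q).const_mul _) ((i2 q p).const_mul _)
        ((i1 p q).const_mul _) ((i3 p q).const_mul _),
      integral_const_mul, integral_const_mul, integral_const_mul, integral_const_mul,
      integral_conj, integral_noise_mul_noise hσ, integral_conj_noise_mul_noise hσ,
      integral_conj_noise_mul_noise hσ]
    simp only [eq_comm (a := q)]
    split_ifs
    · simp only [map_zero]
      ring
    · simp
  simp only [h, Finset.sum_ite_eq, Finset.mem_univ, if_true]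

end Noise

/-! ### The score is linear in the noise -/

section Score

variable {N G m L : ℕ} {σ : ℝ} (s : Fin G → Fin N → ℂ) (f : Fin m → ℝ) (α : Fin m → ℂ)
  (γ : Fin L → ℂ)

/-- The noise `y - S h`. -/
def residual (s : Fin G → Fin N → ℂ) (h : Fin N → ℂ) (y : Fin G → Fin N → ℂ) :
    Fin G → Fin N → ℂ := fun g k => y g k - s g k * h k

/-- The log-likelihood as a function of the channel response. -/
def logLik (σ : ℝ) (s : Fin G → Fin N → ℂ) (y : Fin G → Fin N → ℂ) (h : Fin N → ℂ) : ℝ :=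
  ∑ g, (N * Real.log (Real.pi * σ ^ 2)⁻¹ - (∑ k, ‖residual s h y g k‖ ^ 2) / σ ^ 2)

lemma sub_pilot_mulVec (h : Fin N → ℂ) (y : Fin G → Fin N → ℂ) (g : Fin G) :
    y g - (pilot (s g)).mulVec h = residual s h y g := by
  funext k
  simp [pilot, residual, Matrix.mulVec_diagonal]

lemma logLikelihood_eq (hσ : 0 < σ) (y : Fin G → Fin N → ℂ) :
    logLikelihood σ s f α γ y = logLik σ s y (channel N f α γ) := by
  have hπ := Real.pi_pos
  rw [logLikelihood, likelihood, logLik, Real.log_prod]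
  · refine Finset.sum_congr rfl fun g _ => ?_
    rw [sub_pilot_mulVec, circGaussianDensity, Real.log_mul (by positivity) (Real.exp_ne_zero _),
      Real.log_pow, Real.log_exp]
    ring
  · intro g _
    rw [circGaussianDensity]
    positivity

lemma likelihood_eq_prod (y : Fin G → Fin N → ℂ) : likelihood σ s f α γ y
    = ∏ g, ∏ k, noiseDensity σ (residual s (channel N f α γ) y g k) := by
  refine Finset.prod_congr rfl fun g _ => ?_
  rw [sub_pilot_mulVec, circGaussianDensity]
  simp only [noiseDensity]
  rw [Finset.prod_mul_distrib, Finset.prod_const, Finset.card_univ, Fintype.card_fin,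
    ← Real.exp_sum, ← Finset.sum_div, Finset.sum_neg_distrib]

/-- The Wirtinger derivative of the log-likelihood when the channel varies holomorphically in the
direction `V`. -/
def holoScore (σ : ℝ) (s : Fin G → Fin N → ℂ) (V : Fin N → ℂ) (n : Fin G → Fin N → ℂ) : ℂ :=
  ∑ g, ∑ k, conj (n g k) * (s g k * V k) / (σ : ℂ) ^ 2

lemma holoScore_I_mul (V : Fin N → ℂ) (n : Fin G → Fin N → ℂ) :
    holoScore σ s (fun k => Complex.I * V k) n = Complex.I * holoScore σ s V n := by
  simp only [holoScore, Finset.mul_sum]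
  refine Finset.sum_congr rfl fun g _ => Finset.sum_congr rfl fun k _ => ?_
  ring

lemma hasDerivAt_logLik (y : Fin G → Fin N → ℂ) {h : ℝ → Fin N → ℂ} {V : Fin N → ℂ} {t₀ : ℝ}
    (hd : ∀ k, HasDerivAt (fun t => h t k) (V k) t₀) :
    HasDerivAt (fun t => logLik σ s y (h t))
      (2 * (holoScore σ s V (residual s (h t₀) y)).re) t₀ := by
  have h1 : ∀ g k, HasDerivAt (fun t => ‖residual s (h t) y g k‖ ^ 2)
      (2 * inner ℝ (residual s (h t₀) y g k) (-(s g k * V k))) t₀ := fun g k =>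
    (((hd k).const_mul (s g k)).const_sub (y g k)).norm_sq
  have h2 := HasDerivAt.fun_sum (u := Finset.univ) fun g _ =>
    ((HasDerivAt.fun_sum (u := Finset.univ) fun k _ => h1 g k).div_const (σ ^ 2)).const_sub
      (N * Real.log (Real.pi * σ ^ 2)⁻¹)
  refine h2.congr_deriv ?_
  rw [holoScore, Complex.re_sum, Finset.mul_sum]
  refine Finset.sum_congr rfl fun g _ => ?_
  rw [Complex.re_sum, Finset.mul_sum, Finset.sum_div, ← Finset.sum_neg_distrib]
  refine Finset.sum_congr rfl fun k _ => ?_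
  rw [Complex.inner, neg_mul, Complex.neg_re, mul_comm (s g k * V k), ← Complex.ofReal_pow, Complex.div_ofReal_re]
  ring

lemma sum_apply_update {ι X : Type*} [Fintype ι] [DecidableEq ι] (F : ι → X → ℂ) (x : ι → X)
    (i : ι) (z : X) : ∑ j, F j (Function.update x i z j) = ∑ j, F j (x j) + (F i z - F i (x i)) := by
  rw [← Finset.add_sum_erase _ _ (Finset.mem_univ i),
    ← Finset.add_sum_erase _ (fun j => F j (x j)) (Finset.mem_univ i), Function.update_self]
  have h : ∀ j ∈ Finset.univ.erase i, F j (Function.update x i z j) = F j (x j) := fun j hj => by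
    rw [Function.update_of_ne (Finset.ne_of_mem_erase hj)]
  rw [Finset.sum_congr rfl h]
  ring

lemma channel_apply (k : Fin N) : channel N f α γ k = ∑ i, steering N (f i) k * α i
    + ∑ r : Fin L, steering N (-(((r : ℕ) : ℝ) / (L : ℝ))) k * γ r := rfl

lemma channel_update_freq (i : Fin m) (t : ℝ) (k : Fin N) :
    channel N (Function.update f i t) α γ k
      = channel N f α γ k + (steering N t k * α i - steering N (f i) k * α i) := by
  rw [channel_apply, channel_apply, sum_apply_update (fun i t => steering N t k * α i)]
  ring

lemma channel_update_sparse (i : Fin m) (z : ℂ) (k : Fin N) :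
    channel N f (Function.update α i z) γ k
      = channel N f α γ k + (z - α i) * steering N (f i) k := by
  rw [channel_apply, channel_apply, sum_apply_update (fun i z => steering N (f i) k * z)]
  ring

lemma channel_update_diffuse (r : Fin L) (z : ℂ) (k : Fin N) :
    channel N f α (Function.update γ r z) k
      = channel N f α γ k + (z - γ r) * steering N (-(((r : ℕ) : ℝ) / (L : ℝ))) k := by
  rw [channel_apply, channel_apply, sum_apply_update
    (fun (r : Fin L) z => steering N (-(((r : ℕ) : ℝ) / (L : ℝ))) k * z)]
  ring

lemma hasDerivAt_channel_freq (i : Fin m) (k : Fin N) :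
    HasDerivAt (fun t => channel N (Function.update f i t) α γ k)
      (response N f α (L := L) (Sum.inl i) k) (f i) := by
  simp only [channel_update_freq]
  have h : HasDerivAt (fun t : ℝ => steering N t k)
      (2 * Real.pi * Complex.I * (((k : ℕ) - ((N : ℝ) - 1) / 2 : ℝ) : ℂ) * steering N (f i) k)
      (f i) := by
    have h1 : HasDerivAt (fun t : ℝ => 2 * (Real.pi : ℂ) * Complex.I *
        (((k : ℕ) : ℂ) - ((N : ℂ) - 1) / 2) * (t : ℂ)) (2 * (Real.pi : ℂ) * Complex.I *
        (((k : ℕ) : ℂ) - ((N : ℂ) - 1) / 2)) (f i) := by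
      simpa using (Complex.ofRealCLM.hasDerivAt (x := f i)).const_mul (2 * (Real.pi : ℂ) *
        Complex.I * (((k : ℕ) : ℂ) - ((N : ℂ) - 1) / 2))
    refine h1.cexp.congr_deriv ?_
    rw [steering]
    push_cast
    ring
  refine (((h.mul_const (α i)).sub_const _).const_add _).congr_deriv ?_
  rw [response]
  ring

/-- The channel is affine in `z`, so the derivatives along `1` and `i` are `2 Re Z` and `-2 Im Z`
with `Z = holoScore`; the two Wirtinger combinations then give `Z` and its conjugate. -/
lemma wirtinger_logLik (y : Fin G → Fin N → ℂ) {h : ℂ → Fin N → ℂ} {V : Fin N → ℂ} {z₀ : ℂ}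
    (hV : ∀ z k, h z k = h z₀ k + (z - z₀) * V k) :
    wirtinger (fun z => logLik σ s y (h z)) z₀ = holoScore σ s V (residual s (h z₀) y) ∧
    wirtingerConj (fun z => logLik σ s y (h z)) z₀
      = conj (holoScore σ s V (residual s (h z₀) y)) := by
  have h1 : ∀ c : ℂ, HasDerivAt (fun t : ℝ => logLik σ s y (h (z₀ + t * c)))
      (2 * (holoScore σ s (fun k => c * V k) (residual s (h z₀) y)).re) 0 := by
    intro c
    have := hasDerivAt_logLik (σ := σ) s y (h := fun t : ℝ => h (z₀ + t * c))
      (V := fun k => c * V k) (t₀ := 0) fun k => by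
        have e : ∀ t : ℝ, h (z₀ + t * c) k = h z₀ k + (t : ℂ) * (c * V k) := fun t => by
          rw [hV]
          ring
        simp only [e]
        simpa using ((Complex.ofRealCLM.hasDerivAt (x := 0)).mul_const (c * V k)).const_add (h z₀ k)
    simpa using this
  have h2 := (h1 1).deriv
  have h3 := (h1 Complex.I).deriv
  simp only [mul_one, one_mul] at h2
  rw [holoScore_I_mul, Complex.I_mul_re] at h3
  set Z := holoScore σ s V (residual s (h z₀) y)
  rw [wirtinger, wirtingerConj, h2, h3]
  constructor
  · conv_rhs => rw [← Complex.re_add_im Z]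
    push_cast
    ring
  · conv_rhs => rw [← Complex.re_add_im Z]
    simp only [map_add, map_mul, Complex.conj_ofReal, Complex.conj_I]
    push_cast
    ring

/-- Coefficients of the noise in the score. -/
def scoreCoeff (σ : ℝ) (s : Fin G → Fin N → ℂ) (f : Fin m → ℝ) (α : Fin m → ℂ)
    (a : ParamIdx m L) (p : Fin G × Fin N) : ℂ :=
  conj (s p.1 p.2) * responseConj N f α a p.2 / (σ : ℂ) ^ 2

/-- Coefficients of the conjugate of the noise in the score. -/
def scoreCoeffConj (σ : ℝ) (s : Fin G → Fin N → ℂ) (f : Fin m → ℝ) (α : Fin m → ℂ)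
    (a : ParamIdx m L) (p : Fin G × Fin N) : ℂ :=
  s p.1 p.2 * response N f α a p.2 / (σ : ℂ) ^ 2

/-- A uniform shape for all coordinates: `α` and `γ` have only the first term and their conjugates
only the second, while for a real frequency the two terms are conjugate and add up to twice a real
part. -/
lemma noiseFunctional_score (a : ParamIdx m L) (n : Fin G → Fin N → ℂ) :
    noiseFunctional (scoreCoeff σ s f α a) (scoreCoeffConj σ s f α a) n
      = holoScore σ s (response N f α a) n
        + conj (holoScore σ s (fun k => conj (responseConj N f α a k)) n) := by
  simp only [noiseFunctional, holoScore, Fintype.sum_prod_type, map_sum,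
    ← Finset.sum_add_distrib]
  refine Finset.sum_congr rfl fun g _ => Finset.sum_congr rfl fun k _ => ?_
  simp only [scoreCoeff, scoreCoeffConj, map_mul, map_div₀, map_pow, Complex.conj_conj,
    Complex.conj_ofReal]
  ring

theorem score_eq_noiseFunctional (hσ : 0 < σ) (a : ParamIdx m L) (y : Fin G → Fin N → ℂ) :
    score σ s f α γ a y = noiseFunctional (scoreCoeff σ s f α a) (scoreCoeffConj σ s f α a)
      (residual s (channel N f α γ) y) := by
  have h0 : ∀ n : Fin G → Fin N → ℂ, holoScore σ s (fun _ => 0) n = 0 := fun n => by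
    simp [holoScore]
  rw [noiseFunctional_score]
  rcases a with i | (i | r) | (i | r) <;> simp only [score, logLikelihood_eq _ _ _ _ hσ]
  · have h := (hasDerivAt_logLik (σ := σ) s y
      (fun k => hasDerivAt_channel_freq f α γ i k)).deriv
    rw [h, Function.update_eq_self]
    simp only [responseConj, Complex.conj_conj]
    exact (Complex.add_conj _).symm
  · have h := (wirtinger_logLik (σ := σ) s y
      (h := fun z => channel N f (Function.update α i z) γ) (z₀ := α i)
      (V := fun k => steering N (f i) k) fun z k => by
        rw [Function.update_eq_self, channel_update_sparse]).1
    rw [h, Function.update_eq_self]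
    simp only [responseConj, map_zero, h0, add_zero]
    rfl
  · have h := (wirtinger_logLik (σ := σ) s y
      (h := fun z => channel N f α (Function.update γ r z)) (z₀ := γ r)
      (V := fun k => steering N (-(((r : ℕ) : ℝ) / (L : ℝ))) k) fun z k => by
        rw [Function.update_eq_self, channel_update_diffuse]).1
    rw [h, Function.update_eq_self]
    simp only [responseConj, map_zero, h0, add_zero]
    rfl
  · have h := (wirtinger_logLik (σ := σ) s y
      (h := fun z => channel N f (Function.update α i z) γ) (z₀ := α i)
      (V := fun k => steering N (f i) k) fun z k => by
        rw [Function.update_eq_self, channel_update_sparse]).2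
    rw [h, Function.update_eq_self]
    simp only [responseConj, Complex.conj_conj]
    rw [← zero_add (conj _)]
    exact congrArg₂ _ (h0 _).symm rfl
  · have h := (wirtinger_logLik (σ := σ) s y
      (h := fun z => channel N f α (Function.update γ r z)) (z₀ := γ r)
      (V := fun k => steering N (-(((r : ℕ) : ℝ) / (L : ℝ))) k) fun z k => by
        rw [Function.update_eq_self, channel_update_diffuse]).2
    rw [h, Function.update_eq_self]
    simp only [responseConj, Complex.conj_conj]
    rw [← zero_add (conj _)]
    exact congrArg₂ _ (h0 _).symm rfl

/-! ### The Fisher information -/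

/-- The residual map is a translation, and the likelihood is the noise density composed with it. -/
lemma measurePreserving_residual (hσ : 0 < σ) :
    MeasurePreserving (residual s (channel N f α γ)) (obsLaw σ s f α γ) (noiseLaw G N σ) := by
  have hT : MeasurePreserving (residual s (channel N f α γ)) volume volume :=
    measurePreserving_sub_right volume (fun g k => s g k * channel N f α γ k)
  have hW : Measurable fun n : Fin G → Fin N → ℂ =>
      ENNReal.ofReal (∏ g, ∏ k, noiseDensity σ (n g k)) := by
    have hc := continuous_noiseDensity σ
    refine Measurable.ennreal_ofReal (Continuous.measurable ?_)
    fun_prop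
  have h := measurePreserving_withDensity_comp hT hW
  rw [← noiseLaw_eq_withDensity G N hσ] at h
  simp only [← likelihood_eq_prod] at h
  exact h

theorem memLp_score (hσ : 0 < σ) (a : ParamIdx m L) :
    MemLp (score σ s f α γ a) 2 (obsLaw σ s f α γ) := by
  have e : score σ s f α γ a = noiseFunctional (scoreCoeff σ s f α a) (scoreCoeffConj σ s f α a) ∘
      residual s (channel N f α γ) := funext fun y => score_eq_noiseFunctional s f α γ hσ a y
  rw [e]
  exact (memLp_noiseFunctional hσ _ _).comp_measurePreserving
    (measurePreserving_residual s f α γ hσ)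

variable {s}

/-- The score coefficients carry `1/σ²` each and the noise covariance is `σ²`. Unit-modulus pilots
cancel, so all `G` snapshots contribute equally. -/
theorem fisherInfo_eq (hσ : 0 < σ) (hs : ∀ g k, ‖s g k‖ = 1) :
    fisherInfo σ s f α γ = ((G / σ ^ 2 : ℝ) : ℂ) • gram L N f α := by
  ext a b
  have hT := measurePreserving_residual s f α γ hσ
  have h := integral_map hT.measurable.aemeasurable
    (f := fun n => conj (noiseFunctional (scoreCoeff σ s f α a) (scoreCoeffConj σ s f α a) n) *
      noiseFunctional (scoreCoeff σ s f α b) (scoreCoeffConj σ s f α b) n)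
    (by
      rw [hT.map_eq]
      exact (memLp_noiseFunctional hσ _ _).aestronglyMeasurable.star.mul
        (memLp_noiseFunctional hσ _ _).aestronglyMeasurable)
  rw [hT.map_eq, integral_conj_noiseFunctional_mul hσ] at h
  rw [fisherInfo, Matrix.of_apply]
  simp only [score_eq_noiseFunctional s f α γ hσ]
  rw [← h, Matrix.smul_apply, gram, Matrix.of_apply, Fintype.sum_prod_type]
  have e : ∀ g, ∑ k, (conj (scoreCoeff σ s f α a (g, k)) * scoreCoeff σ s f α b (g, k)
      + conj (scoreCoeffConj σ s f α a (g, k)) * scoreCoeffConj σ s f α b (g, k))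
      = (∑ k, (conj (responseConj N f α a k) * responseConj N f α b k
        + conj (response N f α a k) * response N f α b k)) / (σ : ℂ) ^ 4 := by
    intro g
    rw [Finset.sum_div]
    refine Finset.sum_congr rfl fun k _ => ?_
    have h1 : conj (s g k) * s g k = 1 := by
      rw [Complex.conj_mul', hs]
      simp
    simp only [scoreCoeff, scoreCoeffConj, map_mul, map_div₀, map_pow, Complex.conj_conj,
      Complex.conj_ofReal]
    have hσ' : (σ : ℂ) ≠ 0 := Complex.ofReal_ne_zero.mpr hσ.ne'
    field_simp
    linear_combination (conj (responseConj N f α a k) * responseConj N f α b k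
        + conj (response N f α a k) * response N f α b k) * h1
  simp only [e, Finset.sum_const, Finset.card_univ, Fintype.card_fin]
  have hσ' : (σ : ℂ) ≠ 0 := Complex.ofReal_ne_zero.mpr hσ.ne'
  rw [nsmul_eq_mul, smul_eq_mul]
  push_cast
  field_simp

end Score

/-! ### Bounds for the diagonal of the inverse Fisher information -/

section CramerRao

variable {N G m L : ℕ} {σ : ℝ} {s : Fin G → Fin N → ℂ} {f : Fin m → ℝ} {α : Fin m → ℂ}
  (γ : Fin L → ℂ)

lemma norm_pilot_entry
    {v : Fin N → ℂ} (h : (pilot v).conjTranspose * pilot v = 1) (k : Fin N) : ‖v k‖ = 1 := by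
  have h1 := congrFun (congrFun h k) k
  rw [pilot, Matrix.diagonal_conjTranspose, Matrix.diagonal_mul_diagonal, Matrix.diagonal_apply_eq,
    Matrix.one_apply_eq, Pi.star_apply, RCLike.star_def, Complex.conj_mul'] at h1
  have h2 : ‖v k‖ ^ 2 = 1 := by exact_mod_cast h1
  exact (pow_eq_one_iff_of_nonneg (norm_nonneg _) two_ne_zero).mp h2

lemma crb_eq (hσ : 0 < σ) (hG : 0 < G) (hs : ∀ g k, ‖s g k‖ = 1) (a : ParamIdx m L)
    (hK : (gram L N f α).PosDef) :
    crb σ s f α γ a = σ ^ 2 / G * ((gram L N f α)⁻¹ a a).re := by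
  have hG' : (0 : ℝ) < G := by exact_mod_cast hG
  have hc : ((G / σ ^ 2 : ℝ) : ℂ) ≠ 0 := Complex.ofReal_ne_zero.mpr (by positivity)
  have hinv : (((G / σ ^ 2 : ℝ) : ℂ) • gram L N f α)⁻¹
      = ((G / σ ^ 2 : ℝ) : ℂ)⁻¹ • (gram L N f α)⁻¹ := by
    refine Matrix.inv_eq_right_inv ?_
    rw [Matrix.smul_mul, Matrix.mul_smul, smul_smul, mul_inv_cancel₀ hc, one_smul,
      Matrix.mul_nonsing_inv _ ((Matrix.isUnit_iff_isUnit_det _).mp hK.isUnit)]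
  rw [crb, fisherInfo_eq f α γ hσ hs, hinv, Matrix.smul_apply, smul_eq_mul, ← Complex.ofReal_inv,
    Complex.re_ofReal_mul, inv_div]

lemma Kmin_le_one_div {x : ℝ} (δ : ℝ) (hG : 0 < G) (hx : x = N * δ) (h : 2 < x) :
    Kmin G N δ ≤ 1 / G := by
  have hG' : (0 : ℝ) < G := by exact_mod_cast hG
  rw [Kmin, ← hx]
  refine one_div_le_one_div_of_le hG' (le_mul_of_one_le_right hG'.le ?_)
  have : 0 < x⁻¹ := inv_pos.mpr (by linarith)
  linarith

/-- Two-sided bounds for a Cramér-Rao bound, given the corresponding diagonal entry `M` of the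
Gram matrix. -/
lemma crb_bounds {δ : ℝ} (hσ : 0 < σ) (hG : 0 < G) (hs : ∀ g k, ‖s g k‖ = 1)
    (hK : (gram L N f α).PosDef) (hx : 2 < (N : ℝ) * δ) {a : ParamIdx m L}
    (ha : ((gram L N f α)⁻¹ a a).re ≤ 1 / ((1 - 2 / (N * δ)) * (gram L N f α a a).re)) :
    Kmin G N δ * σ ^ 2 ≤ (gram L N f α a a).re * crb σ s f α γ a ∧
    (gram L N f α a a).re * crb σ s f α γ a ≤ Kmax G N δ * σ ^ 2 := by
  have hG' : (0 : ℝ) < G := by exact_mod_cast hG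
  have hpos : 0 < (gram L N f α a a).re := (Complex.lt_def.mp hK.diag_pos).1
  have hlow := one_div_diag_le_inv_diag hK a
  have hκ : 0 < 1 - 2 / (N * δ) := by
    rw [sub_pos, div_lt_one (by linarith)]
    exact hx
  rw [crb_eq γ hσ hG hs a hK]
  set M := (gram L N f α a a).re
  set R := ((gram L N f α)⁻¹ a a).re
  have e : M * (σ ^ 2 / G * R) = σ ^ 2 / G * (R * M) := by ring
  rw [e]
  constructor
  · have h1 : 1 ≤ R * M := (div_le_iff₀ hpos).mp hlow
    calc Kmin G N δ * σ ^ 2 ≤ 1 / G * σ ^ 2 :=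
          mul_le_mul_of_nonneg_right (Kmin_le_one_div δ hG rfl hx) (sq_nonneg σ)
      _ = σ ^ 2 / G * 1 := by ring
      _ ≤ σ ^ 2 / G * (R * M) := mul_le_mul_of_nonneg_left h1 (by positivity)
  · have h1 : R * M ≤ 1 / (1 - 2 / (N * δ)) := by
      refine (mul_le_mul_of_nonneg_right ha hpos.le).trans (le_of_eq ?_)
      field_simp
    calc σ ^ 2 / G * (R * M) ≤ σ ^ 2 / G * (1 / (1 - 2 / (N * δ))) :=
          mul_le_mul_of_nonneg_left h1 (by positivity)
      _ = Kmax G N δ * σ ^ 2 := by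
          rw [Kmax, ← div_eq_mul_inv, div_mul_div_comm, mul_one, div_mul_eq_mul_div, one_mul]

end CramerRao

end HybridChannel

end

/-! ### Assembly of the Cramér-Rao bounds -/

theorem proposition4 (N G m L : ℕ) (hG : 0 < G) (hm : 0 < m) (hL : 0 < L)
    (σ : ℝ) (hσ : 0 < σ)
    (s : Fin G → Fin N → ℂ)
    (hs : ∀ g, (HybridChannel.pilot (s g)).conjTranspose * HybridChannel.pilot (s g) = 1)
    (f : Fin m → ℝ) (α : Fin m → ℂ) (γ : Fin L → ℂ)
    (hα : ∀ i, α i ≠ 0)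
    (δ : ℝ) (hδ : δ = HybridChannel.minSep L f)
    (hN : 3 * m + 3 * L ≤ 2 * N)
    (hsep : 2 < (N : ℝ) * δ) :
    -- the Fisher information exists and is invertible, so that the bounds are well defined
    (∀ a, MeasureTheory.MemLp (HybridChannel.score σ s f α γ a) 2
        (HybridChannel.obsLaw σ s f α γ)) ∧
    (HybridChannel.fisherInfo σ s f α γ).PosDef ∧
    -- frequencies
    (∀ i : Fin m,
      HybridChannel.Kmin G N δ * (‖α i‖ ^ 2)⁻¹ * σ ^ 2 ≤
          2 * Real.pi ^ 2 * (N : ℝ) * ((N : ℝ) - 1) * ((N : ℝ) + 1) / 3 *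
            HybridChannel.crb σ s f α γ (HybridChannel.idxFreq L i) ∧
      2 * Real.pi ^ 2 * (N : ℝ) * ((N : ℝ) - 1) * ((N : ℝ) + 1) / 3 *
            HybridChannel.crb σ s f α γ (HybridChannel.idxFreq L i) ≤
          HybridChannel.Kmax G N δ * (‖α i‖ ^ 2)⁻¹ * σ ^ 2) ∧
    -- sparse amplitudes
    (∀ i : Fin m,
      HybridChannel.Kmin G N δ * (σ ^ 2 / (N : ℝ)) ≤
          HybridChannel.crb σ s f α γ (HybridChannel.idxSparse L i) ∧
      HybridChannel.crb σ s f α γ (HybridChannel.idxSparse L i) ≤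
          HybridChannel.Kmax G N δ * (σ ^ 2 / (N : ℝ))) ∧
    -- diffuse amplitudes
    (∀ r : Fin L,
      HybridChannel.Kmin G N δ * (σ ^ 2 / (N : ℝ)) ≤
          HybridChannel.crb σ s f α γ (HybridChannel.idxDiffuse m r) ∧
      HybridChannel.crb σ s f α γ (HybridChannel.idxDiffuse m r) ≤
          HybridChannel.Kmax G N δ * (σ ^ 2 / (N : ℝ))) := by
  have hx0 : 0 < (N : ℝ) * δ := by linarith
  have hδ0 : 0 < δ := pos_of_mul_pos_right hx0 (Nat.cast_nonneg N)
  have hsep' : ∀ i j, i ≠ j → ∀ k : ℤ,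
      δ ≤ |HybridChannel.nodes L f i - HybridChannel.nodes L f j + k| := by
    rw [hδ] at hδ0 ⊢
    exact HybridChannel.minSep_le_nodes hm hL hδ0
  have hhalf : δ ≤ 1 / 2 := by
    have hL1 : (1 : ℝ) ≤ L := by exact_mod_cast hL
    rw [hδ] at hδ0 ⊢
    refine (HybridChannel.minSep_le_one_div hm hL hδ0).trans ?_
    exact one_div_le_one_div_of_le two_pos (by linarith)
  -- `N δ > 2` with `δ ≤ 1/2` forces `N > 4`; the numerical constants of the moment bounds rely on
  -- `N ≥ 5`.
  have hN5 : 5 ≤ N := by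
    have h4 : (4 : ℝ) < N := by nlinarith [(Nat.cast_nonneg N : (0 : ℝ) ≤ N)]
    have : 4 < N := by exact_mod_cast h4
    omega
  have hNpos : (0 : ℝ) < N := by
    have : 0 < N := by omega
    exact_mod_cast this
  have hsu : ∀ g k, ‖s g k‖ = 1 := fun g k => HybridChannel.norm_pilot_entry (hs g) k
  obtain ⟨hK, hfreq, hamp⟩ :=
    HybridChannel.gram_inv_bounds (L := L) hα hδ0 (by linarith) hsep' hN5 hsep
  have hampBound : ∀ j : Fin m ⊕ Fin L,
      HybridChannel.Kmin G N δ * (σ ^ 2 / (N : ℝ)) ≤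
          HybridChannel.crb σ s f α γ (Sum.inr (Sum.inl j)) ∧
      HybridChannel.crb σ s f α γ (Sum.inr (Sum.inl j)) ≤
          HybridChannel.Kmax G N δ * (σ ^ 2 / (N : ℝ)) := by
    intro j
    have h := HybridChannel.crb_bounds γ hσ hG hsu hK hsep (hamp j)
    rw [HybridChannel.gram_amp_self, Complex.ofReal_re] at h
    rw [← mul_div_assoc, ← mul_div_assoc, div_le_iff₀' hNpos, le_div_iff₀' hNpos]
    exact h
  refine ⟨HybridChannel.memLp_score s f α γ hσ, ?_, fun i => ?_, fun i => hampBound (Sum.inl i),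
    fun r => hampBound (Sum.inr r)⟩
  · rw [HybridChannel.fisherInfo_eq f α γ hσ hsu]
    refine hK.smul ?_
    have hG' : (0 : ℝ) < G := by exact_mod_cast hG
    exact Complex.zero_lt_real.mpr (by positivity)
  · have h := HybridChannel.crb_bounds γ hσ hG hsu hK hsep (hfreq i)
    rw [HybridChannel.gram_inl_self, Complex.ofReal_re] at h
    have hi : 0 < ‖α i‖ ^ 2 := pow_pos (norm_pos_iff.mpr (hα i)) 2
    -- The diagonal entry is `‖α i‖²` times the normalisation of the statement, as `8/12 = 2/3` and
    -- `N² - 1 = (N - 1)(N + 1)`.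
    have e : 8 * Real.pi ^ 2 * ‖α i‖ ^ 2 * (N * ((N : ℝ) ^ 2 - 1) / 12) *
        HybridChannel.crb σ s f α γ (Sum.inl i)
        = ‖α i‖ ^ 2 * (2 * Real.pi ^ 2 * (N : ℝ) * ((N : ℝ) - 1) * ((N : ℝ) + 1) / 3 *
            HybridChannel.crb σ s f α γ (HybridChannel.idxFreq L i)) := by
      rw [HybridChannel.idxFreq]
      ring
    rw [e] at h
    rw [mul_right_comm, mul_right_comm (HybridChannel.Kmax G N δ), ← div_eq_mul_inv,
      ← div_eq_mul_inv, div_le_iff₀' hi, le_div_iff₀' hi]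
    exact h
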